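/- Let $n\ge 2$. **The space $\overline{M}_{n,1}$.** A stable $(n+1)$-marked nodal quilted disk is a finite tree of disks, glued at pairs of boundary points (nodes), with markings $z_0,z_1,\dots,z_n$ on the boundary, distinct from the nodes and in this order along the boundary. Some components are quilted: they carry a circle tangent to the boundary exactly at the special point (marking or node) nearest to $z_0$. Every path from a marking $z_i$, $i\ge 1$, to $z_0$ meets exactly one quilted component; quilted components have at least two and unquilted ones at least three special points. An isomorphism consists of holomorphic isomorphisms of the components, preserving nodes, markings and circles. Equivalently, put on each component $\alpha$ the special point nearest to $z_0$ at $\infty$. Then $\alpha$ is the closed upper half plane with $\infty$, the other special points are real numbers, the circle is a horizontal line of height $y_\alpha>0$, and the isomorphisms are the maps $w\mapsto aw+b$ with $a>0$, $b\in\mathbb{R}$. Let $\overline{M}_{n,1}$ be the set of isomorphism classes. For a component $\alpha$ let $z_{\alpha i}$ be the special point of $\alpha$ that is $z_i$ or the node in the direction of $z_i$ (so $z_{\alpha 0}=\infty$). If $\alpha$ is unquilted, let $y_\alpha=0$ if the quilted components on the paths through $\alpha$ lie further from $z_0$ than $\alpha$, and $y_\alpha=\infty$ if they lie closer to $z_0$.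 For $0\le i<j<k<l\le n$ let $\rho_{ijkl}\in[-\infty,0]$ be the value of $$\frac{(w_2-w_3)(w_4-w_1)}{(w_1-w_2)(w_3-w_4)}$$ at $(w_1,w_2,w_3,w_4)=(z_{\alpha i},z_{\alpha j},z_{\alpha k},z_{\alpha l})$, for any component $\alpha$ on which at least three of these points are distinct; the value is $-\infty$ if $w_1=w_2$ or $w_3=w_4$, and $0$ if $w_2=w_3$ or $w_1=w_4$. For $1\le i<j\le n$ let $\rho_{ij}=y_\alpha/(z_{\alpha j}-z_{\alpha i})\in[0,\infty]$, where $\alpha$ is the component on which $z_{\alpha 0},z_{\alpha i},z_{\alpha j}$ are distinct. Give $\overline{M}_{n,1}$ the topology pulled back along the map to $[-\infty,0]^{\binom{n+1}{4}}\times[0,\infty]^{\binom n2}$ formed by all $\rho_{ijkl}$ and $\rho_{ij}$. **The variety $V$.** A maximal colored tree with $n$ leaves is a planar rooted tree with a distinguished set of colored vertices such that every path from a leaf to the root meets exactly one colored vertex, the colored vertices are bivalent, and all other vertices are trivalent. Let $T_1,\dots,T_k$ be an enumeration of these finitely many trees. For such a tree $T$ and $1\le i\le n-1$ let $v_i$ be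 the vertex at which the paths from leaves $i$ and $i+1$ to the root meet, let $a_i$ and $b_i$ be the numbers of leaves on the left and on the right side of $v_i$, and let $\delta_i=1$ if $v_i$ is on the root side of the colored vertices and $\delta_i=0$ otherwise. Set $$\mu_T=\Bigl(a_1b_1(1+\delta_1),\dots,a_{n-1}b_{n-1}(1+\delta_{n-1}),-\sum_{i=1}^{n-1}\delta_ia_ib_i\Bigr)\in\mathbb{Z}^n .$$ Let $V\subset\mathbb{P}^{k-1}(\mathbb{C})$ be the Zariski closure of the set of points $(\underline{x}^{\mu_{T_1}}:\dots:\underline{x}^{\mu_{T_k}})$ with $\underline{x}=(x_1,\dots,x_{n-1},y)\in(\mathbb{C}^*)^n$. Its non-negative part is the set of points of $V$ that have non-negative real homogeneous coordinates, with the topology induced from $\mathbb{P}^{k-1}(\mathbb{C})$. **Theorem.** $\overline{M}_{n,1}$ is homeomorphic to the non-negative part of the projective toric variety $V$. -/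

import Mathlib

open scoped LinearAlgebra.Projectivization OnePoint

/-! ### Nodal quilted disks

A disk component whose special point nearest to the root marking `z₀` is put at `∞` is the closed
upper half plane together with `∞`.  Its remaining special points are real numbers, a circle that
is tangent to the boundary at `∞` is a horizontal line of height `y > 0`, and the holomorphic
isomorphisms that fix `∞` are the maps `w ↦ a * w + b` with `a > 0` and `b` real. -/

/-- A tree of disks with a root.  `marking i` is the marking `z_{i+1}`.
`component seam m pos sub` is a disk component, in the half plane model: its special point nearest
to the root is `∞`, its other special points are `pos 0, …, pos (m-1)`, and at `pos c` it carries
`sub c`, which is either a marking, or a further tree of disks that is attached through a node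
(a node identifies `pos c` with the point `∞` of the root component of `sub c`).
`seam = some y` means that the component is quilted, with seam the line of height `y`;
`seam = none` means that the component is unquilted. -/
inductive NodalDisk (n : ℕ) : Type
  | marking (i : Fin n) : NodalDisk n
  | component (seam : Option ℝ) (m : ℕ) (pos : Fin m → ℝ) (sub : Fin m → NodalDisk n) :
      NodalDisk n

namespace NodalDisk

variable {n : ℕ}

/-- The markings of a nodal disk other than `z₀`, in the order in which they occur along the
boundary. -/
def labels : NodalDisk n → List (Fin n)
  | marking i => [i]
  | component _ m _ sub => (List.finRange m).flatMap fun c => (sub c).labels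

/-- On every component the special points are distinct and in order, the seams are lines in the
open half plane, and the stability condition holds: every quilted component has at least two
special points and every unquilted component has at least three, the point `∞` included. -/
def IsStable : NodalDisk n → Prop
  | marking _ => True
  | component (some y) m pos sub =>
      0 < y ∧ 1 ≤ m ∧ StrictMono pos ∧ ∀ c, (sub c).IsStable
  | component none m pos sub =>
      2 ≤ m ∧ StrictMono pos ∧ ∀ c, (sub c).IsStable

/-- Every path from the root to a marking meets exactly `k` quilted components. -/
def SeamsOnPaths : NodalDisk n → ℕ → Prop
  | marking _, k => k = 0
  | component (some _) _ _ sub, k => ∃ j, k = j + 1 ∧ ∀ c, (sub c).SeamsOnPaths j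
  | component none _ _ sub, k => ∀ c, (sub c).SeamsOnPaths k

/-- Isomorphisms: component by component a holomorphic isomorphism `w ↦ a * w + b` that preserves
the special points and the seams, together with the markings. -/
inductive Iso : NodalDisk n → NodalDisk n → Prop
  | marking (i : Fin n) : Iso (marking i) (marking i)
  | component {seam seam' : Option ℝ} {m : ℕ} {pos pos' : Fin m → ℝ}
      {sub sub' : Fin m → NodalDisk n} (a b : ℝ) (ha : 0 < a)
      (hseam : seam' = seam.map fun y => a * y) (hpos : ∀ c, pos' c = a * pos c + b)
      (hsub : ∀ c, Iso (sub c) (sub' c)) :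
      Iso (component seam m pos sub) (component seam' m pos' sub')

/-! ### Cross-ratios -/

open Classical in
/-- For the root component `α` of a nodal disk, the point `z_{α i}`: the special point of `α` which
is the marking `z_i` or the node in the direction of `z_i`.  It is `∞` for `z₀` and for all
markings that do not lie in the given nodal disk.  The index `i = 0` stands for `z₀`. -/
noncomputable def specialPoint : NodalDisk n → Fin (n + 1) → OnePoint ℝ
  | marking _ => fun _ => ∞
  | component _ _ pos sub => Fin.cases ∞ fun i =>
      if h : ∃ c, i ∈ (sub c).labels then ((pos h.choose : ℝ) : OnePoint ℝ) else ∞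

/-- Some component is quilted. -/
def HasSeam : NodalDisk n → Prop
  | marking _ => False
  | component seam _ _ sub => seam.isSome ∨ ∃ c, (sub c).HasSeam

open Classical in
/-- The height of the line on the root component: the height of the seam if the component is
quilted.  If it is unquilted, the line is at height `0` when the quilted components lie further
away from `z₀`, and at height `∞` when a quilted component lies closer to `z₀`. -/
noncomputable def height : NodalDisk n → EReal
  | marking _ => 0
  | component (some y) _ _ _ => (y : EReal)
  | component none _ _ sub => if ∃ c, (sub c).HasSeam then 0 else ⊤

open Classical in
/-- A component of a nodal disk (with everything beyond it, seen from `z₀`) with the property `P`,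
found by a search that starts at the root. -/
noncomputable def findComponent (P : NodalDisk n → Prop) : NodalDisk n → Option (NodalDisk n)
  | marking _ => none
  | component seam m pos sub =>
      if P (component seam m pos sub) then some (component seam m pos sub)
      else (List.finRange m).findSome? fun c => (sub c).findComponent P

end NodalDisk

/-- The difference `u - v` of two points of the projective line, in homogeneous form: with
`x = (x : 1)` and `∞ = (1 : 0)` it is the determinant of `u` and `v`. -/
def pointDiff : OnePoint ℝ → OnePoint ℝ → ℝ
  | OnePoint.some u, OnePoint.some v => u - v
  | OnePoint.infty, OnePoint.some _ => 1
  | OnePoint.some _, OnePoint.infty => -1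
  | OnePoint.infty, OnePoint.infty => 0

/-- The cross-ratio `(w₂ - w₃) (w₄ - w₁) / ((w₁ - w₂) (w₃ - w₄))` of four points of the projective
line, at least three of which are distinct.  Where the denominator vanishes it is `-∞`, since it is
only used for points in cyclic order. -/
noncomputable def crossRatio (w₁ w₂ w₃ w₄ : OnePoint ℝ) : EReal :=
  if pointDiff w₁ w₂ * pointDiff w₃ w₄ = 0 then ⊥
  else ((pointDiff w₂ w₃ * pointDiff w₄ w₁ / (pointDiff w₁ w₂ * pointDiff w₃ w₄) : ℝ) : EReal)

namespace NodalDisk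

variable {n : ℕ}

/-- At least three of the points `z_{α q₀}, …, z_{α q₃}` on the root component are distinct. -/
def ThreeDistinct (q : Fin 4 → Fin (n + 1)) (D : NodalDisk n) : Prop :=
  3 ≤ (Set.range fun t => D.specialPoint (q t)).ncard

/-- The points `z_{α 0}, z_{α i}, z_{α j}` on the root component are distinct. -/
def MeetsAt (i j : Fin n) (D : NodalDisk n) : Prop :=
  D.specialPoint i.succ ≠ ∞ ∧ D.specialPoint j.succ ≠ ∞ ∧
    D.specialPoint i.succ ≠ D.specialPoint j.succ

/-- The cross-ratio `ρ_{q₀ q₁ q₂ q₃}`, evaluated on a component on which at least three of the four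
points are distinct. -/
noncomputable def rho4 (q : Fin 4 → Fin (n + 1)) (D : NodalDisk n) : EReal :=
  match D.findComponent (ThreeDistinct q) with
  | some E => crossRatio (E.specialPoint (q 0)) (E.specialPoint (q 1))
      (E.specialPoint (q 2)) (E.specialPoint (q 3))
  | none => 0

/-- The function `ρ_{ij} = y / (z_j - z_i)`, evaluated on the component on which `z₀`, `z_i`, `z_j`
are distinct, where `y ∈ [0, ∞]` is the height of the line on that component. -/
noncomputable def rho2 (i j : Fin n) (D : NodalDisk n) : EReal :=
  match D.findComponent (MeetsAt i j) with
  | some E =>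
      E.height / ((pointDiff (E.specialPoint j.succ) (E.specialPoint i.succ) : ℝ) : EReal)
  | none => 0

/-! Isomorphism is an equivalence relation and preserves cross-ratios. -/

lemma Iso.refl (D : NodalDisk n) : Iso D D := by
  induction D with
  | marking i => exact .marking i
  | component seam m pos sub ih => exact .component 1 0 one_pos (by simp) (by simp) ih

lemma Iso.symm {D D' : NodalDisk n} (h : Iso D D') : Iso D' D := by
  induction h with
  | marking i => exact .marking i
  | @component seam seam' m pos pos' sub sub' a b ha hseam hpos _ ih =>
    refine .component a⁻¹ (-(a⁻¹ * b)) (inv_pos.2 ha) ?_ ?_ ih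
    · subst hseam
      cases seam <;> simp [ha.ne']
    · intro c
      rw [hpos]
      field_simp
      ring

lemma Iso.trans {D D' D'' : NodalDisk n} (h : Iso D D') (h' : Iso D' D'') : Iso D D'' := by
  induction h generalizing D'' with
  | marking i => exact h'
  | @component seam seam' m pos pos' sub sub' a b ha hseam hpos _ ih =>
    cases h' with
    | component a' b' ha' hseam' hpos' hsub' =>
      refine .component (a' * a) (a' * b + b') (mul_pos ha' ha) ?_ ?_ fun c => ih c (hsub' c)
      · subst hseam hseam'
        cases seam <;> simp [mul_assoc]
      · intro c
        rw [hpos', hpos]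
        ring

lemma Iso.labels_eq {D D' : NodalDisk n} (h : Iso D D') : D'.labels = D.labels := by
  induction h with
  | marking i => rfl
  | component a b ha hseam hpos _ ih => simp only [labels, ih]

lemma Iso.hasSeam_iff {D D' : NodalDisk n} (h : Iso D D') : D'.HasSeam ↔ D.HasSeam := by
  induction h with
  | marking i => rfl
  | component a b ha hseam hpos _ ih => simp [HasSeam, ih, hseam]

/-- The action of `w ↦ a * w + b` on the boundary of the half plane. -/
def affineMap (a b : ℝ) : OnePoint ℝ → OnePoint ℝ
  | OnePoint.some x => ((a * x + b : ℝ) : OnePoint ℝ)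
  | OnePoint.infty => ∞

lemma affineMap_injective {a : ℝ} (ha : 0 < a) (b : ℝ) : Function.Injective (affineMap a b) := by
  intro u v h
  induction u using OnePoint.rec <;> induction v using OnePoint.rec
  · rfl
  · exact absurd h (OnePoint.infty_ne_coe _)
  · exact absurd h (OnePoint.coe_ne_infty _)
  · have := OnePoint.coe_injective h
    simp only [add_left_inj, mul_eq_mul_left_iff, ha.ne', or_false] at this
    rw [this]

lemma affineMap_eq_infty_iff {a b : ℝ} {u : OnePoint ℝ} : affineMap a b u = ∞ ↔ u = ∞ := by
  induction u using OnePoint.rec with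
  | infty => exact Iff.rfl
  | coe x => exact iff_of_false (OnePoint.coe_ne_infty _) (OnePoint.coe_ne_infty _)

/-- The factors by which `w ↦ a * w + b` changes homogeneous coordinates. -/
noncomputable def affineFactor (a : ℝ) : OnePoint ℝ → ℝ
  | OnePoint.some _ => √a
  | OnePoint.infty => (√a)⁻¹

lemma affineFactor_ne_zero {a : ℝ} (ha : 0 < a) (u : OnePoint ℝ) : affineFactor a u ≠ 0 := by
  have := (Real.sqrt_pos.2 ha).ne'
  induction u using OnePoint.rec with
  | infty => exact inv_ne_zero this
  | coe x => exact this

lemma pointDiff_affineMap {a : ℝ} (ha : 0 < a) (b : ℝ) (u v : OnePoint ℝ) :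
    pointDiff (affineMap a b u) (affineMap a b v)
      = affineFactor a u * affineFactor a v * pointDiff u v := by
  have h0 := (Real.sqrt_pos.2 ha).ne'
  have h1 := Real.mul_self_sqrt ha.le
  induction u using OnePoint.rec <;> induction v using OnePoint.rec
  · change (0 : ℝ) = _ * 0
    simp
  · change (1 : ℝ) = (√a)⁻¹ * √a * 1
    field_simp
  · change (-1 : ℝ) = √a * (√a)⁻¹ * (-1)
    field_simp
  · rename_i x y
    change (a * x + b) - (a * y + b) = √a * √a * (x - y)
    rw [h1]
    ring

lemma crossRatio_affineMap {a : ℝ} (ha : 0 < a) (b : ℝ) (w₁ w₂ w₃ w₄ : OnePoint ℝ) :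
    crossRatio (affineMap a b w₁) (affineMap a b w₂) (affineMap a b w₃) (affineMap a b w₄)
      = crossRatio w₁ w₂ w₃ w₄ := by
  have h1 := affineFactor_ne_zero ha w₁
  have h2 := affineFactor_ne_zero ha w₂
  have h3 := affineFactor_ne_zero ha w₃
  have h4 := affineFactor_ne_zero ha w₄
  unfold crossRatio
  simp only [pointDiff_affineMap ha]
  have hiff : affineFactor a w₁ * affineFactor a w₂ * pointDiff w₁ w₂ *
      (affineFactor a w₃ * affineFactor a w₄ * pointDiff w₃ w₄) = 0 ↔
      pointDiff w₁ w₂ * pointDiff w₃ w₄ = 0 := by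
    simp [h1, h2, h3, h4]
  by_cases h : pointDiff w₁ w₂ * pointDiff w₃ w₄ = 0
  · rw [if_pos h, if_pos (hiff.2 h)]
  · rw [if_neg h, if_neg (mt hiff.1 h)]
    congr 1
    have h5 := left_ne_zero_of_mul h
    have h6 := right_ne_zero_of_mul h
    field_simp

/-- What an isomorphism does to the root component. -/
lemma Iso.root {D D' : NodalDisk n} (h : Iso D D') : ∃ a b : ℝ, 0 < a ∧
    (∀ i, D'.specialPoint i = affineMap a b (D.specialPoint i)) ∧
    D'.height = (a : EReal) * D.height := by
  cases h with
  | marking i => exact ⟨1, 0, one_pos, fun _ => rfl, by simp [height]⟩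
  | @component seam seam' m pos pos' sub sub' a b ha hseam hpos hsub =>
    refine ⟨a, b, ha, ?_, ?_⟩
    · intro i
      refine Fin.cases rfl (fun i => ?_) i
      have hl : ∀ c, (sub' c).labels = (sub c).labels := fun c => (hsub c).labels_eq
      simp only [specialPoint, Fin.cases_succ, hl]
      split_ifs
      · rw [hpos]
        rfl
      · rfl
    · subst hseam
      cases seam with
      | some y => exact EReal.coe_mul a y
      | none =>
        have hs : ∀ c, (sub' c).HasSeam ↔ (sub c).HasSeam := fun c => (hsub c).hasSeam_iff
        simp only [height, Option.map_none]
        by_cases h : ∃ c, (sub c).HasSeam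
        · rw [if_pos h, if_pos (by simpa only [hs] using h), mul_zero]
        · rw [if_neg h, if_neg (by simpa only [hs] using h), EReal.coe_mul_top_of_pos ha]

lemma Iso.findComponent {P : NodalDisk n → Prop} (hP : ∀ D D', Iso D D' → (P D ↔ P D'))
    {D D' : NodalDisk n} (h : Iso D D') :
    Option.Rel Iso (D.findComponent P) (D'.findComponent P) := by
  induction h with
  | marking i => exact .none
  | @component seam seam' m pos pos' sub sub' a b ha hseam hpos hsub ih =>
    have hiso : Iso (.component seam m pos sub) (.component seam' m pos' sub') :=
      .component a b ha hseam hpos hsub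
    simp only [NodalDisk.findComponent]
    by_cases hp : P (.component seam m pos sub)
    · rw [if_pos hp, if_pos ((hP _ _ hiso).1 hp)]
      exact .some hiso
    · rw [if_neg hp, if_neg (mt (hP _ _ hiso).2 hp)]
      generalize List.finRange m = l
      induction l with
      | nil => exact .none
      | cons c l hl =>
        simp only [List.findSome?_cons]
        have := ih c
        cases h1 : (sub c).findComponent P <;> cases h2 : (sub' c).findComponent P <;>
          simp only [h1, h2] at this ⊢
        · exact hl
        · cases this
        · cases this
        · exact this

lemma Iso.rho4_eq {D D' : NodalDisk n} (h : Iso D D') (q : Fin 4 → Fin (n + 1)) :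
    D.rho4 q = D'.rho4 q := by
  have hP : ∀ D D' : NodalDisk n, Iso D D' → (ThreeDistinct q D ↔ ThreeDistinct q D') := by
    intro D D' h
    obtain ⟨a, b, ha, hs, -⟩ := h.root
    have : (Set.range fun t => D'.specialPoint (q t))
        = affineMap a b '' (Set.range fun t => D.specialPoint (q t)) := by
      rw [← Set.range_comp]
      simp only [hs]
      rfl
    rw [ThreeDistinct, ThreeDistinct, this,
      Set.ncard_image_of_injective _ (affineMap_injective ha b)]
  have := h.findComponent hP
  unfold rho4
  generalize D.findComponent (ThreeDistinct q) = E at this ⊢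
  generalize D'.findComponent (ThreeDistinct q) = E' at this ⊢
  cases this with
  | none => rfl
  | some hE =>
    obtain ⟨a, b, ha, hs, -⟩ := hE.root
    simp only [hs, crossRatio_affineMap ha]

lemma Iso.rho2_eq {D D' : NodalDisk n} (h : Iso D D') (i j : Fin n) :
    D.rho2 i j = D'.rho2 i j := by
  have hP : ∀ D D' : NodalDisk n, Iso D D' → (MeetsAt i j D ↔ MeetsAt i j D') := by
    intro D D' h
    obtain ⟨a, b, ha, hs, -⟩ := h.root
    simp only [MeetsAt, hs, ne_eq, affineMap_eq_infty_iff, (affineMap_injective ha b).eq_iff]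
  have key : ∀ (P : NodalDisk n → Prop) (D E : NodalDisk n),
      D.findComponent P = some E → P E := by
    intro P D
    induction D with
    | marking i => intro E hE; cases hE
    | component seam m pos sub ih =>
      intro E hE
      simp only [NodalDisk.findComponent] at hE
      split_ifs at hE with hp
      · cases hE; exact hp
      · obtain ⟨c, -, hc⟩ := List.exists_of_findSome?_eq_some hE
        exact ih c E hc
  have hfind := h.findComponent hP
  have hkey := key (MeetsAt i j) D
  unfold rho2
  generalize D.findComponent (MeetsAt i j) = E at hfind hkey ⊢
  generalize D'.findComponent (MeetsAt i j) = E' at hfind ⊢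
  cases hfind with
  | none => rfl
  | @some E E' hE =>
    obtain ⟨a, b, ha, hs, hh⟩ := hE.root
    obtain ⟨hi, hj, -⟩ := hkey E rfl
    simp only [hs, hh]
    obtain ⟨x, hx⟩ := OnePoint.ne_infty_iff_exists.1 hi
    obtain ⟨z, hz⟩ := OnePoint.ne_infty_iff_exists.1 hj
    rw [← hx, ← hz]
    change E.height / ((z - x : ℝ) : EReal)
      = (a : EReal) * E.height / (((a * z + b) - (a * x + b) : ℝ) : EReal)
    have : (a * z + b) - (a * x + b) = (z - x) * a := by ring
    rw [this, EReal.coe_mul, mul_comm (a : EReal), EReal.mul_div_mul_cancel]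
    · exact EReal.coe_ne_bot a
    · exact EReal.coe_ne_top a
    · exact EReal.coe_ne_zero.2 ha.ne'

end NodalDisk

/-- A stable nodal quilted disk with markings `z₀, z₁, …, z_n` in order along the boundary, such
that every path from a marking `z_i`, `i ≥ 1`, to `z₀` meets exactly one quilted component. -/
structure StableQuiltedDisk (n : ℕ) where
  disk : NodalDisk n
  stable : disk.IsStable
  colored : disk.SeamsOnPaths 1
  labels_eq : disk.labels = List.finRange n

/-- Isomorphism of stable nodal quilted disks. -/
instance StableQuiltedDisk.setoid (n : ℕ) : Setoid (StableQuiltedDisk n) where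
  r S S' := S.disk.Iso S'.disk
  iseqv := ⟨fun _ => .refl _, .symm, .trans⟩

/-- The set of isomorphism classes of stable `n + 1`-marked nodal quilted disks. -/
def QuiltedModuli (n : ℕ) : Type := Quotient (StableQuiltedDisk.setoid n)

namespace QuiltedModuli

/-- All cross-ratios `ρ_{ijkl}`, `0 ≤ i < j < k < l ≤ n`, and `ρ_{ij}`, `1 ≤ i < j ≤ n`. -/
noncomputable def rho (n : ℕ) (S : QuiltedModuli n) :
    ((Fin 4 ↪o Fin (n + 1)) → EReal) × ((Fin 2 ↪o Fin n) → EReal) :=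
  Quotient.lift
    (fun S : StableQuiltedDisk n =>
      ((fun q => S.disk.rho4 q, fun p => S.disk.rho2 (p 0) (p 1)) :
        ((Fin 4 ↪o Fin (n + 1)) → EReal) × ((Fin 2 ↪o Fin n) → EReal)))
    (fun _ _ h => Prod.ext (funext fun q => NodalDisk.Iso.rho4_eq h q)
      (funext fun p => NodalDisk.Iso.rho2_eq h (p 0) (p 1))) S

/-- The topology on the moduli space is pulled back along the cross-ratios. -/
noncomputable instance (n : ℕ) : TopologicalSpace (QuiltedModuli n) :=
  TopologicalSpace.induced (rho n) inferInstance

end QuiltedModuli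

/-! ### Maximal colored trees and their weight vectors -/

/-- Planar rooted trees all of whose vertices are trivalent. -/
inductive TrivalentTree : Type
  | leaf : TrivalentTree
  | node (l r : TrivalentTree) : TrivalentTree

/-- Planar rooted trees with colored vertices, such that the path from the root to any leaf meets
exactly one colored vertex, the colored vertices are bivalent, and all other vertices are
trivalent. `colored t` has a colored vertex closest to the root, with the tree `t` below it;
`node l r` has an uncolored vertex closest to the root. -/
inductive ColoredTree : Type
  | colored (t : TrivalentTree) : ColoredTree
  | node (l r : ColoredTree) : ColoredTree

namespace TrivalentTree

/-- The number of leaves. -/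
def leaves : TrivalentTree → ℕ
  | leaf => 1
  | node l r => l.leaves + r.leaves

/-- `a_i * b_i`, where `v_i` is the vertex at which the paths from the `i`-th and the `i+1`-st leaf
(counted from 1) to the root meet, and `a_i` and `b_i` are the numbers of leaves on its left and on
its right. -/
def split : TrivalentTree → ℕ → ℤ
  | leaf, _ => 0
  | node l r, i =>
      if i < l.leaves then l.split i
      else if i = l.leaves then l.leaves * r.leaves
      else r.split (i - l.leaves)

end TrivalentTree

namespace ColoredTree

/-- The number of leaves. -/
def leaves : ColoredTree → ℕ
  | colored t => t.leaves
  | node l r => l.leaves + r.leaves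

/-- `a_i * b_i`, where `v_i` is the vertex at which the paths from the `i`-th and the `i+1`-st leaf
(counted from 1) to the root meet, and `a_i` and `b_i` are the numbers of leaves on its left and on
its right. -/
def split : ColoredTree → ℕ → ℤ
  | colored t, i => t.split i
  | node l r, i =>
      if i < l.leaves then l.split i
      else if i = l.leaves then l.leaves * r.leaves
      else r.split (i - l.leaves)

/-- `δ_i` is `1` if `v_i` lies above the colored vertices, that is on the side of the root, and `0`
if it lies below them. -/
def delta : ColoredTree → ℕ → ℤ
  | colored _, _ => 0
  | node l r, i =>
      if i < l.leaves then l.delta i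
      else if i = l.leaves then 1
      else r.delta (i - l.leaves)

end ColoredTree

/-- The maximal colored trees with `n` leaves. -/
def MaximalColoredTree (n : ℕ) : Type := {T : ColoredTree // T.leaves = n}

lemma TrivalentTree.leaves_pos : ∀ t : TrivalentTree, 0 < t.leaves
  | leaf => one_pos
  | node l _ => Nat.add_pos_left l.leaves_pos _

lemma ColoredTree.leaves_pos : ∀ t : ColoredTree, 0 < t.leaves
  | colored t => t.leaves_pos
  | node l _ => Nat.add_pos_left l.leaves_pos _

lemma TrivalentTree.finite_leaves_le (n : ℕ) : {t : TrivalentTree | t.leaves ≤ n}.Finite := by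
  induction n with
  | zero => exact Set.finite_empty.subset fun t (ht : t.leaves ≤ 0) =>
      absurd t.leaves_pos (by omega)
  | succ n ih =>
    refine ((Set.finite_singleton leaf).union (ih.image2 node ih)).subset ?_
    rintro (_ | ⟨l, r⟩) ht
    · exact Or.inl rfl
    · have := l.leaves_pos
      have := r.leaves_pos
      simp only [Set.mem_ofPred_eq, leaves] at ht
      exact Or.inr ⟨l, by simp; omega, r, by simp; omega, rfl⟩

lemma ColoredTree.finite_leaves_le (n : ℕ) : {t : ColoredTree | t.leaves ≤ n}.Finite := by
  induction n with
  | zero => exact Set.finite_empty.subset fun t (ht : t.leaves ≤ 0) =>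
      absurd t.leaves_pos (by omega)
  | succ n ih =>
    refine (((TrivalentTree.finite_leaves_le (n + 1)).image colored).union
      (ih.image2 node ih)).subset ?_
    rintro (t | ⟨l, r⟩) ht
    · exact Or.inl ⟨t, ht, rfl⟩
    · have := l.leaves_pos
      have := r.leaves_pos
      simp only [Set.mem_ofPred_eq, leaves] at ht
      exact Or.inr ⟨l, by simp; omega, r, by simp; omega, rfl⟩

instance (n : ℕ) : Finite (MaximalColoredTree n) :=
  ((ColoredTree.finite_leaves_le n).subset fun _ h => le_of_eq h).to_subtype

/-- The weight vector
`μ_T = (a₁ b₁ (1 + δ₁), …, a_{n-1} b_{n-1} (1 + δ_{n-1}), - ∑ i, δ_i a_i b_i)`. -/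
def weightVector {n : ℕ} (T : MaximalColoredTree n) (j : Fin n) : ℤ :=
  if (j : ℕ) + 1 < n then T.1.split (j + 1) * (1 + T.1.delta (j + 1))
  else - ∑ i ∈ Finset.Ico 1 n, T.1.delta i * T.1.split i

/-! ### The toric variety and its non-negative part -/

/-- The quotient topology on complex projective space. -/
noncomputable instance (k : ℕ) : TopologicalSpace (ℙ ℂ (Fin k → ℂ)) :=
  TopologicalSpace.coinduced (Projectivization.mk' ℂ) inferInstance

/-- The vector `(x^{μ_{T₁}}, …, x^{μ_{T_k}})` of monomials in `x = (x₁, …, x_{n-1}, y)`. -/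
noncomputable def monomialVector {n k : ℕ} (T : Fin k → MaximalColoredTree n) (x : Fin n → ℂˣ) : Fin k → ℂ :=
  fun t => ((∏ j, x j ^ weightVector (T t) j : ℂˣ) : ℂ)

/-- The image of `x ↦ (x^{μ_{T₁}} : … : x^{μ_{T_k}})` in projective space of dimension `k - 1`. -/
def monomialImage {n k : ℕ} (T : Fin k → MaximalColoredTree n) : Set (ℙ ℂ (Fin k → ℂ)) :=
  {p | ∃ (x : Fin n → ℂˣ) (h : monomialVector T x ≠ 0), p = Projectivization.mk ℂ _ h}

/-- The Zariski closure of a set in projective space: the common zeros of all homogeneous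
polynomials that vanish on the set. -/
def zariskiClosure {k : ℕ} (A : Set (ℙ ℂ (Fin k → ℂ))) : Set (ℙ ℂ (Fin k → ℂ)) :=
  {p | ∀ (d : ℕ) (f : MvPolynomial (Fin k) ℂ), f.IsHomogeneous d →
    (∀ q ∈ A, MvPolynomial.eval q.rep f = 0) → MvPolynomial.eval p.rep f = 0}

/-- The projective toric variety `V`: the closure of the image of the monomial map. -/
def toricVariety {n k : ℕ} (T : Fin k → MaximalColoredTree n) : Set (ℙ ℂ (Fin k → ℂ)) :=
  zariskiClosure (monomialImage T)

/-- The points of a set in projective space that have non-negative real homogeneous coordinates. -/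
def nonnegPart {k : ℕ} (V : Set (ℙ ℂ (Fin k → ℂ))) : Set (ℙ ℂ (Fin k → ℂ)) :=
  {p | p ∈ V ∧ ∃ (v : Fin k → ℝ) (h : (fun t => (v t : ℂ)) ≠ 0),
    (∀ t, 0 ≤ v t) ∧ p = Projectivization.mk ℂ (fun t => (v t : ℂ)) h}

/-! ### Systems of ratios -/

/-! Both spaces are homeomorphic to one compact space, `RatioSpace n`. Points on a line together
with a height `y` have, up to affine maps, the scale-free coordinates `(z_k - z_p) / (z_q - z_p)`
and `L / (L + y)` with `L = z_q - z_p`, all in `[0, 1]`. `IsRatioSystem` collects closed conditions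
that survive in the limit: monotonicity, and the rules relating nested intervals. For `w` the rule
says that the odds `w / (1 - w) = L / y` get multiplied by the relative width, with denominators
cleared so that `w = 0` and `w = 1` make sense.

Moduli side. Any two markings are separated on exactly one component of a nodal disk, and reading
off ratios there gives a system (`exists_realizes`). Conversely the system of an interval dictates
its root component: the markings sit at the values of `z`, markings with equal value form the
clusters beyond the nodes, and `w` decides where the seam goes (`exists_quilted`). Disks with equal
ratios are isomorphic (`Realizes.iso`). All cross-ratios are continuous functions of the system
(`Realizes.rho_eq`) and determine it (`ratioRho_injective`), so this is a continuous bijection from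
a compact space to a Hausdorff space.

Toric side. Exactly `a_i b_i` pairs of leaves meet at `v_i`, so the monomial of a tree is a product
over all pairs of leaves, with factor `x_i` or `x_i ^ 2 / y` according to the vertex where the pair
meets (`prod_zpow_weightVector`). Dividing the factor of a pair by `L + L ^ 2 / y`, which does not
depend on the tree, turns it into `g * (1 - w)` or `g ^ 2 * w` with `g = x_i / L`. These are
polynomials in the ratios, so the projective point extends continuously to all of `RatioSpace n`; it
stays on the variety because configurations of distinct points are dense (`exists_tendsto`).

The extension is well defined and injective because of a greedy tree (`exists_coloredTree`): for
every choice of scores there is one tree in which all pairs of leaves simultaneously meet at a best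
vertex among those with non-zero factor. Hence some weight is non-zero, and comparing the best with
the worst tree for the difference of two logarithmic systems shows that proportional weights come
from equal systems (`eq_of_treeWeight`). For surjectivity, a non-negative point of the variety
satisfies all binomial equations; Farkas' lemma and logarithms then produce a curve of positive
monomial points converging to it (`exists_tendsto_monomials`), and the image of a compact space is
closed. -/

/-- Limits of the ratios of lengths of a configuration of points `z_0 < … < z_{n-1}` on a line
together with a height `y`.  The number `z p q k` is a limit of `(z_k - z_p) / (z_q - z_p)`, and
`w p q` is a limit of `(z_q - z_p) / (z_q - z_p + y)`. -/
structure IsRatioSystem (n : ℕ) (d : (ℕ → ℕ → ℕ → ℝ) × (ℕ → ℕ → ℝ)) : Prop where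
  z_left : ∀ p q, p < q → q < n → d.1 p q p = 0
  z_right : ∀ p q, p < q → q < n → d.1 p q q = 1
  z_step : ∀ p q k, p < q → q < n → p ≤ k → k < q → d.1 p q k ≤ d.1 p q (k + 1)
  z_comp : ∀ P Q p q k, P ≤ p → p < q → q ≤ Q → Q < n → p ≤ k → k ≤ q →
    d.1 P Q k = d.1 P Q p + (d.1 P Q q - d.1 P Q p) * d.1 p q k
  z_junk : ∀ p q k, ¬ (p < q ∧ q < n ∧ p ≤ k ∧ k ≤ q) → d.1 p q k = 0
  w_nonneg : ∀ p q, p < q → q < n → 0 ≤ d.2 p q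
  w_le_one : ∀ p q, p < q → q < n → d.2 p q ≤ 1
  w_comp : ∀ P Q p q, P ≤ p → p < q → q ≤ Q → Q < n →
    d.2 p q * (1 - d.2 P Q) = (d.1 P Q q - d.1 P Q p) * d.2 P Q * (1 - d.2 p q)
  w_junk : ∀ p q, ¬ (p < q ∧ q < n) → d.2 p q = 0

namespace IsRatioSystem

variable {n : ℕ} {d : (ℕ → ℕ → ℕ → ℝ) × (ℕ → ℕ → ℝ)}

lemma z_mono (h : IsRatioSystem n d) {p q k l : ℕ} (hpk : p ≤ k) (hkl : k ≤ l) (hlq : l ≤ q)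
    (hq : q < n) : d.1 p q k ≤ d.1 p q l := by
  induction l, hkl using Nat.le_induction with
  | base => exact le_rfl
  | succ l hkl ih =>
    exact (ih (by omega)).trans (h.z_step p q l (by omega) hq (by omega) (by omega))

lemma z_nonneg (h : IsRatioSystem n d) (p q k : ℕ) : 0 ≤ d.1 p q k := by
  by_cases hk : p < q ∧ q < n ∧ p ≤ k ∧ k ≤ q
  · rw [← h.z_left p q hk.1 hk.2.1]
    exact h.z_mono le_rfl hk.2.2.1 hk.2.2.2 hk.2.1
  · rw [h.z_junk _ _ _ hk]

lemma z_le_one (h : IsRatioSystem n d) (p q k : ℕ) : d.1 p q k ≤ 1 := by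
  by_cases hk : p < q ∧ q < n ∧ p ≤ k ∧ k ≤ q
  · rw [← h.z_right p q hk.1 hk.2.1]
    exact h.z_mono hk.2.2.1 hk.2.2.2 le_rfl hk.2.1
  · rw [h.z_junk _ _ _ hk]
    exact zero_le_one

end IsRatioSystem

/-- The difference `z p q (i + 1) - z p q i`. -/
def gapRatio (d : (ℕ → ℕ → ℕ → ℝ) × (ℕ → ℕ → ℝ)) (p q i : ℕ) : ℝ := d.1 p q (i + 1) - d.1 p q i

namespace IsRatioSystem

variable {n : ℕ} {d : (ℕ → ℕ → ℕ → ℝ) × (ℕ → ℕ → ℝ)}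

lemma gapRatio_nonneg (h : IsRatioSystem n d) {p q i : ℕ} (hp : p ≤ i) (hi : i < q) (hq : q < n) :
    0 ≤ gapRatio d p q i :=
  sub_nonneg.2 (h.z_step p q i (by omega) hq hp hi)

lemma sum_gapRatio (d : (ℕ → ℕ → ℕ → ℝ) × (ℕ → ℕ → ℝ)) (p q : ℕ) {k l : ℕ} (hkl : k ≤ l) :
    ∑ i ∈ Finset.Ico k l, gapRatio d p q i = d.1 p q l - d.1 p q k :=
  Finset.sum_Ico_sub _ hkl

lemma exists_gapRatio_pos {p q k l : ℕ} (hkl : k ≤ l) (hpos : 0 < d.1 p q l - d.1 p q k) :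
    ∃ i, k ≤ i ∧ i < l ∧ 0 < gapRatio d p q i := by
  rw [← sum_gapRatio d p q hkl] at hpos
  obtain ⟨i, hi, hi0⟩ := Finset.exists_lt_of_sum_lt (f := fun _ => (0 : ℝ)) (by simpa using hpos)
  rw [Finset.mem_Ico] at hi
  exact ⟨i, hi.1, hi.2, hi0⟩

lemma exists_gapRatio_pos_of_lt (h : IsRatioSystem n d) {p q : ℕ} (hpq : p < q) (hq : q < n) :
    ∃ i, p ≤ i ∧ i < q ∧ 0 < gapRatio d p q i := by
  refine exists_gapRatio_pos hpq.le ?_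
  rw [h.z_left p q hpq hq, h.z_right p q hpq hq]
  norm_num

lemma gapRatio_comp (h : IsRatioSystem n d) {P Q p q i : ℕ} (hP : P ≤ p) (hQ : q ≤ Q) (hn : Q < n)
    (hp : p ≤ i) (hq : i < q) :
    gapRatio d P Q i = (d.1 P Q q - d.1 P Q p) * gapRatio d p q i := by
  rw [gapRatio, gapRatio, h.z_comp P Q p q (i + 1) hP (by omega) hQ hn (by omega) (by omega),
    h.z_comp P Q p q i hP (by omega) hQ hn hp hq.le]
  ring

lemma width_nonneg (h : IsRatioSystem n d) {P Q p q : ℕ} (hP : P ≤ p) (hpq : p ≤ q) (hQ : q ≤ Q)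
    (hn : Q < n) : 0 ≤ d.1 P Q q - d.1 P Q p :=
  sub_nonneg.2 (h.z_mono hP hpq hQ hn)

/-- By `gapRatio_comp`, an interval that collapses to a point inside a larger one contains no
visible gap. -/
lemma width_pos (h : IsRatioSystem n d) {P Q p q i : ℕ} (hP : P ≤ p) (hQ : q ≤ Q) (hn : Q < n)
    (hp : p ≤ i) (hq : i < q) (hi : 0 < gapRatio d P Q i) : 0 < d.1 P Q q - d.1 P Q p := by
  rcases (h.width_nonneg hP (by omega) hQ hn : 0 ≤ d.1 P Q q - d.1 P Q p).lt_or_eq with h0 | h0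
  · exact h0
  · rw [h.gapRatio_comp hP hQ hn hp hq, ← h0, zero_mul] at hi
    exact absurd hi (lt_irrefl 0)

lemma gapRatio_pos_of_pos (h : IsRatioSystem n d) {P Q p q i : ℕ} (hP : P ≤ p) (hQ : q ≤ Q)
    (hn : Q < n) (hp : p ≤ i) (hq : i < q) (hi : 0 < gapRatio d P Q i) : 0 < gapRatio d p q i := by
  have h1 := h.width_pos hP hQ hn hp hq hi
  rw [h.gapRatio_comp hP hQ hn hp hq] at hi
  exact pos_of_mul_pos_right hi h1.le

end IsRatioSystem

/-- The space of systems of ratios of `n` points. -/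
abbrev RatioSpace (n : ℕ) : Type := {d : (ℕ → ℕ → ℕ → ℝ) × (ℕ → ℕ → ℝ) // IsRatioSystem n d}

lemma isClosed_isRatioSystem (n : ℕ) : IsClosed {d | IsRatioSystem n d} := by
  have hz : ∀ p q k, Continuous fun d : (ℕ → ℕ → ℕ → ℝ) × (ℕ → ℕ → ℝ) => d.1 p q k := by
    intros; fun_prop
  have hw : ∀ p q, Continuous fun d : (ℕ → ℕ → ℕ → ℝ) × (ℕ → ℕ → ℝ) => d.2 p q := by
    intros; fun_prop
  have key : {d | IsRatioSystem n d} =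
    {d : (ℕ → ℕ → ℕ → ℝ) × (ℕ → ℕ → ℝ) | ∀ p q, p < q → q < n → d.1 p q p = 0} ∩
    {d | ∀ p q, p < q → q < n → d.1 p q q = 1} ∩
    {d | ∀ p q k, p < q → q < n → p ≤ k → k < q → d.1 p q k ≤ d.1 p q (k + 1)} ∩
    {d | ∀ P Q p q k, P ≤ p → p < q → q ≤ Q → Q < n → p ≤ k → k ≤ q →
      d.1 P Q k = d.1 P Q p + (d.1 P Q q - d.1 P Q p) * d.1 p q k} ∩
    {d | ∀ p q k, ¬ (p < q ∧ q < n ∧ p ≤ k ∧ k ≤ q) → d.1 p q k = 0} ∩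
    {d | ∀ p q, p < q → q < n → 0 ≤ d.2 p q} ∩
    {d | ∀ p q, p < q → q < n → d.2 p q ≤ 1} ∩
    {d | ∀ P Q p q, P ≤ p → p < q → q ≤ Q → Q < n →
      d.2 p q * (1 - d.2 P Q) = (d.1 P Q q - d.1 P Q p) * d.2 P Q * (1 - d.2 p q)} ∩
    {d | ∀ p q, ¬ (p < q ∧ q < n) → d.2 p q = 0} := by
    ext d
    constructor
    · rintro ⟨h1, h2, h3, h4, h5, h6, h7, h8, h9⟩
      exact ⟨⟨⟨⟨⟨⟨⟨⟨h1, h2⟩, h3⟩, h4⟩, h5⟩, h6⟩, h7⟩, h8⟩, h9⟩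
    · rintro ⟨⟨⟨⟨⟨⟨⟨⟨h1, h2⟩, h3⟩, h4⟩, h5⟩, h6⟩, h7⟩, h8⟩, h9⟩
      exact ⟨h1, h2, h3, h4, h5, h6, h7, h8, h9⟩
  rw [key]
  simp only [Set.ofPred_forall]
  refine ((((((((?_ : IsClosed _).inter ?_).inter ?_).inter ?_).inter ?_).inter ?_).inter
    ?_).inter ?_).inter ?_
  all_goals
    repeat' refine isClosed_iInter fun _ => ?_
    first
      | exact isClosed_eq (by fun_prop) (by fun_prop)
      | exact isClosed_le (by fun_prop) (by fun_prop)

/-- All entries lie in `[0, 1]`; the entries with meaningless indices are pinned to `0`, so the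
space is a closed subset of a product of unit intervals. -/
instance (n : ℕ) : CompactSpace (RatioSpace n) := by
  refine (isCompact_iff_compactSpace (s := {d | IsRatioSystem n d})).1 ?_
  have hc : IsCompact ((Set.univ.pi fun _ => Set.univ.pi fun _ => Set.univ.pi fun _ =>
      Set.Icc (0 : ℝ) 1) ×ˢ (Set.univ.pi fun _ => Set.univ.pi fun _ => Set.Icc (0 : ℝ) 1) :
      Set ((ℕ → ℕ → ℕ → ℝ) × (ℕ → ℕ → ℝ))) :=
    (isCompact_univ_pi fun _ => isCompact_univ_pi fun _ => isCompact_univ_pi fun _ =>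
      isCompact_Icc).prod (isCompact_univ_pi fun _ => isCompact_univ_pi fun _ => isCompact_Icc)
  refine hc.of_isClosed_subset (isClosed_isRatioSystem n) ?_
  intro d hd
  have hd : IsRatioSystem n d := hd
  refine ⟨?_, ?_⟩
  · simp only [Set.mem_pi, Set.mem_univ, forall_const]
    exact fun p q k => ⟨hd.z_nonneg p q k, hd.z_le_one p q k⟩
  · simp only [Set.mem_pi, Set.mem_univ, forall_const]
    intro p q
    by_cases h : p < q ∧ q < n
    · exact ⟨hd.w_nonneg p q h.1 h.2, hd.w_le_one p q h.1 h.2⟩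
    · rw [hd.w_junk p q h]
      exact ⟨le_rfl, zero_le_one⟩

/-! ### The vertex at which two leaves meet -/

/-- For a tree with leaves `a, a + 1, …`, the paths from the leaves `p < q` to the root meet in the
vertex between the leaves `meet a p q` and `meet a p q + 1`. -/
def TrivalentTree.meet : TrivalentTree → ℕ → ℕ → ℕ → ℕ
  | leaf, _, _, _ => 0
  | node l r, a, p, q =>
      if q < a + l.leaves then l.meet a p q
      else if a + l.leaves ≤ p then r.meet (a + l.leaves) p q
      else a + l.leaves - 1

/-- For a tree with leaves `a, a + 1, …`, the paths from the leaves `p < q` to the root meet in the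
vertex between the leaves `(meet a p q).1` and `(meet a p q).1 + 1`, and `(meet a p q).2` says
whether this vertex is on the root side of the colored vertices. -/
def ColoredTree.meet : ColoredTree → ℕ → ℕ → ℕ → ℕ × Bool
  | colored t, a, p, q => (t.meet a p q, false)
  | node l r, a, p, q =>
      if q < a + l.leaves then l.meet a p q
      else if a + l.leaves ≤ p then r.meet (a + l.leaves) p q
      else (a + l.leaves - 1, true)

/-- The product over all pairs `p < q` with `a ≤ p` and `q < b`. -/
def pairProd {M : Type*} [CommMonoid M] (a b : ℕ) (f : ℕ → ℕ → M) : M :=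
  ∏ p ∈ Finset.Ico a b, ∏ q ∈ Finset.Ico (p + 1) b, f p q

/-- The triangle of pairs splits into two smaller triangles and a rectangle. For a tree with `m - a`
leaves on the left of its root vertex, the rectangle consists of the pairs that meet at the root. -/
lemma pairProd_split {M : Type*} [CommMonoid M] {a m b : ℕ} (ham : a ≤ m) (hmb : m ≤ b)
    (f : ℕ → ℕ → M) :
    pairProd a b f = pairProd a m f * pairProd m b f *
      ∏ p ∈ Finset.Ico a m, ∏ q ∈ Finset.Ico m b, f p q := by
  unfold pairProd
  rw [← Finset.prod_Ico_consecutive _ ham hmb, mul_right_comm, ← Finset.prod_mul_distrib]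
  congr 1
  refine Finset.prod_congr rfl fun p hp => ?_
  rw [Finset.mem_Ico] at hp
  rw [Finset.prod_Ico_consecutive _ (by omega) hmb]

lemma pairProd_congr {M : Type*} [CommMonoid M] {a b : ℕ} {f g : ℕ → ℕ → M}
    (h : ∀ p q, a ≤ p → p < q → q < b → f p q = g p q) : pairProd a b f = pairProd a b g := by
  refine Finset.prod_congr rfl fun p hp => Finset.prod_congr rfl fun q hq => ?_
  rw [Finset.mem_Ico] at hp hq
  exact h p q hp.1 (by omega) hq.2

lemma pairProd_mul {M : Type*} [CommMonoid M] (a b : ℕ) (f g : ℕ → ℕ → M) :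
    pairProd a b (fun p q => f p q * g p q) = pairProd a b f * pairProd a b g := by
  simp only [pairProd, Finset.prod_mul_distrib]

lemma prod_Ico_one_add {M : Type*} [CommMonoid M] {L R : ℕ} (hL : 0 < L) (hR : 0 < R)
    (f : ℕ → M) :
    ∏ i ∈ Finset.Ico 1 (L + R), f i =
      (∏ i ∈ Finset.Ico 1 L, f i) * (∏ i ∈ Finset.Ico 1 R, f (L + i)) * f L := by
  rw [← Finset.prod_Ico_consecutive _ (show 1 ≤ L by omega) (show L ≤ L + R by omega),
    Finset.prod_eq_prod_Ico_succ_bot (show L < L + R by omega), mul_assoc, mul_comm (f L)]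
  congr 2
  rw [Finset.prod_Ico_add (f := f), add_comm 1 L, add_comm R L]

/-- Double counting: a vertex with `a_i` leaves on its left and `b_i` on its right is the meeting
point of exactly `a_i b_i` pairs. `split` counts vertices from 1 while the gaps `x` start at the
first leaf `a`, whence the index `a + i - 1`. -/
lemma TrivalentTree.pairProd_meet (t : TrivalentTree) (x : ℕ → ℝ) (a : ℕ) :
    pairProd a (a + t.leaves) (fun p q => x (t.meet a p q)) =
      ∏ i ∈ Finset.Ico 1 t.leaves, x (a + i - 1) ^ t.split i := by
  induction t generalizing a with
  | leaf => simp [pairProd, leaves]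
  | node l r ihl ihr =>
    have hL := l.leaves_pos
    have hR := r.leaves_pos
    have e1 : pairProd a (a + l.leaves) (fun p q => x ((node l r).meet a p q)) =
        pairProd a (a + l.leaves) (fun p q => x (l.meet a p q)) :=
      pairProd_congr fun p q _ _ hq => by simp only [meet, if_pos hq]
    have e2 : pairProd (a + l.leaves) (a + l.leaves + r.leaves)
        (fun p q => x ((node l r).meet a p q)) =
        pairProd (a + l.leaves) (a + l.leaves + r.leaves)
          (fun p q => x (r.meet (a + l.leaves) p q)) :=
      pairProd_congr fun p q hp hpq _ => by
        simp only [meet, if_pos hp, if_neg (show ¬ q < a + l.leaves by omega)]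
    have e3 : ∏ p ∈ Finset.Ico a (a + l.leaves),
        ∏ q ∈ Finset.Ico (a + l.leaves) (a + l.leaves + r.leaves),
          x ((node l r).meet a p q) = x (a + l.leaves - 1) ^ ((l.leaves * r.leaves : ℕ) : ℤ) := by
      rw [Finset.prod_congr rfl fun p hp => Finset.prod_congr rfl fun q hq =>
        show x ((node l r).meet a p q) = x (a + l.leaves - 1) by
          rw [Finset.mem_Ico] at hp hq
          simp only [meet, if_neg (show ¬ q < a + l.leaves by omega),
            if_neg (show ¬ a + l.leaves ≤ p by omega)]]
      rw [zpow_natCast]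
      rw [Finset.prod_const, Finset.prod_const, Nat.card_Ico, Nat.card_Ico, ← pow_mul,
        Nat.add_sub_cancel_left, Nat.add_sub_cancel_left, mul_comm]
    have hs : a + (node l r).leaves = a + l.leaves + r.leaves := by simp only [leaves]; omega
    rw [hs, pairProd_split (m := a + l.leaves) (by omega) (by omega), e1, e2, e3, ihl, ihr]
    simp only [leaves]
    rw [prod_Ico_one_add hL hR]
    congr 1
    · congr 1
      · refine Finset.prod_congr rfl fun i hi => ?_
        rw [Finset.mem_Ico] at hi
        simp only [split, if_pos hi.2]
      · refine Finset.prod_congr rfl fun i hi => ?_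
        rw [Finset.mem_Ico] at hi
        simp only [split, if_neg (show ¬ l.leaves + i < l.leaves by omega),
          if_neg (show ¬ l.leaves + i = l.leaves by omega), Nat.add_sub_cancel_left, add_assoc]
    · simp only [split, lt_irrefl, if_false, if_true]
      push_cast
      rfl

/-- The monomial `x_i` of a vertex below the colored vertices, and the monomial `x_i ^ 2 / y` of a
vertex above them. -/
noncomputable def vertexMonomial (x : ℕ → ℝ) (y : ℝ) (o : ℕ × Bool) : ℝ :=
  if o.2 then x o.1 ^ 2 / y else x o.1

/-- The same count with colors: a pair that meets above the colored vertices contributes `x_i` twice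
and `y` to the power `-1`, which is the effect of `δ_i` on the exponents. -/
lemma ColoredTree.pairProd_meet (t : ColoredTree) (x : ℕ → ℝ) (y : ℝ)
    (a : ℕ) :
    pairProd a (a + t.leaves) (fun p q => vertexMonomial x y (t.meet a p q)) =
      ∏ i ∈ Finset.Ico 1 t.leaves,
        (x (a + i - 1) ^ (t.split i * (1 + t.delta i)) * y ^ (- (t.delta i * t.split i))) := by
  induction t generalizing a with
  | colored t =>
    simp only [leaves, meet, vertexMonomial, Bool.false_eq_true, if_false]
    rw [t.pairProd_meet]
    simp [split, delta]
  | node l r ihl ihr =>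
    have hL := l.leaves_pos
    have hR := r.leaves_pos
    have e1 : pairProd a (a + l.leaves) (fun p q => vertexMonomial x y ((node l r).meet a p q)) =
        pairProd a (a + l.leaves) (fun p q => vertexMonomial x y (l.meet a p q)) :=
      pairProd_congr fun p q _ _ hq => by simp only [meet, if_pos hq]
    have e2 : pairProd (a + l.leaves) (a + l.leaves + r.leaves)
        (fun p q => vertexMonomial x y ((node l r).meet a p q)) =
        pairProd (a + l.leaves) (a + l.leaves + r.leaves)
          (fun p q => vertexMonomial x y (r.meet (a + l.leaves) p q)) :=
      pairProd_congr fun p q hp hpq _ => by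
        simp only [meet, if_pos hp, if_neg (show ¬ q < a + l.leaves by omega)]
    have e3 : ∏ p ∈ Finset.Ico a (a + l.leaves),
        ∏ q ∈ Finset.Ico (a + l.leaves) (a + l.leaves + r.leaves),
          vertexMonomial x y ((node l r).meet a p q) =
        (x (a + l.leaves - 1) ^ 2 / y) ^ ((l.leaves * r.leaves : ℕ) : ℤ) := by
      rw [Finset.prod_congr rfl fun p hp => Finset.prod_congr rfl fun q hq =>
        show vertexMonomial x y ((node l r).meet a p q) = x (a + l.leaves - 1) ^ 2 / y by
          rw [Finset.mem_Ico] at hp hq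
          simp only [meet, if_neg (show ¬ q < a + l.leaves by omega), vertexMonomial,
            if_neg (show ¬ a + l.leaves ≤ p by omega), if_true]]
      rw [zpow_natCast]
      rw [Finset.prod_const, Finset.prod_const, Nat.card_Ico, Nat.card_Ico, ← pow_mul,
        Nat.add_sub_cancel_left, Nat.add_sub_cancel_left, mul_comm]
    have hs : a + (node l r).leaves = a + l.leaves + r.leaves := by simp only [leaves]; omega
    rw [hs, pairProd_split (m := a + l.leaves) (by omega) (by omega), e1, e2, e3, ihl, ihr]
    simp only [leaves]
    rw [prod_Ico_one_add hL hR]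
    congr 1
    · congr 1
      · refine Finset.prod_congr rfl fun i hi => ?_
        rw [Finset.mem_Ico] at hi
        simp only [split, delta, if_pos hi.2]
      · refine Finset.prod_congr rfl fun i hi => ?_
        rw [Finset.mem_Ico] at hi
        simp only [split, delta, if_neg (show ¬ l.leaves + i < l.leaves by omega),
          if_neg (show ¬ l.leaves + i = l.leaves by omega), Nat.add_sub_cancel_left, add_assoc]
    · simp only [split, delta, lt_irrefl, if_false, if_true]
      push_cast
      rw [div_zpow, ← zpow_natCast, ← zpow_mul, one_mul, zpow_neg, div_eq_mul_inv]
      congr 2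
      push_cast
      ring

lemma prod_zpow_weightVector {n : ℕ} (T : MaximalColoredTree n) (x : ℕ → ℝ)
    {y : ℝ} (hy : y ≠ 0) :
    ∏ j : Fin n, (if (j : ℕ) + 1 < n then x j else y) ^ weightVector T j =
      pairProd 0 n (fun p q => vertexMonomial x y (T.1.meet 0 p q)) := by
  have h := T.1.pairProd_meet x y 0
  rw [T.2, zero_add] at h
  rw [h]
  have hn : 0 < n := T.2 ▸ T.1.leaves_pos
  obtain ⟨m, rfl⟩ : ∃ m, n = m + 1 := ⟨n - 1, by omega⟩
  rw [Fin.prod_univ_castSucc, Finset.prod_mul_distrib]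
  congr 1
  · rw [Finset.prod_Ico_eq_prod_range, ← Fin.prod_univ_eq_prod_range
      (fun k => x (0 + (1 + k) - 1) ^ (T.1.split (1 + k) * (1 + T.1.delta (1 + k))))]
    refine Finset.prod_congr rfl fun i _ => ?_
    have := i.2
    simp only [Fin.val_castSucc, weightVector, if_pos (show (i : ℕ) + 1 < m + 1 by omega)]
    rw [add_comm 1 (i : ℕ), zero_add, Nat.add_sub_cancel]
  · simp only [weightVector, Fin.val_last, lt_irrefl, if_false]
    rw [← Finset.sum_neg_distrib]
    generalize Finset.Ico 1 (m + 1) = s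
    induction s using Finset.induction_on with
    | empty => simp
    | insert i s hi ih => rw [Finset.sum_insert hi, Finset.prod_insert hi, zpow_add₀ hy, ih]

lemma TrivalentTree.meet_mem (t : TrivalentTree) {a p q : ℕ} (hp : a ≤ p) (hpq : p < q)
    (hq : q < a + t.leaves) : p ≤ t.meet a p q ∧ t.meet a p q < q := by
  induction t generalizing a with
  | leaf => simp only [leaves] at hq; omega
  | node l r ihl ihr =>
    have := l.leaves_pos
    simp only [leaves] at hq
    simp only [meet]
    split_ifs with h1 h2
    · exact ihl hp h1
    · exact ihr h2 (by omega)
    · omega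

lemma ColoredTree.meet_mem (t : ColoredTree) {a p q : ℕ} (hp : a ≤ p) (hpq : p < q)
    (hq : q < a + t.leaves) : p ≤ (t.meet a p q).1 ∧ (t.meet a p q).1 < q := by
  induction t generalizing a with
  | colored t => exact t.meet_mem hp hpq hq
  | node l r ihl ihr =>
    have := l.leaves_pos
    simp only [leaves] at hq
    simp only [meet]
    split_ifs with h1 h2
    · exact ihl hp h1
    · exact ihr h2 (by omega)
    · simp only; omega

/-! ### The monomials as functions of a system of ratios -/

/-- The limit of the monomial of a vertex, divided by `L + L ^ 2 / y` with `L = z_q - z_p`. -/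
noncomputable def meetWeight (d : (ℕ → ℕ → ℕ → ℝ) × (ℕ → ℕ → ℝ)) (p q : ℕ) (o : ℕ × Bool) : ℝ :=
  if o.2 then gapRatio d p q o.1 ^ 2 * d.2 p q else gapRatio d p q o.1 * (1 - d.2 p q)

/-- The limit of the monomial of a tree, up to a factor that does not depend on the tree. -/
noncomputable def treeWeight {n : ℕ} (d : (ℕ → ℕ → ℕ → ℝ) × (ℕ → ℕ → ℝ))
    (T : MaximalColoredTree n) : ℝ :=
  pairProd 0 n fun p q => meetWeight d p q (T.1.meet 0 p q)

lemma continuous_treeWeight {n : ℕ} (T : MaximalColoredTree n) :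
    Continuous fun d : (ℕ → ℕ → ℕ → ℝ) × (ℕ → ℕ → ℝ) => treeWeight d T := by
  unfold treeWeight pairProd
  refine continuous_finsetProd _ fun p _ => continuous_finsetProd _ fun q _ => ?_
  by_cases ho : (T.1.meet 0 p q).2 <;> simp only [meetWeight, gapRatio, ho, if_true, if_false,
    Bool.false_eq_true] <;> fun_prop

/-- The vertices at which the leaves `p < q` can meet in a tree whose monomial does not vanish. -/
def IsAllowed (d : (ℕ → ℕ → ℕ → ℝ) × (ℕ → ℕ → ℝ)) (p q : ℕ) (o : ℕ × Bool) : Prop :=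
  p ≤ o.1 ∧ o.1 < q ∧ 0 < gapRatio d p q o.1 ∧ if o.2 then 0 < d.2 p q else d.2 p q < 1

/-! ### Non-vanishing weights and greedy trees. -/

namespace IsRatioSystem

variable {n : ℕ} {d : (ℕ → ℕ → ℕ → ℝ) × (ℕ → ℕ → ℝ)}

lemma meetWeight_nonneg (h : IsRatioSystem n d) {p q : ℕ} {o : ℕ × Bool} (hp : p ≤ o.1)
    (hq : o.1 < q) (hn : q < n) : 0 ≤ meetWeight d p q o := by
  have h1 := h.gapRatio_nonneg hp hq hn
  have h2 := h.w_nonneg p q (by omega) hn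
  have h3 := sub_nonneg.2 (h.w_le_one p q (by omega) hn)
  unfold meetWeight
  split_ifs <;> positivity

lemma meetWeight_ne_zero_iff (h : IsRatioSystem n d) {p q : ℕ} {o : ℕ × Bool} (hp : p ≤ o.1)
    (hq : o.1 < q) (hn : q < n) : meetWeight d p q o ≠ 0 ↔ IsAllowed d p q o := by
  have h1 := h.gapRatio_nonneg hp hq hn
  have h2 := h.w_nonneg p q (by omega) hn
  have h3 := h.w_le_one p q (by omega) hn
  unfold meetWeight IsAllowed
  split_ifs
  · simp [hp, hq, h1.lt_iff_ne', h2.lt_iff_ne']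
  · simp [hp, hq, h1.lt_iff_ne', h3.lt_iff_ne, sub_eq_zero, eq_comm (a := (1 : ℝ))]

lemma treeWeight_nonneg (h : IsRatioSystem n d) (T : MaximalColoredTree n) :
    0 ≤ treeWeight d T := by
  unfold treeWeight pairProd
  refine Finset.prod_nonneg fun p hp => Finset.prod_nonneg fun q hq => ?_
  rw [Finset.mem_Ico] at hp hq
  have := T.1.meet_mem (a := 0) hp.1 (show p < q by omega) (by rw [T.2]; omega)
  exact h.meetWeight_nonneg this.1 this.2 hq.2

lemma treeWeight_ne_zero_iff (h : IsRatioSystem n d) (T : MaximalColoredTree n) :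
    treeWeight d T ≠ 0 ↔ ∀ p q, p < q → q < n → IsAllowed d p q (T.1.meet 0 p q) := by
  unfold treeWeight pairProd
  simp only [Finset.prod_ne_zero_iff, Finset.mem_Ico]
  refine forall_congr' fun p => ?_
  have key : ∀ q, p < q → q < n → (meetWeight d p q (T.1.meet 0 p q) ≠ 0 ↔
      IsAllowed d p q (T.1.meet 0 p q)) := by
    intro q hpq hq
    have := T.1.meet_mem (a := 0) (zero_le) hpq (by rw [T.2]; omega)
    exact h.meetWeight_ne_zero_iff this.1 this.2 hq
  constructor
  · exact fun H q hpq hq => (key q hpq hq).1 (H (by omega) q (by omega))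
  · exact fun H hp q hq => (key q (by omega) hq.2).2 (H q (by omega) hq.2)

lemma w_pos_of_w_pos (h : IsRatioSystem n d) {P Q p q : ℕ} (hP : P ≤ p) (hpq : p < q)
    (hQ : q ≤ Q) (hn : Q < n) (hpos : 0 < d.1 P Q q - d.1 P Q p) (hw : 0 < d.2 P Q) :
    0 < d.2 p q := by
  refine (h.w_nonneg p q hpq (by omega)).lt_of_ne fun h0 => ?_
  have := h.w_comp P Q p q hP hpq hQ hn
  rw [← h0] at this
  nlinarith [mul_pos hpos hw]

lemma w_lt_one_of_w_lt_one (h : IsRatioSystem n d) {P Q p q : ℕ} (hP : P ≤ p) (hpq : p < q)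
    (hQ : q ≤ Q) (hn : Q < n) (hw : d.2 P Q < 1) : d.2 p q < 1 := by
  refine (h.w_le_one p q hpq (by omega)).lt_of_ne fun h0 => ?_
  have := h.w_comp P Q p q hP hpq hQ hn
  rw [h0] at this
  linarith

/-- The left side of `w_comp` is positive, hence so is every factor on its right side. -/
lemma width_pos_of_w (h : IsRatioSystem n d) {P Q p q : ℕ} (hP : P ≤ p) (hpq : p < q)
    (hQ : q ≤ Q) (hn : Q < n) (hw : d.2 P Q < 1) (hw' : 0 < d.2 p q) :
    0 < d.1 P Q q - d.1 P Q p ∧ 0 < d.2 P Q := by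
  have := h.w_comp P Q p q hP hpq hQ hn
  have h1 : 0 < d.2 p q * (1 - d.2 P Q) := mul_pos hw' (sub_pos.2 hw)
  refine ⟨(h.width_nonneg hP hpq.le hQ hn).lt_of_ne fun h0 => ?_,
    (h.w_nonneg P Q (by omega) hn).lt_of_ne fun h0 => ?_⟩ <;>
  · rw [← h0] at this
    simp only [zero_mul, mul_zero] at this
    linarith

/-- Within an interval, a subinterval of positive width differs only by a positive finite rescaling:
visible gaps stay visible, and the odds of `w` are multiplied by a positive number. This lets a best
vertex of the whole interval remain best for all pairs that it separates. -/
lemma isAllowed_iff (h : IsRatioSystem n d) {P Q p q : ℕ} (hP : P ≤ p) (hpq : p < q)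
    (hQ : q ≤ Q) (hn : Q < n) (hpos : 0 < d.1 P Q q - d.1 P Q p) {o : ℕ × Bool} (hp : p ≤ o.1)
    (hq : o.1 < q) : IsAllowed d p q o ↔ IsAllowed d P Q o := by
  have hw := h.w_comp P Q p q hP hpq hQ hn
  have h1 : 0 < d.2 p q ↔ 0 < d.2 P Q := by
    refine ⟨fun h1 => ?_, h.w_pos_of_w_pos hP hpq hQ hn hpos⟩
    refine (h.w_nonneg P Q (by omega) hn).lt_of_ne fun h0 => ?_
    rw [← h0] at hw
    linarith
  have h2 : d.2 p q < 1 ↔ d.2 P Q < 1 := by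
    refine ⟨fun h1 => ?_, h.w_lt_one_of_w_lt_one hP hpq hQ hn⟩
    refine (h.w_le_one P Q (by omega) hn).lt_of_ne fun h0 => ?_
    rw [h0] at hw
    nlinarith [mul_pos hpos (sub_pos.2 h1)]
  unfold IsAllowed
  rw [h1, h2, h.gapRatio_comp hP hQ hn hp hq, mul_pos_iff_of_pos_left hpos]
  simp only [hp, hq, hP.trans hp, hq.trans_le hQ, true_and]

/-- A tree in which the leaves always meet at a best possible gap. -/
lemma exists_trivalentTree (h : IsRatioSystem n d) (lam : ℕ → ℝ) (m : ℕ) :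
    ∀ a, a + m + 1 ≤ n → ∃ t : TrivalentTree, t.leaves = m + 1 ∧
      ∀ p q, a ≤ p → p < q → q < a + m + 1 → 0 < gapRatio d p q (t.meet a p q) ∧
        ∀ k, p ≤ k → k < q → 0 < gapRatio d p q k → lam k ≤ lam (t.meet a p q) := by
  induction m using Nat.strong_induction_on with
  | _ m ih =>
    intro a hn
    rcases m.eq_zero_or_pos with rfl | hm
    · exact ⟨.leaf, rfl, fun p q hp hpq hq => by omega⟩
    -- The root is placed at the best visible gap of the whole interval. Every pair separated by it
    -- spans positive width, so the visible gaps between the two leaves are visible in the whole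
    -- interval too, and none of them can beat the root.
    obtain ⟨i, hi, hbest⟩ := Finset.exists_max_image
      ((Finset.Ico a (a + m)).filter fun i => 0 < gapRatio d a (a + m) i) lam (by
        obtain ⟨i, h1, h2, h3⟩ := h.exists_gapRatio_pos_of_lt (show a < a + m by omega) (by omega)
        exact ⟨i, by simp [h1, h2, h3]⟩)
    simp only [Finset.mem_filter, Finset.mem_Ico] at hi hbest
    obtain ⟨⟨hi1, hi2⟩, hi3⟩ := hi
    obtain ⟨l, hl, hl'⟩ := ih (i - a) (by omega) a (by omega)
    obtain ⟨r, hr, hr'⟩ := ih (a + m - i - 1) (by omega) (i + 1) (by omega)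
    refine ⟨.node l r, by simp only [TrivalentTree.leaves]; omega, fun p q hp hpq hq => ?_⟩
    simp only [TrivalentTree.meet, hl, show a + (i - a + 1) = i + 1 by omega]
    split_ifs with h1 h2
    · exact hl' p q hp hpq (by omega)
    · exact hr' p q h2 hpq (by omega)
    · rw [Nat.add_sub_cancel]
      refine ⟨h.gapRatio_pos_of_pos hp (by omega) (by omega) (by omega) (by omega) hi3, ?_⟩
      intro k hk1 hk2 hk
      refine hbest k ⟨by omega, ?_⟩
      rw [h.gapRatio_comp hp (show q ≤ a + m by omega) (by omega) hk1 hk2]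
      exact mul_pos (h.width_pos hp (by omega) (by omega) (by omega) (by omega) hi3) hk

/-- The logarithm of the monomial of a vertex. -/
def meetScore (lam : ℕ → ℝ) (eta : ℝ) (o : ℕ × Bool) : ℝ :=
  if o.2 then lam o.1 + (lam o.1 - eta) else lam o.1

lemma exists_isAllowed (h : IsRatioSystem n d) {p q : ℕ} (hpq : p < q) (hq : q < n) :
    ∃ o, IsAllowed d p q o := by
  obtain ⟨i, h1, h2, h3⟩ := h.exists_gapRatio_pos_of_lt hpq hq
  by_cases hw : 0 < d.2 p q
  · exact ⟨(i, true), h1, h2, h3, by simpa using hw⟩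
  · exact ⟨(i, false), h1, h2, h3, by simp; linarith⟩

/-- A colored tree in which the leaves always meet at a best possible vertex. -/
lemma exists_coloredTree (h : IsRatioSystem n d) (lam : ℕ → ℝ) (eta : ℝ) (m : ℕ) :
    ∀ a, a + m + 1 ≤ n → ∃ t : ColoredTree, t.leaves = m + 1 ∧
      ∀ p q, a ≤ p → p < q → q < a + m + 1 → IsAllowed d p q (t.meet a p q) ∧
        ∀ o, IsAllowed d p q o → meetScore lam eta o ≤ meetScore lam eta (t.meet a p q) := by
  induction m using Nat.strong_induction_on with
  | _ m ih =>
    intro a hn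
    rcases m.eq_zero_or_pos with rfl | hm
    · exact ⟨.colored .leaf, rfl, fun p q hp hpq hq => by omega⟩
    have hfin : {o | IsAllowed d a (a + m) o}.Finite := by
      refine ((Finset.range (a + m) ×ˢ Finset.univ).finite_toSet).subset ?_
      rintro ⟨i, b⟩ ⟨-, h2, -⟩
      simpa using h2
    obtain ⟨⟨i, b⟩, hi, hbest⟩ := hfin.exists_maximalFor (meetScore lam eta) _
      (h.exists_isAllowed (show a < a + m by omega) (by omega))
    replace hbest : ∀ o, IsAllowed d a (a + m) o → meetScore lam eta o ≤ meetScore lam eta (i, b) :=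
      fun o ho => (le_total _ _).elim id (hbest ho)
    have hi' : IsAllowed d a (a + m) (i, b) := hi
    obtain ⟨hi1, hi2, hi3, hi4⟩ := hi
    simp only at hi1 hi2 hi3
    cases b with
    | true =>
      obtain ⟨l, hl, hl'⟩ := ih (i - a) (by omega) a (by omega)
      obtain ⟨r, hr, hr'⟩ := ih (a + m - i - 1) (by omega) (i + 1) (by omega)
      refine ⟨.node l r, by simp only [ColoredTree.leaves]; omega, fun p q hp hpq hq => ?_⟩
      simp only [ColoredTree.meet, hl, show a + (i - a + 1) = i + 1 by omega]
      split_ifs with h1 h2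
      · exact hl' p q hp hpq (by omega)
      · exact hr' p q h2 hpq (by omega)
      · rw [Nat.add_sub_cancel]
        have hpos := h.width_pos hp (show q ≤ a + m by omega) (by omega) (show p ≤ i by omega)
          (by omega) hi3
        refine ⟨(h.isAllowed_iff hp hpq (by omega) (by omega) hpos (show p ≤ i by omega)
          (show i < q by omega)).2 hi', fun o ho => hbest o ?_⟩
        exact (h.isAllowed_iff hp hpq (by omega) (by omega) hpos ho.1 ho.2.1).1 ho
    | false =>
      simp only [Bool.false_eq_true, if_false] at hi4
      obtain ⟨t, ht, ht'⟩ := h.exists_trivalentTree lam m a hn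
      refine ⟨.colored t, ht, fun p q hp hpq hq => ?_⟩
      obtain ⟨h1, h2⟩ := ht' p q hp hpq hq
      have h3 := t.meet_mem hp hpq (by rw [ht]; omega)
      have hlt : d.2 p q < 1 := h.w_lt_one_of_w_lt_one hp hpq (by omega) (by omega) hi4
      simp only [ColoredTree.meet]
      refine ⟨⟨h3.1, h3.2, h1, by simpa using hlt⟩, ?_⟩
      rintro ⟨k, b⟩ ⟨hk1, hk2, hk3, hk4⟩
      simp only at hk1 hk2 hk3 hk4
      have hk := h2 k hk1 hk2 hk3
      cases b with
      | false => simpa [meetScore] using hk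
      | true =>
        simp only [if_true] at hk4
        -- Below the colored vertices only uncolored scores are optimized, so a vertex `(k, true)`
        -- might seem better. If it is allowed, then `0 < w` on the whole interval, so `(k, false)`
        -- and `(i, true)` were competitors of `(i, false)`. Its victory gives `lam k ≤ lam i ≤
        -- eta`, and therefore `(k, true)` scores no more than `(k, false)`.
        obtain ⟨hpos, hw⟩ := h.width_pos_of_w hp hpq (show q ≤ a + m by omega) (by omega) hi4 hk4
        have e1 : lam k ≤ lam i := by
          simpa [meetScore] using hbest (k, false) ((h.isAllowed_iff hp hpq (by omega) (by omega)
            hpos (o := (k, false)) hk1 hk2).1 ⟨hk1, hk2, hk3, by simpa using hlt⟩)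
        have e2 : lam i + (lam i - eta) ≤ lam i := by
          simpa [meetScore] using hbest (i, true) ⟨hi1, hi2, hi3, by simpa using hw⟩
        simp only [meetScore, if_true, Bool.false_eq_true, if_false]
        linarith

lemma exists_maximalColoredTree (h : IsRatioSystem n d) (hn : 0 < n) (lam : ℕ → ℝ) (eta : ℝ) :
    ∃ T : MaximalColoredTree n, ∀ p q, p < q → q < n → IsAllowed d p q (T.1.meet 0 p q) ∧
      ∀ o, IsAllowed d p q o → meetScore lam eta o ≤ meetScore lam eta (T.1.meet 0 p q) := by
  obtain ⟨t, ht, h'⟩ := h.exists_coloredTree lam eta (n - 1) 0 (by omega)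
  exact ⟨⟨t, by omega⟩, fun p q hpq hq => h' p q zero_le hpq (by omega)⟩

lemma exists_treeWeight_ne_zero (h : IsRatioSystem n d) (hn : 0 < n) :
    ∃ T : MaximalColoredTree n, treeWeight d T ≠ 0 := by
  obtain ⟨T, hT⟩ := h.exists_maximalColoredTree hn 0 0
  exact ⟨T, (h.treeWeight_ne_zero_iff T).2 fun p q hpq hq => (hT p q hpq hq).1⟩

/-- The scores of the greedy tree can be chosen so that the prescribed vertex is the unique best
one. -/
lemma exists_tree_meet_eq (h : IsRatioSystem n d) {p q : ℕ} (hpq : p < q) (hq : q < n)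
    {o : ℕ × Bool} (ho : IsAllowed d p q o) :
    ∃ T : MaximalColoredTree n, treeWeight d T ≠ 0 ∧ T.1.meet 0 p q = o := by
  classical
  obtain ⟨i, b⟩ := o
  -- For `b = true` the scores at `i` are 2 with `true` and 1 with `false`, and 0 elsewhere. For `b
  -- = false` they are 0 with `true` and 1 with `false` at `i`, and -2 or 0 elsewhere. In both cases
  -- `(i, b)` is the only maximum.
  obtain ⟨T, hT⟩ := h.exists_maximalColoredTree (by omega) (fun j => if j = i then 1 else 0)
    (if b then 0 else 2)
  refine ⟨T, (h.treeWeight_ne_zero_iff T).2 fun p q hpq hq => (hT p q hpq hq).1, ?_⟩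
  have := (hT p q hpq hq).2 _ ho
  generalize T.1.meet 0 p q = o at this
  obtain ⟨j, c⟩ := o
  by_contra hne
  have hne : ¬ (j = i ∧ c = b) := fun hh => hne (by rw [hh.1, hh.2])
  cases b <;> cases c <;> by_cases hj : j = i <;> simp_all [meetScore] <;> norm_num at this

end IsRatioSystem

namespace IsRatioSystem

variable {n : ℕ} {d : (ℕ → ℕ → ℕ → ℝ) × (ℕ → ℕ → ℝ)}

/-! ### Density of the configurations of distinct points -/

/-- The two intervals overlap in the gap `j`. Some gap is visible in their union; if it lies in the
first interval, that interval has positive width. Otherwise the second interval has, so `j` is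
visible in the union, and `j` also lies in the first interval. -/
lemma gapRatio_pos_min_max (h : IsRatioSystem n d) {P Q P' Q' i j : ℕ} (hi : P ≤ i) (hi' : i < Q)
    (hQ : Q < n) (hj : P' ≤ j) (hj' : j < Q') (hQ' : Q' < n) (hPj : P ≤ j) (hQj : j < Q)
    (hgi : 0 < gapRatio d P Q i) (hgj : 0 < gapRatio d P' Q' j) :
    0 < gapRatio d (min P P') (max Q Q') i := by
  have hw : 0 < d.1 (min P P') (max Q Q') Q - d.1 (min P P') (max Q Q') P := by
    obtain ⟨k, hk1, hk2, hk3⟩ := h.exists_gapRatio_pos_of_lt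
      (show min P P' < max Q Q' by omega) (by omega)
    by_cases hk : P ≤ k ∧ k < Q
    · exact h.width_pos (by omega) (by omega) (by omega) hk.1 hk.2 hk3
    · have h1 := h.width_pos (p := P') (q := Q') (i := k) (show min P P' ≤ P' by omega)
        (show Q' ≤ max Q Q' by omega) (by omega) (by omega) (by omega) hk3
      have h2 : 0 < gapRatio d (min P P') (max Q Q') j := by
        rw [h.gapRatio_comp (show min P P' ≤ P' by omega) (show Q' ≤ max Q Q' by omega) (by omega)
          hj hj']
        exact mul_pos h1 hgj
      exact h.width_pos (by omega) (by omega) (by omega) hPj hQj h2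
  rw [h.gapRatio_comp (show min P P' ≤ P by omega) (show Q ≤ max Q Q' by omega) (by omega) hi hi']
  exact mul_pos hw hgi

/-- The largest interval in which a gap does not become negligible. -/
lemma exists_block (h : IsRatioSystem n d) {i : ℕ} (hi : i + 1 < n) :
    ∃ P Q, P ≤ i ∧ i < Q ∧ Q < n ∧ 0 < gapRatio d P Q i ∧
      ∀ P' Q', P' ≤ i → i < Q' → Q' < n → 0 < gapRatio d P' Q' i → P ≤ P' ∧ Q' ≤ Q := by
  classical
  obtain ⟨⟨P, Q⟩, hPQ, hmax⟩ := Finset.exists_max_image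
    ((Finset.range (i + 1) ×ˢ Finset.Ico (i + 1) n).filter
      fun b : ℕ × ℕ => 0 < gapRatio d b.1 b.2 i) (fun b => b.2 - b.1) ⟨(i, i + 1), by
        simp [hi, gapRatio, h.z_left i (i + 1) (by omega) hi, h.z_right i (i + 1) (by omega) hi]⟩
  simp only [Finset.mem_filter, Finset.mem_product, Finset.mem_range, Finset.mem_Ico, Prod.forall]
    at hPQ hmax
  obtain ⟨⟨h1, h2, h3⟩, h4⟩ := hPQ
  refine ⟨P, Q, by omega, by omega, h3, h4, fun P' Q' h1' h2' h3' h4' => ?_⟩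
  have := hmax (min P P') (max Q Q') ⟨⟨by omega, by omega, by omega⟩,
    h.gapRatio_pos_min_max (by omega) (by omega) h3 h1' h2' h3' (by omega) (by omega) h4 h4'⟩
  omega

/-- A system of ratios is a limit of the systems of ratios of points with gaps `c i * t ^ e i`. -/
lemma exists_scales (h : IsRatioSystem n d) : ∃ c e : ℕ → ℝ, (∀ i, 0 < c i) ∧
    ∀ p q i, p ≤ i → i < q → q < n → 0 < gapRatio d p q i →
      (∀ j, p ≤ j → j < q → 0 < gapRatio d p q j →
        e j = e i ∧ c j * gapRatio d p q i = c i * gapRatio d p q j) ∧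
      (∀ j, p ≤ j → j < q → gapRatio d p q j = 0 → e j < e i) ∧
      (d.2 p q = 1 → 0 < e i) ∧ (d.2 p q = 0 → e i < 0) ∧
      (0 < d.2 p q → d.2 p q < 1 → e i = 0 ∧ c i * (1 - d.2 p q) = gapRatio d p q i * d.2 p q) := by
  have hB : ∀ i, ∃ b : ℕ × ℕ, i + 1 < n → (b.1 ≤ i ∧ i < b.2 ∧ b.2 < n ∧ 0 < gapRatio d b.1 b.2 i ∧
      ∀ P' Q', P' ≤ i → i < Q' → Q' < n → 0 < gapRatio d P' Q' i → b.1 ≤ P' ∧ Q' ≤ b.2) := by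
    intro i
    by_cases hi : i + 1 < n
    · obtain ⟨P, Q, hPQ⟩ := h.exists_block hi
      exact ⟨(P, Q), fun _ => hPQ⟩
    · exact ⟨(0, 0), fun hi' => absurd hi' hi⟩
  choose B hB using hB
  -- The block of a gap is the largest interval in which the gap is visible. Inside it the
  -- coefficient is the relative gap, multiplied by the length `L = w / (1 - w)` of the block at
  -- height `y = 1` when that is finite and positive. Otherwise the scale of the block is arbitrary
  -- and is taken to be 1.
  let c : ℕ → ℝ := fun i => if i + 1 < n then gapRatio d (B i).1 (B i).2 i *
    (if 0 < d.2 (B i).1 (B i).2 ∧ d.2 (B i).1 (B i).2 < 1 then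
      d.2 (B i).1 (B i).2 / (1 - d.2 (B i).1 (B i).2) else 1) else 1
  -- The exponent must have the sign of `log (L / y)` in the limit and must increase strictly from a
  -- block to a larger one that does not see it. The length of the block does this for `w = 1`;
  -- subtracting `n`, which exceeds every length, makes it negative for `w = 0`.
  let e : ℕ → ℝ := fun i => if d.2 (B i).1 (B i).2 = 1 then ((B i).2 - (B i).1 : ℝ)
    else if d.2 (B i).1 (B i).2 = 0 then ((B i).2 - (B i).1 - n : ℝ) else 0
  refine ⟨c, e, fun i => ?_, ?_⟩
  · simp only [c]
    split_ifs with h1 h2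
    · exact mul_pos (hB i h1).2.2.2.1 (div_pos h2.1 (sub_pos.2 h2.2))
    · rw [mul_one]; exact (hB i h1).2.2.2.1
    · exact one_pos
  intro p q i hp hq hn hi
  have hin : i + 1 < n := by omega
  obtain ⟨b1, b2, b3, b4, b5⟩ := hB i hin
  obtain ⟨b6, b7⟩ := b5 p q hp hq hn hi
  have hU : 0 < d.1 (B i).1 (B i).2 q - d.1 (B i).1 (B i).2 p := h.width_pos b6 b7 b3 hp hq b4
  have hw := h.w_comp (B i).1 (B i).2 p q b6 (by omega) b7 b3
  have hw0 := h.w_nonneg p q (by omega) hn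
  have hw1 := h.w_le_one p q (by omega) hn
  have hW0 := h.w_nonneg (B i).1 (B i).2 (by omega) b3
  have hW1 := h.w_le_one (B i).1 (B i).2 (by omega) b3
  have hci : c i = gapRatio d (B i).1 (B i).2 i *
    (if 0 < d.2 (B i).1 (B i).2 ∧ d.2 (B i).1 (B i).2 < 1 then
      d.2 (B i).1 (B i).2 / (1 - d.2 (B i).1 (B i).2) else 1) := if_pos hin
  refine ⟨fun j hj hj' hj0 => ?_, fun j hj hj' hj0 => ?_, fun h1 => ?_, fun h0 => ?_,
    fun h0 h1 => ?_⟩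
  · have hjn : j + 1 < n := by omega
    obtain ⟨a1, a2, a3, a4, a5⟩ := hB j hjn
    obtain ⟨a6, a7⟩ := a5 p q hj hj' hn hj0
    -- Gaps that are visible in a common interval have the same block: each is visible in the block
    -- of the other.
    have e1 := a5 (B i).1 (B i).2 (by omega) (by omega) b3 (by
      rw [h.gapRatio_comp b6 b7 b3 hj hj']; exact mul_pos hU hj0)
    have e2 := b5 (B j).1 (B j).2 (by omega) (by omega) a3 (by
      rw [h.gapRatio_comp a6 a7 a3 hp hq]
      exact mul_pos (h.width_pos a6 a7 a3 hj hj' a4) hi)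
    have e3 : B j = B i := Prod.ext (by omega) (by omega)
    refine ⟨by simp only [e, e3], ?_⟩
    rw [hci]
    simp only [c, if_pos hjn, e3]
    rw [h.gapRatio_comp b6 b7 b3 hj hj', h.gapRatio_comp b6 b7 b3 hp hq]
    ring
  · have hjn : j + 1 < n := by omega
    obtain ⟨a1, a2, a3, a4, a5⟩ := hB j hjn
    have hz : gapRatio d (B i).1 (B i).2 j = 0 := by
      rw [h.gapRatio_comp b6 b7 b3 hj hj', hj0, mul_zero]
    have e1 := b5 _ _ (by omega) (by omega) (by omega)
      (h.gapRatio_pos_min_max b1 b2 b3 a1 a2 a3 (by omega) (by omega) b4 a4)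
    have e2 : (B i).1 ≤ (B j).1 := by omega
    have e3 : (B j).2 ≤ (B i).2 := by omega
    have e4 : ((B j).2 - (B j).1 : ℝ) < (B i).2 - (B i).1 := by
      have : (B j).2 + (B i).1 < (B i).2 + (B j).1 := by
        by_contra hcon
        have e5 : B j = B i := Prod.ext (by omega) (by omega)
        rw [e5, hz] at a4
        exact lt_irrefl 0 a4
      have : ((B j).2 + (B i).1 : ℝ) < (B i).2 + (B j).1 := by exact_mod_cast this
      linarith
    have e5 : ((B j).1 : ℝ) < (B j).2 := by exact_mod_cast (show (B j).1 < (B j).2 by omega)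
    have e6 : ((B i).2 - (B i).1 : ℝ) < n := by
      have : ((B i).2 : ℝ) < n := by exact_mod_cast b3
      have : (0 : ℝ) ≤ (B i).1 := Nat.cast_nonneg _
      linarith
    have e7 := h.w_comp (B i).1 (B i).2 (B j).1 (B j).2 e2 (by omega) e3 b3
    have e8 : d.1 (B i).1 (B i).2 (B j).2 - d.1 (B i).1 (B i).2 (B j).1 = 0 := by
      have := h.gapRatio_comp e2 e3 b3 a1 a2
      rw [hz] at this
      exact (mul_eq_zero.1 this.symm).resolve_right a4.ne'
    -- The smaller block collapses in the larger one, so `w_comp` leaves only two possibilities: `w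
    -- = 0` on the smaller block or `w = 1` on the larger one. In either case the exponents are in
    -- strict order.
    rw [e8, zero_mul, zero_mul] at e7
    simp only [e]
    rcases mul_eq_zero.1 e7 with e9 | e9
    · rw [e9, if_neg zero_ne_one, if_pos rfl]
      split_ifs <;> linarith
    · rw [if_pos (show d.2 (B i).1 (B i).2 = 1 by linarith)]
      split_ifs <;> linarith
  · rw [h1] at hw
    simp only [e]
    rw [if_pos (by linarith)]
    exact sub_pos.2 (by exact_mod_cast (show (B i).1 < (B i).2 by omega))
  · rw [h0, zero_mul, sub_zero, mul_one] at hw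
    have := (mul_eq_zero.1 hw.symm).resolve_left hU.ne'
    simp only [e]
    rw [this, if_neg zero_ne_one, if_pos rfl]
    have : ((B i).2 : ℝ) < n := by exact_mod_cast b3
    have : (0 : ℝ) ≤ (B i).1 := Nat.cast_nonneg _
    linarith
  · have g0 : d.2 (B i).1 (B i).2 ≠ 0 := by
      intro h2
      rw [h2] at hw
      linarith
    have g1 : d.2 (B i).1 (B i).2 ≠ 1 := by
      intro h2
      rw [h2] at hw
      nlinarith [mul_pos hU (sub_pos.2 h1)]
    refine ⟨by simp only [e, if_neg g0, if_neg g1], ?_⟩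
    rw [hci, if_pos ⟨hW0.lt_of_ne g0.symm, hW1.lt_of_ne g1⟩, h.gapRatio_comp b6 b7 b3 hp hq]
    have : 1 - d.2 (B i).1 (B i).2 ≠ 0 := sub_ne_zero.2 g1.symm
    field_simp
    linear_combination -hw

end IsRatioSystem

/-! ### Configurations of distinct points and their limits. -/

/-- The system of ratios of points with positive gaps `x i`, together with a height `y`. -/
noncomputable def gapSystem (n : ℕ) (x : ℕ → ℝ) (y : ℝ) : (ℕ → ℕ → ℕ → ℝ) × (ℕ → ℕ → ℝ) :=
  (fun p q k => if p < q ∧ q < n ∧ p ≤ k ∧ k ≤ q then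
      (∑ i ∈ Finset.Ico p k, x i) / ∑ i ∈ Finset.Ico p q, x i else 0,
    fun p q => if p < q ∧ q < n then
      (∑ i ∈ Finset.Ico p q, x i) / ((∑ i ∈ Finset.Ico p q, x i) + y) else 0)

section gapSystem

variable {n : ℕ} {x : ℕ → ℝ} {y : ℝ}

lemma sum_Ico_pos (hx : ∀ i, 0 < x i) {p q : ℕ} (hpq : p < q) : 0 < ∑ i ∈ Finset.Ico p q, x i :=
  Finset.sum_pos (fun i _ => hx i) (by simpa using hpq)

lemma isRatioSystem_gapSystem (hx : ∀ i, 0 < x i) (hy : 0 < y) :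
    IsRatioSystem n (gapSystem n x y) where
  z_left p q hpq hq := by simp [gapSystem]
  z_right p q hpq hq := by
    have := (sum_Ico_pos hx hpq).ne'
    simp [gapSystem, hpq, hq, hpq.le, this]
  z_step p q k hpq hq hk hk' := by
    have := sum_Ico_pos hx hpq
    simp only [gapSystem, hpq, hq, hk, hk'.le, show p ≤ k + 1 by omega, show k + 1 ≤ q by omega,
      and_self, if_true]
    rw [Finset.sum_Ico_succ_top hk]
    gcongr
    linarith [hx k]
  z_comp P Q p q k hP hpq hQ hn hk hk' := by
    have h1 := (sum_Ico_pos hx hpq).ne'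
    have h2 := (sum_Ico_pos hx (show P < Q by omega)).ne'
    simp only [gapSystem, hpq, hP, hQ, hn, hk, hk', show P < Q by omega, show P ≤ k by omega,
      show k ≤ Q by omega, show p ≤ Q by omega, show P ≤ q by omega, show q < n by omega,
      and_self, if_true]
    rw [← Finset.sum_Ico_consecutive _ hP hk, ← Finset.sum_Ico_consecutive _ hP hpq.le]
    field_simp
    ring
  z_junk p q k h := if_neg h
  w_nonneg p q hpq hq := by
    have := sum_Ico_pos hx hpq
    simp only [gapSystem, hpq, hq, and_self, if_true]
    positivity
  w_le_one p q hpq hq := by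
    have := sum_Ico_pos hx hpq
    simp only [gapSystem, hpq, hq, and_self, if_true]
    rw [div_le_one (by positivity)]
    linarith
  w_comp P Q p q hP hpq hQ hn := by
    have h1 := sum_Ico_pos hx hpq
    have h2 := sum_Ico_pos hx (show P < Q by omega)
    simp only [gapSystem, hpq, hP, hQ, hn, show P < Q by omega,
      show p ≤ Q by omega, show P ≤ q by omega, show q < n by omega, and_self, if_true]
    rw [← Finset.sum_Ico_consecutive _ hP hpq.le]
    have h3 : (∑ i ∈ Finset.Ico p q, x i) + y ≠ 0 := by positivity
    have h4 : (∑ i ∈ Finset.Ico P Q, x i) + y ≠ 0 := by positivity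
    field_simp
    ring
  w_junk p q h := if_neg h

lemma gapRatio_gapSystem {p q i : ℕ} (hp : p ≤ i) (hi : i < q) (hq : q < n) :
    gapRatio (gapSystem n x y) p q i = x i / ∑ i ∈ Finset.Ico p q, x i := by
  simp only [gapRatio, gapSystem, hp, hi.le, hq, show p < q by omega, show p ≤ i + 1 by omega,
    show i + 1 ≤ q by omega, and_self, if_true]
  rw [Finset.sum_Ico_succ_top hp]
  ring

/-- Each pair contributes the factor `L + L ^ 2 / y`, with `L` the distance of its two points. These
factors do not involve the tree, so `treeWeight` and the monomials define the same projective point.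
-/
lemma treeWeight_gapSystem (hx : ∀ i, 0 < x i) (hy : 0 < y) (T : MaximalColoredTree n) :
    (∏ j : Fin n, (if (j : ℕ) + 1 < n then x j else y) ^ weightVector T j) =
      treeWeight (gapSystem n x y) T * pairProd 0 n fun p q => (∑ i ∈ Finset.Ico p q, x i) +
        (∑ i ∈ Finset.Ico p q, x i) ^ 2 / y := by
  rw [prod_zpow_weightVector T x hy.ne', treeWeight, ← pairProd_mul]
  refine pairProd_congr fun p q _ hpq hq => ?_
  have h1 := T.1.meet_mem (a := 0) zero_le hpq (by rw [T.2]; omega)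
  have h2 := sum_Ico_pos hx hpq
  have h3 : (∑ i ∈ Finset.Ico p q, x i) + y ≠ 0 := by positivity
  simp only [vertexMonomial, meetWeight, gapRatio_gapSystem h1.1 h1.2 hq]
  simp only [gapSystem, hpq, hq, and_self, if_true]
  split_ifs
  · field_simp
    ring
  · field_simp
    ring

lemma pairProd_pos {a b : ℕ} {f : ℕ → ℕ → ℝ} (h : ∀ p q, a ≤ p → p < q → q < b → 0 < f p q) :
    0 < pairProd a b f := by
  unfold pairProd
  refine Finset.prod_pos fun p hp => Finset.prod_pos fun q hq => ?_
  rw [Finset.mem_Ico] at hp hq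
  exact h p q hp.1 (by omega) hq.2

end gapSystem

open Filter Topology in
/-- Every system of ratios is a limit of systems of ratios of distinct points. -/
lemma IsRatioSystem.exists_tendsto {n : ℕ} {d : (ℕ → ℕ → ℕ → ℝ) × (ℕ → ℕ → ℝ)}
    (h : IsRatioSystem n d) : ∃ x : ℝ → ℕ → ℝ, (∀ s i, 0 < x s i) ∧
      Tendsto (fun s => gapSystem n (x s) 1) atTop (𝓝 d) := by
  obtain ⟨c, e, hc, H⟩ := h.exists_scales
  refine ⟨fun s i => c i * Real.exp (e i * s), fun s i => mul_pos (hc i) (Real.exp_pos _), ?_⟩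
  set x : ℝ → ℕ → ℝ := fun s i => c i * Real.exp (e i * s) with hx
  have hxpos : ∀ s i, 0 < x s i := fun s i => mul_pos (hc i) (Real.exp_pos _)
  have hratio : ∀ p q i j, p ≤ i → i < q → q < n → 0 < gapRatio d p q i → p ≤ j → j < q →
      Tendsto (fun s => x s j / x s i) atTop (𝓝 (gapRatio d p q j / gapRatio d p q i)) := by
    intro p q i j hp hi hq hpos hj hj'
    obtain ⟨H1, H2, -⟩ := H p q i hp hi hq hpos
    have hform : (fun s => x s j / x s i) = fun s => c j / c i * Real.exp ((e j - e i) * s) := by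
      funext s
      simp only [hx]
      rw [sub_mul, Real.exp_sub]
      field_simp
    rw [hform]
    rcases (h.gapRatio_nonneg hj hj' hq).lt_or_eq with hj0 | hj0
    · obtain ⟨e1, e2⟩ := H1 j hj hj' hj0
      have : c j / c i = gapRatio d p q j / gapRatio d p q i := by
        rw [div_eq_div_iff (hc i).ne' hpos.ne', e2, mul_comm]
      simp only [e1, sub_self, zero_mul, Real.exp_zero, mul_one, this]
      exact tendsto_const_nhds
    · have e1 := H2 j hj hj' hj0.symm
      rw [← hj0, zero_div, ← mul_zero (c j / c i)]
      exact (Real.tendsto_exp_atBot.comp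
        (tendsto_id.const_mul_atTop_of_neg (sub_neg.2 e1))).const_mul _
  have hlen : ∀ p q i, p ≤ i → i < q → q < n → 0 < gapRatio d p q i →
      Tendsto (fun s => (∑ j ∈ Finset.Ico p q, x s j) / x s i) atTop
        (𝓝 (gapRatio d p q i)⁻¹) := by
    intro p q i hp hi hq hpos
    have : (gapRatio d p q i)⁻¹ = ∑ j ∈ Finset.Ico p q, gapRatio d p q j / gapRatio d p q i := by
      rw [← Finset.sum_div, IsRatioSystem.sum_gapRatio d p q (by omega : p ≤ q),
        h.z_left p q (by omega) hq, h.z_right p q (by omega) hq, sub_zero, one_div]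
    rw [this]
    simp only [Finset.sum_div]
    refine tendsto_finsetSum _ fun j hj => ?_
    rw [Finset.mem_Ico] at hj
    exact hratio p q i j hp hi hq hpos hj.1 hj.2
  have hgap : ∀ p q j, p ≤ j → j < q → q < n →
      Tendsto (fun s => x s j / ∑ i ∈ Finset.Ico p q, x s i) atTop (𝓝 (gapRatio d p q j)) := by
    intro p q j hj hj' hq
    -- A visible gap serves as unit of length, because only quotients by such a gap are known to
    -- converge to finite limits.
    obtain ⟨i, hi, hi', hpos⟩ := h.exists_gapRatio_pos_of_lt (show p < q by omega) hq
    have := (hratio p q i j hi hi' hq hpos hj hj').div (hlen p q i hi hi' hq hpos)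
      (inv_ne_zero hpos.ne')
    rw [div_inv_eq_mul, div_mul_cancel₀ _ hpos.ne'] at this
    refine this.congr fun s => ?_
    rw [Pi.div_apply, div_div_div_cancel_right₀ (hxpos s i).ne']
  refine Tendsto.prodMk_nhds ?_ ?_
  · refine tendsto_pi_nhds.2 fun p => tendsto_pi_nhds.2 fun q => tendsto_pi_nhds.2 fun k => ?_
    by_cases hk : p < q ∧ q < n ∧ p ≤ k ∧ k ≤ q
    · simp only [if_pos hk, Finset.sum_div]
      have : d.1 p q k = ∑ j ∈ Finset.Ico p k, gapRatio d p q j := by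
        rw [IsRatioSystem.sum_gapRatio d p q hk.2.2.1, h.z_left p q hk.1 hk.2.1, sub_zero]
      rw [this]
      refine tendsto_finsetSum _ fun j hj => ?_
      rw [Finset.mem_Ico] at hj
      exact hgap p q j hj.1 (by omega) hk.2.1
    · simp only [if_neg hk, h.z_junk p q k hk]
      exact tendsto_const_nhds
  · refine tendsto_pi_nhds.2 fun p => tendsto_pi_nhds.2 fun q => ?_
    by_cases hk : p < q ∧ q < n
    · simp only [if_pos hk]
      obtain ⟨hpq, hq⟩ := hk
      obtain ⟨i, hi, hi', hpos⟩ := h.exists_gapRatio_pos_of_lt hpq hq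
      obtain ⟨-, -, H1, H0, Hm⟩ := H p q i hi hi' hq hpos
      have hl := hlen p q i hi hi' hq hpos
      have hL : ∀ s, ∑ j ∈ Finset.Ico p q, x s j =
          x s i * ((∑ j ∈ Finset.Ico p q, x s j) / x s i) := fun s => by
        rw [mul_div_cancel₀ _ (hxpos s i).ne']
      have hLpos : ∀ s, 0 < ∑ j ∈ Finset.Ico p q, x s j := fun s => sum_Ico_pos (hxpos s) hpq
      rcases (h.w_nonneg p q hpq hq).eq_or_lt with h0 | h0
      · have h1 : Tendsto (fun s => x s i) atTop (𝓝 0) := by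
          rw [← mul_zero (c i)]
          exact (Real.tendsto_exp_atBot.comp
            (tendsto_id.const_mul_atTop_of_neg (H0 h0.symm))).const_mul _
        have h2 : Tendsto (fun s => ∑ j ∈ Finset.Ico p q, x s j) atTop (𝓝 0) := by
          have := h1.mul hl
          rw [zero_mul] at this
          exact this.congr fun s => (hL s).symm
        have h3 := h2.div (h2.add_const 1) (by norm_num)
        rw [zero_div] at h3
        rw [← h0]
        exact h3
      · rcases (h.w_le_one p q hpq hq).eq_or_lt with h1 | h1
        · have h2 : Tendsto (fun s => x s i) atTop atTop :=
            (Real.tendsto_exp_atTop.comp (tendsto_id.const_mul_atTop (H1 h1))).const_mul_atTop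
              (hc i)
          have h3 : Tendsto (fun s => ∑ j ∈ Finset.Ico p q, x s j) atTop atTop := by
            refine (h2.atTop_mul_pos (inv_pos.2 hpos) hl).congr fun s => (hL s).symm
          have h4 : Tendsto (fun s => 1 - ((∑ j ∈ Finset.Ico p q, x s j) + 1)⁻¹) atTop
              (𝓝 (1 - 0)) :=
            (tendsto_inv_atTop_zero.comp (tendsto_atTop_add_const_right _ _ h3)).const_sub 1
          rw [h1]
          rw [sub_zero] at h4
          refine h4.congr fun s => ?_
          have := hLpos s
          field_simp
          ring
        · obtain ⟨he, hci⟩ := Hm h0 h1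
          have h2 : Tendsto (fun s => ∑ j ∈ Finset.Ico p q, x s j) atTop
              (𝓝 (c i * (gapRatio d p q i)⁻¹)) := by
            refine (hl.const_mul (c i)).congr fun s => ?_
            conv_rhs => rw [hL s]
            simp [hx, he]
          have h3 : 0 < c i * (gapRatio d p q i)⁻¹ := mul_pos (hc i) (inv_pos.2 hpos)
          have h4 := h2.div (h2.add_const 1) (by positivity)
          have h5 : c i * (gapRatio d p q i)⁻¹ / (c i * (gapRatio d p q i)⁻¹ + 1) = d.2 p q := by
            rw [div_eq_iff (by positivity)]
            field_simp
            linarith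
          rwa [h5] at h4
    · simp only [if_neg hk, h.w_junk p q hk]
      exact tendsto_const_nhds

/-! ### A system of ratios is determined by the monomials of the trees -/

lemma log_pairProd {a b : ℕ} {f : ℕ → ℕ → ℝ}
    (h : ∀ p q, a ≤ p → p < q → q < b → f p q ≠ 0) :
    Real.log (pairProd a b f) =
      ∑ p ∈ Finset.Ico a b, ∑ q ∈ Finset.Ico (p + 1) b, Real.log (f p q) := by
  have h' : ∀ p ∈ Finset.Ico a b, ∀ q ∈ Finset.Ico (p + 1) b, f p q ≠ 0 := by
    intro p hp q hq
    rw [Finset.mem_Ico] at hp hq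
    exact h p q hp.1 (by omega) hq.2
  unfold pairProd
  rw [Real.log_prod fun p hp => Finset.prod_ne_zero_iff.2 (h' p hp)]
  exact Finset.sum_congr rfl fun p hp => Real.log_prod (h' p hp)

namespace IsRatioSystem

variable {n : ℕ} {d d' : (ℕ → ℕ → ℕ → ℝ) × (ℕ → ℕ → ℝ)}

/-- Taking for `c` the coefficients of the approximating configurations makes the logarithm of a
factor linear in `log c`, up to a constant of the pair. If `0 < w < 1`, both colors use the same
constant since `c` is then the actual gap at height 1, so that `eta = log 1 = 0`. If `w` is 0 or 1,
only one color is allowed and the constant is free. -/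
lemma exists_log_meetWeight (h : IsRatioSystem n d) : ∃ c : ℕ → ℝ, (∀ i, 0 < c i) ∧
    (∀ p q i j, q < n → IsAllowed d p q i → IsAllowed d p q j →
      c j.1 * gapRatio d p q i.1 = c i.1 * gapRatio d p q j.1) ∧
    (∀ p q i, p ≤ i → i < q → q < n → 0 < gapRatio d p q i → 0 < d.2 p q → d.2 p q < 1 →
      c i * (1 - d.2 p q) = gapRatio d p q i * d.2 p q) ∧
    ∀ p q, p < q → q < n → ∃ κ : ℝ, ∀ o, IsAllowed d p q o →
      Real.log (meetWeight d p q o) = κ + meetScore (fun i => Real.log (c i)) 0 o := by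
  obtain ⟨c, e, hc, H⟩ := h.exists_scales
  have hj : ∀ p q i j, q < n → IsAllowed d p q i → IsAllowed d p q j →
      c j.1 * gapRatio d p q i.1 = c i.1 * gapRatio d p q j.1 := fun p q i j hq hi hj =>
    ((H p q i.1 hi.1 hi.2.1 hq hi.2.2.1).1 j.1 hj.1 hj.2.1 hj.2.2.1).2
  refine ⟨c, hc, hj, fun p q i hp hi hq hpos h0 h1 =>
    ((H p q i hp hi hq hpos).2.2.2.2 h0 h1).2, fun p q hpq hq => ?_⟩
  obtain ⟨i, hp, hi, hpos⟩ := h.exists_gapRatio_pos_of_lt hpq hq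
  obtain ⟨H1, -, -, -, H2⟩ := H p q i hp hi hq hpos
  have hlog : ∀ o, IsAllowed d p q o → Real.log (gapRatio d p q o.1) =
      Real.log (gapRatio d p q i) - Real.log (c i) + Real.log (c o.1) := by
    intro o ho
    have h1 := (H1 o.1 ho.1 ho.2.1 ho.2.2.1).2
    have h2 := congrArg Real.log h1
    rw [Real.log_mul (hc _).ne' hpos.ne', Real.log_mul (hc _).ne' ho.2.2.1.ne'] at h2
    linarith
  by_cases h0 : 0 < d.2 p q
  · by_cases h1 : d.2 p q < 1
    · have h3 := congrArg Real.log (H2 h0 h1).2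
      have h4 : 0 < 1 - d.2 p q := sub_pos.2 h1
      rw [Real.log_mul (hc _).ne' h4.ne', Real.log_mul hpos.ne' h0.ne'] at h3
      refine ⟨Real.log (gapRatio d p q i) - Real.log (c i) + Real.log (1 - d.2 p q),
        fun o ho => ?_⟩
      have h5 := hlog o ho
      have h6 := ho.2.2.1
      unfold meetWeight meetScore
      split_ifs
      · rw [Real.log_mul (by positivity) h0.ne', Real.log_pow, h5]
        push_cast
        linarith
      · rw [Real.log_mul h6.ne' h4.ne', h5]
        linarith
    · refine ⟨2 * (Real.log (gapRatio d p q i) - Real.log (c i)) + Real.log (d.2 p q),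
        fun o ho => ?_⟩
      have h5 := hlog o ho
      have h6 := ho.2.2.1
      have h7 : o.2 = true := by
        by_contra hf
        have := ho.2.2.2
        rw [if_neg hf] at this
        exact h1 this
      unfold meetWeight meetScore
      rw [if_pos h7, if_pos h7, Real.log_mul (by positivity) h0.ne', Real.log_pow, h5]
      push_cast
      ring
  · refine ⟨Real.log (gapRatio d p q i) - Real.log (c i) + Real.log (1 - d.2 p q),
        fun o ho => ?_⟩
    have h4 : 0 < 1 - d.2 p q := by linarith
    have h5 := hlog o ho
    have h6 := ho.2.2.1
    have h7 : ¬ o.2 = true := by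
      intro hf
      have := ho.2.2.2
      rw [if_pos hf] at this
      exact h0 this
    unfold meetWeight meetScore
    rw [if_neg h7, if_neg h7, Real.log_mul h6.ne' h4.ne', h5]
    ring

/-- Every allowed vertex is used by some tree of non-zero weight, so the support of the weights
determines which vertices are allowed. -/
lemma isAllowed_of_treeWeight (h : IsRatioSystem n d) (h' : IsRatioSystem n d')
    (H : ∀ T : MaximalColoredTree n, treeWeight d T ≠ 0 → treeWeight d' T ≠ 0) {p q : ℕ}
    (hpq : p < q) (hq : q < n) {o : ℕ × Bool} (ho : IsAllowed d p q o) : IsAllowed d' p q o := by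
  obtain ⟨T, hT, rfl⟩ := h.exists_tree_meet_eq hpq hq ho
  exact (h'.treeWeight_ne_zero_iff T).1 (H T hT) p q hpq hq

/-- Let `lam` be the difference of the logarithmic coefficients of both systems. The total score of
a tree for `lam`, corrected by constants of the pairs, is the same for all trees of non-zero weight.
The greedy trees for `lam` and `-lam` then show that `lam` is constant on the allowed vertices of
each pair, which makes the gap ratios proportional and fixes `w`. -/
lemma eq_of_treeWeight (h : IsRatioSystem n d) (h' : IsRatioSystem n d') {K : ℝ} (hK : K ≠ 0)
    (H : ∀ T : MaximalColoredTree n, treeWeight d T = K * treeWeight d' T) : d = d' := by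
  have hall : ∀ p q, p < q → q < n → ∀ o, IsAllowed d p q o ↔ IsAllowed d' p q o :=
    fun p q hpq hq o =>
    ⟨h.isAllowed_of_treeWeight h' (fun T hT => right_ne_zero_of_mul (H T ▸ hT)) hpq hq,
      h'.isAllowed_of_treeWeight h (fun T hT => by rw [H T]; exact mul_ne_zero hK hT) hpq hq⟩
  obtain ⟨c, hc, c1, c2, c3⟩ := h.exists_log_meetWeight
  obtain ⟨c', hc', c1', c2', c3'⟩ := h'.exists_log_meetWeight
  choose! κ hκ using c3
  choose! κ' hκ' using c3'
  set lam : ℕ → ℝ := fun i => Real.log (c i) - Real.log (c' i) with hlam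
  have hsum : ∀ T : MaximalColoredTree n, (∀ p q, p < q → q < n →
      IsAllowed d p q (T.1.meet 0 p q)) → ∑ p ∈ Finset.Ico 0 n, ∑ q ∈ Finset.Ico (p + 1) n,
        (κ p q - κ' p q + meetScore lam 0 (T.1.meet 0 p q)) = Real.log K := by
    intro T hT
    have hT0 := (h.treeWeight_ne_zero_iff T).2 hT
    have hT0' : treeWeight d' T ≠ 0 := right_ne_zero_of_mul (H T ▸ hT0)
    have hlog := congrArg Real.log (H T)
    rw [Real.log_mul hK hT0', treeWeight, treeWeight, log_pairProd, log_pairProd] at hlog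
    · rw [← sub_eq_iff_eq_add, ← Finset.sum_sub_distrib] at hlog
      rw [← hlog]
      refine Finset.sum_congr rfl fun p hp => ?_
      rw [← Finset.sum_sub_distrib]
      refine Finset.sum_congr rfl fun q hq => ?_
      rw [Finset.mem_Ico] at hp hq
      have hA := hT p q (by omega) hq.2
      rw [hκ p q (by omega) hq.2 _ hA, hκ' p q (by omega) hq.2 _ ((hall p q (by omega) hq.2 _).1 hA)]
      simp only [meetScore, hlam]
      split_ifs <;> ring
    · intro p q _ hpq hq
      have hA := (hall p q hpq hq _).1 (hT p q hpq hq)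
      exact (h'.meetWeight_ne_zero_iff hA.1 hA.2.1 hq).2 hA
    · intro p q _ hpq hq
      have hA := hT p q hpq hq
      exact (h.meetWeight_ne_zero_iff hA.1 hA.2.1 hq).2 hA
  -- `T` maximizes and `S` minimizes the score at every pair at once. Their totals agree, so the
  -- maximum equals the minimum at each single pair.
  have hconst : ∀ p q, p < q → q < n → ∀ o o', IsAllowed d p q o → IsAllowed d p q o' →
      meetScore lam 0 o = meetScore lam 0 o' := by
    intro p q hpq hq
    obtain ⟨T, hT⟩ := h.exists_maximalColoredTree (by omega) lam 0
    obtain ⟨S, hS⟩ := h.exists_maximalColoredTree (by omega) (fun i => - lam i) 0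
    have hneg : ∀ o, meetScore (fun i => - lam i) 0 o = - meetScore lam 0 o := by
      intro o
      simp only [meetScore]
      split_ifs <;> ring
    have e1 := hsum T fun p q hpq hq => (hT p q hpq hq).1
    have e2 := hsum S fun p q hpq hq => (hS p q hpq hq).1
    have hle : ∀ p ∈ Finset.Ico 0 n, ∀ q ∈ Finset.Ico (p + 1) n,
        κ p q - κ' p q + meetScore lam 0 (S.1.meet 0 p q) ≤
          κ p q - κ' p q + meetScore lam 0 (T.1.meet 0 p q) := by
      intro p hp q hq
      rw [Finset.mem_Ico] at hp hq
      have := (hT p q (by omega) hq.2).2 _ (hS p q (by omega) hq.2).1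
      linarith
    have e3 := (Finset.sum_eq_sum_iff_of_le fun p hp => Finset.sum_le_sum (hle p hp)).1
      (e2.trans e1.symm) p (by simp; omega)
    have e4 := (Finset.sum_eq_sum_iff_of_le (hle p (by simp; omega))).1 e3 q (by simp; omega)
    have e5 : ∀ o, IsAllowed d p q o → meetScore lam 0 o = meetScore lam 0 (T.1.meet 0 p q) := by
      intro o ho
      have h1 := (hT p q hpq hq).2 o ho
      have h2 := (hS p q hpq hq).2 o ho
      rw [hneg, hneg] at h2
      linarith
    intro o o' ho ho'
    rw [e5 o ho, e5 o' ho']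
  have hgap : ∀ p q, p < q → q < n → ∀ i, p ≤ i → i < q → gapRatio d p q i = gapRatio d' p q i := by
    intro p q hpq hq
    obtain ⟨⟨i, b⟩, ho⟩ := h.exists_isAllowed hpq hq
    have ho' := (hall p q hpq hq _).1 ho
    have key : ∀ j, p ≤ j → j < q → gapRatio d p q j * gapRatio d' p q i =
        gapRatio d' p q j * gapRatio d p q i := by
      intro j hj hj'
      by_cases hA : IsAllowed d p q (j, b)
      · have hA' := (hall p q hpq hq _).1 hA
        have e1 := hconst p q hpq hq _ _ ho hA
        have e2 : Real.log (c i) + Real.log (c' j) = Real.log (c j) + Real.log (c' i) := by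
          cases b <;> simp [meetScore, hlam] at e1 <;> linarith
        rw [← Real.log_mul (hc _).ne' (hc' _).ne', ← Real.log_mul (hc _).ne' (hc' _).ne'] at e2
        have e3 := Real.log_injOn_pos (Set.mem_Ioi.2 (mul_pos (hc _) (hc' _)))
          (Set.mem_Ioi.2 (mul_pos (hc _) (hc' _))) e2
        have e4 := c1 p q _ _ hq ho hA
        have e5 := c1' p q _ _ hq ho' hA'
        simp only at e4 e5
        have := hc i
        have := hc' i
        have e6 : c i * c' i * (gapRatio d p q j * gapRatio d' p q i) =
            c i * c' i * (gapRatio d' p q j * gapRatio d p q i) := by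
          linear_combination (-c' i * gapRatio d' p q i) * e4 + (c i * gapRatio d p q i) * e5
            - (gapRatio d p q i * gapRatio d' p q i) * e3
        exact mul_left_cancel₀ (by positivity) e6
      · have e1 : gapRatio d p q j = 0 := by
          by_contra hne
          exact hA ⟨hj, hj', (h.gapRatio_nonneg hj hj' hq).lt_of_ne' hne, ho.2.2.2⟩
        have e2 : gapRatio d' p q j = 0 := by
          by_contra hne
          exact hA ((hall p q hpq hq _).2
            ⟨hj, hj', (h'.gapRatio_nonneg hj hj' hq).lt_of_ne' hne, ho'.2.2.2⟩)
        rw [e1, e2, zero_mul, zero_mul]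
    -- Proportional gap ratios are equal since on both sides they add up to 1.
    have hs : gapRatio d' p q i = gapRatio d p q i := by
      have e1 := Finset.sum_congr (rfl : Finset.Ico p q = _) fun j hj =>
        key j (Finset.mem_Ico.1 hj).1 (Finset.mem_Ico.1 hj).2
      rw [← Finset.sum_mul, ← Finset.sum_mul, sum_gapRatio d p q hpq.le,
        sum_gapRatio d' p q hpq.le, h.z_left p q hpq hq, h.z_right p q hpq hq,
        h'.z_left p q hpq hq, h'.z_right p q hpq hq] at e1
      linarith
    intro j hj hj'
    have := key j hj hj'
    rw [hs] at this
    exact mul_right_cancel₀ ho.2.2.1.ne' this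
  refine Prod.ext ?_ ?_
  · funext p q k
    by_cases hk : p < q ∧ q < n ∧ p ≤ k ∧ k ≤ q
    · obtain ⟨hpq, hq, hp, hkq⟩ := hk
      have e1 := sum_gapRatio d p q hp
      have e2 := sum_gapRatio d' p q hp
      rw [h.z_left p q hpq hq, sub_zero] at e1
      rw [h'.z_left p q hpq hq, sub_zero] at e2
      rw [← e1, ← e2]
      refine Finset.sum_congr rfl fun i hi => ?_
      rw [Finset.mem_Ico] at hi
      exact hgap p q hpq hq i hi.1 (by omega)
    · rw [h.z_junk _ _ _ hk, h'.z_junk _ _ _ hk]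
  · funext p q
    by_cases hk : p < q ∧ q < n
    · obtain ⟨hpq, hq⟩ := hk
      obtain ⟨i, hp, hi, hpos⟩ := h.exists_gapRatio_pos_of_lt hpq hq
      have hA : ∀ b, IsAllowed d p q (i, b) ↔ if b = true then 0 < d.2 p q else d.2 p q < 1 :=
        fun b => ⟨fun hh => hh.2.2.2, fun hh => ⟨hp, hi, hpos, hh⟩⟩
      have hA' : ∀ b, IsAllowed d p q (i, b) ↔ if b = true then 0 < d'.2 p q else d'.2 p q < 1 :=
        fun b => by
          rw [hall p q hpq hq]
          exact ⟨fun hh => hh.2.2.2, fun hh => ⟨hp, hi, hgap p q hpq hq i hp hi ▸ hpos, hh⟩⟩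
      have t := (hA true).symm.trans (hA' true)
      have f := (hA false).symm.trans (hA' false)
      simp only [if_true, Bool.false_eq_true, if_false] at t f
      rcases (h.w_nonneg p q hpq hq).eq_or_lt with h0 | h0
      · have := h'.w_nonneg p q hpq hq
        rw [← h0] at t ⊢
        simp only [lt_irrefl, false_iff, not_lt] at t
        exact le_antisymm this t
      · rcases (h.w_le_one p q hpq hq).eq_or_lt with h1 | h1
        · have := h'.w_le_one p q hpq hq
          rw [h1] at f ⊢
          simp only [lt_irrefl, false_iff, not_lt] at f
          exact le_antisymm f this
        -- Both colors are allowed at the gap `i`, and their scores are `2 * lam i` and `lam i`.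
        -- Hence `lam i = 0`: not only the shape but also the length relative to the height agrees.
        · have e1 := hconst p q hpq hq _ _ ((hA true).2 (by simpa using h0))
            ((hA false).2 (by simpa using h1))
          have e2 : Real.log (c i) = Real.log (c' i) := by
            simp [meetScore, hlam] at e1
            linarith
          have e3 := Real.log_injOn_pos (Set.mem_Ioi.2 (hc i)) (Set.mem_Ioi.2 (hc' i)) e2
          have e4 := c2 p q i hp hi hq hpos h0 h1
          have e5 := c2' p q i hp hi hq (hgap p q hpq hq i hp hi ▸ hpos) (t.1 h0) (f.1 h1)
          rw [← e3, ← hgap p q hpq hq i hp hi] at e5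
          have := hc i
          have e6 : (c i + gapRatio d p q i) * d.2 p q = (c i + gapRatio d p q i) * d'.2 p q := by
            linear_combination e5 - e4
          exact mul_left_cancel₀ (by positivity) e6
    · rw [h.w_junk _ _ hk, h'.w_junk _ _ hk]

end IsRatioSystem

/-! ### Non-negative points of toric varieties -/

/-- Farkas' lemma over the rational numbers. -/
lemma exists_nonneg_combination {ι E : Type*} [AddCommGroup E] [Module ℚ E] (α : ι → E →ₗ[ℚ] ℚ)
    (s : Finset ι) (γ : E →ₗ[ℚ] ℚ) (h : ∀ x, (∀ i ∈ s, α i x ≤ 0) → γ x ≤ 0) :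
    ∃ u : ι → ℚ, (∀ i, 0 ≤ u i) ∧ γ = ∑ i ∈ s, u i • α i := by
  classical
  induction s using Finset.induction_on generalizing α γ with
  | empty =>
    refine ⟨0, fun _ => le_rfl, LinearMap.ext fun x => ?_⟩
    have h1 := h x (by simp)
    have h2 := h (-x) (by simp)
    rw [map_neg] at h2
    simp only [Finset.sum_empty, LinearMap.zero_apply]
    linarith
  | insert a s ha ih =>
    by_cases hγ : ∀ x, (∀ i ∈ s, α i x ≤ 0) → γ x ≤ 0
    · obtain ⟨u, hu, hs⟩ := ih α γ hγ
      refine ⟨Function.update u a 0, fun i => ?_, ?_⟩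
      · by_cases hi : i = a
        · subst hi; simp
        · simpa [hi] using hu i
      · rw [Finset.sum_insert ha, hs]
        simp only [Function.update_self, zero_smul, zero_add]
        refine Finset.sum_congr rfl fun i hi => ?_
        rw [Function.update_of_ne (ne_of_mem_of_not_mem hi ha)]
    · push Not at hγ
      -- The new inequality is needed, so it fails at some point with `γ` positive. Scaled to `α a
      -- x₀ = 1`, this point gives the projection `x ↦ x - α a x • x₀` onto the kernel of `α a`, and
      -- the induction hypothesis is applied to the forms composed with it.
      obtain ⟨x₁, hx₁, hγ₁⟩ := hγ
      have hpos : 0 < α a x₁ := by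
        by_contra hle
        exact absurd (h x₁ (by simpa [not_lt.1 hle] using hx₁)) (not_le.2 hγ₁)
      obtain ⟨x₀, hx₀, hγ₀, ha₀⟩ : ∃ x₀, (∀ i ∈ s, α i x₀ ≤ 0) ∧ 0 < γ x₀ ∧ α a x₀ = 1 := by
        refine ⟨(α a x₁)⁻¹ • x₁, fun i hi => ?_, ?_, ?_⟩
        · rw [map_smul, smul_eq_mul]
          exact mul_nonpos_of_nonneg_of_nonpos (inv_nonneg.2 hpos.le) (hx₁ i hi)
        · rw [map_smul, smul_eq_mul]
          exact mul_pos (inv_pos.2 hpos) hγ₁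
        · rw [map_smul, smul_eq_mul, inv_mul_cancel₀ hpos.ne']
      obtain ⟨u, hu, hs⟩ := ih (fun i => α i - α i x₀ • α a) (γ - γ x₀ • α a) fun x hx => by
        have := h (x - α a x • x₀) fun i hi => by
          rcases Finset.mem_insert.1 hi with rfl | hi
          · simp [ha₀]
          · have := hx i hi
            simp only [LinearMap.sub_apply, LinearMap.smul_apply, smul_eq_mul, map_sub,
              map_smul] at this ⊢
            linarith
        simp only [LinearMap.sub_apply, LinearMap.smul_apply, smul_eq_mul, map_sub,
          map_smul] at this ⊢
        linarith
      refine ⟨Function.update u a (γ x₀ - ∑ i ∈ s, u i * α i x₀), fun i => ?_, ?_⟩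
      · by_cases hi : i = a
        · subst hi
          have : ∑ i ∈ s, u i * α i x₀ ≤ 0 :=
            Finset.sum_nonpos fun i hi => mul_nonpos_of_nonneg_of_nonpos (hu i) (hx₀ i hi)
          rw [Function.update_self]
          linarith
        · simpa [hi] using hu i
      · rw [Finset.sum_insert ha, Function.update_self]
        have e : ∑ i ∈ s, Function.update u a (γ x₀ - ∑ i ∈ s, u i * α i x₀) i • α i =
            ∑ i ∈ s, u i • α i :=
          Finset.sum_congr rfl fun i hi => by
            rw [Function.update_of_ne (ne_of_mem_of_not_mem hi ha)]
        rw [e]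
        have e2 : ∑ i ∈ s, u i • (α i - α i x₀ • α a) =
            ∑ i ∈ s, u i • α i - (∑ i ∈ s, u i * α i x₀) • α a := by
          simp only [smul_sub, Finset.sum_sub_distrib, Finset.sum_smul, mul_smul]
        rw [e2] at hs
        rw [sub_smul, sub_add_eq_add_sub, ← add_sub_assoc', ← hs, add_sub_cancel]

section Binomials

variable {ι κ : Type*} [Fintype ι] {m : ι → κ → ℤ} {v : ι → ℝ}

/-- A rational relation between the exponent vectors becomes a binomial equation by clearing
denominators and moving the negative part to the other side. -/
lemma exists_natPow_of_relation
    (H : ∀ a b : ι → ℕ, (∀ j, ∑ t, a t * m t j = ∑ t, b t * m t j) →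
      ∏ t, v t ^ a t = ∏ t, v t ^ b t)
    (r : ι → ℚ) (hr : ∀ j, ∑ t, r t * m t j = 0) :
    ∃ (N : ℕ) (a b : ι → ℕ), 0 < N ∧ (∀ t, (N : ℚ) * r t = a t - b t) ∧
      (∀ t, r t = 0 → a t = 0) ∧ (∀ t, 0 < r t → 0 < a t) ∧ (∀ t, 0 ≤ r t → b t = 0) ∧
      ∏ t, v t ^ a t = ∏ t, v t ^ b t := by
  classical
  set N : ℕ := ∏ t, (r t).den with hN
  have hN0 : 0 < N := Finset.prod_pos fun t _ => (r t).den_pos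
  have hz : ∀ t, ∃ z : ℤ, (N : ℚ) * r t = z := by
    intro t
    refine ⟨(∏ s ∈ Finset.univ.erase t, (r s).den : ℕ) * (r t).num, ?_⟩
    rw [hN, ← Finset.prod_erase_mul _ _ (Finset.mem_univ t)]
    push_cast
    rw [mul_assoc, mul_comm ((r t).den : ℚ), Rat.mul_den_eq_num]
  choose z hz using hz
  have hNq : (0 : ℚ) < N := by exact_mod_cast hN0
  have hab : ∀ t, z t = ((z t).toNat : ℤ) - ((-z t).toNat : ℤ) := fun t => by omega
  refine ⟨N, fun t => (z t).toNat, fun t => (-z t).toNat, hN0, fun t => ?_, fun t ht => ?_,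
    fun t ht => ?_, fun t ht => ?_, H _ _ fun j => ?_⟩
  · rw [hz]
    exact_mod_cast hab t
  · have := hz t
    rw [ht, mul_zero] at this
    have : z t = 0 := by exact_mod_cast this.symm
    simp [this]
  · have : (0 : ℚ) < z t := hz t ▸ mul_pos hNq ht
    have : 0 < z t := by exact_mod_cast this
    exact Int.lt_toNat.2 this
  · have : (0 : ℚ) ≤ z t := hz t ▸ mul_nonneg hNq.le ht
    have : 0 ≤ z t := by exact_mod_cast this
    exact Int.toNat_eq_zero.2 (by linarith)
  · rw [← sub_eq_zero, ← Finset.sum_sub_distrib]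
    have h1 : ∑ t, (z t : ℚ) * m t j = 0 := by
      rw [← mul_zero (N : ℚ), ← hr j, Finset.mul_sum]
      exact Finset.sum_congr rfl fun t _ => by rw [← hz, mul_assoc]
    have h2 : ∑ t, z t * m t j = 0 := by exact_mod_cast h1
    rw [← h2]
    refine Finset.sum_congr rfl fun t _ => ?_
    rw [← sub_mul, ← hab]

variable [Fintype κ]

/-- The support of a non-negative solution of all binomial equations is a face. -/
lemma exists_face
    (H : ∀ a b : ι → ℕ, (∀ j, ∑ t, a t * m t j = ∑ t, b t * m t j) →
      ∏ t, v t ^ a t = ∏ t, v t ^ b t) :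
    ∃ w : κ → ℚ, ∀ t, (v t ≠ 0 → ∑ j, w j * m t j = 0) ∧ (v t = 0 → ∑ j, w j * m t j < 0) := by
  classical
  let α : ι → (κ → ℚ) →ₗ[ℚ] ℚ := fun t => ∑ j, (m t j : ℚ) • LinearMap.proj j
  have hα : ∀ t w, α t w = ∑ j, w j * m t j := by
    intro t w
    simp only [α, LinearMap.sum_apply, LinearMap.smul_apply, LinearMap.proj_apply, smul_eq_mul,
      mul_comm]
  have key : ∀ t₀, v t₀ = 0 → ∃ w : κ → ℚ, (∀ t, α t w ≤ 0) ∧ (∀ t, v t ≠ 0 → α t w = 0) ∧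
      α t₀ w < 0 := by
    intro t₀ ht₀
    by_contra hcon
    push Not at hcon
    -- If no functional separates `t₀`, then `- α t₀` is a non-negative combination of all `α t` and
    -- of `- α t` for `t` in the support. The resulting relation is positive at `t₀` and
    -- non-negative off the support, so one side of its binomial equation contains the factor `v t₀
    -- = 0`, while the other side involves only non-zero coordinates.
    obtain ⟨u, hu, hγ⟩ := exists_nonneg_combination
      (Sum.elim α fun t => if v t ≠ 0 then - α t else 0) Finset.univ (- α t₀) fun w hw => by
        have h1 : ∀ t, α t w ≤ 0 := fun t => by simpa using hw (Sum.inl t) (Finset.mem_univ _)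
        have := hcon w h1 fun t ht => by
          have h2 := hw (Sum.inr t) (Finset.mem_univ _)
          simp only [Sum.elim_inr, if_pos ht, LinearMap.neg_apply] at h2
          linarith [h1 t]
        simpa using this
    let r : ι → ℚ := fun t => u (Sum.inl t) + (if t = t₀ then 1 else 0) -
      (if v t ≠ 0 then u (Sum.inr t) else 0)
    have hr : ∀ j, ∑ t, r t * m t j = 0 := by
      intro j
      have hj : ∀ t, α t (Pi.single j 1) = m t j := by
        intro t
        rw [hα, Finset.sum_eq_single j] <;> simp +contextual
      have := LinearMap.congr_fun hγ (Pi.single j 1)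
      simp only [LinearMap.neg_apply, Fintype.sum_sum_type, LinearMap.add_apply,
        LinearMap.sum_apply, Sum.elim_inl, Sum.elim_inr, LinearMap.smul_apply, smul_eq_mul, hj]
        at this
      simp only [r, sub_mul, add_mul, Finset.sum_sub_distrib, Finset.sum_add_distrib, ite_mul,
        one_mul, zero_mul, Finset.sum_ite_eq', Finset.mem_univ, if_true]
      have e : ∑ t, u (Sum.inr t) * (if v t ≠ 0 then - α t else 0 : (κ → ℚ) →ₗ[ℚ] ℚ)
          (Pi.single j 1) = - ∑ t, if v t ≠ 0 then u (Sum.inr t) * m t j else 0 := by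
        rw [← Finset.sum_neg_distrib]
        refine Finset.sum_congr rfl fun t _ => ?_
        split_ifs <;> simp [hj]
      rw [e] at this
      linarith
    obtain ⟨N, a, b, -, -, -, h1, h2, h3⟩ := exists_natPow_of_relation H r hr
    have hr0 : ∀ t, v t = 0 → 0 ≤ r t := fun t ht => by
      have := hu (Sum.inl t)
      simp only [r, ht, ne_eq, not_true, if_false]
      split_ifs <;> linarith
    have hrt : 0 < r t₀ := by
      have := hu (Sum.inl t₀)
      simp only [r, ht₀, ne_eq, not_true, if_false, if_true]
      linarith
    rw [Finset.prod_eq_zero (Finset.mem_univ t₀) (by rw [ht₀, zero_pow (h1 t₀ hrt).ne'])] at h3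
    refine Finset.prod_ne_zero_iff.2 (fun t _ => ?_) h3.symm
    by_cases ht : v t = 0
    · rw [h2 t (hr0 t ht), pow_zero]
      exact one_ne_zero
    · exact pow_ne_zero _ ht
  choose! w hw1 hw2 hw3 using key
  -- The sum of the separating functionals is negative at every zero coordinate at once.
  refine ⟨∑ t ∈ Finset.univ.filter fun t => v t = 0, w t, fun t => ⟨fun ht => ?_, fun ht => ?_⟩⟩
  · rw [← hα, map_sum]
    refine Finset.sum_eq_zero fun s hs => hw2 s (by simpa using hs) t ht
  · rw [← hα, map_sum, ← Finset.sum_erase_add _ _ (show t ∈ _ by simpa using ht)]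
    refine add_neg_of_nonpos_of_neg (Finset.sum_nonpos fun s hs => ?_) (hw3 t ht)
    simp only [Finset.mem_erase, Finset.mem_filter] at hs
    exact hw1 s hs.2.2 t

/-- On its support, a non-negative solution of all binomial equations is a monomial. -/
lemma exists_log_eq
    (H : ∀ a b : ι → ℕ, (∀ j, ∑ t, a t * m t j = ∑ t, b t * m t j) →
      ∏ t, v t ^ a t = ∏ t, v t ^ b t) :
    ∃ c : κ → ℝ, ∀ t, v t ≠ 0 → Real.log (v t) = ∑ j, c j * m t j := by
  classical
  let mS : ι → κ → ℚ := fun t => if v t ≠ 0 then fun j => (m t j : ℚ) else 0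
  let M : (ι → ℚ) →ₗ[ℚ] κ → ℚ := Fintype.linearCombination ℚ mS
  let ℓ : (ι → ℚ) →ₗ[ℚ] ℝ := Fintype.linearCombination ℚ fun t => Real.log (v t)
  -- Relations between the exponent vectors of the support are respected by the logarithms, so `log
  -- v` factors through the span of these vectors, and the functional obtained there extends to all
  -- of `κ → ℚ`.
  have hker : LinearMap.ker M ≤ LinearMap.ker ℓ := by
    intro r hr
    rw [LinearMap.mem_ker] at hr ⊢
    simp only [M, Fintype.linearCombination_apply] at hr
    simp only [ℓ, Fintype.linearCombination_apply]
    obtain ⟨N, a, b, hN, h0, ha, -, hb, h3⟩ := exists_natPow_of_relation H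
      (fun t => if v t ≠ 0 then r t else 0) fun j => by
        have := congrFun hr j
        rw [Finset.sum_apply] at this
        rw [Pi.zero_apply] at this
        refine (Finset.sum_congr rfl fun t _ => ?_).trans this
        by_cases ht : v t = 0 <;> simp [mS, ht]
    have hz : ∀ t, v t = 0 → a t = 0 ∧ b t = 0 := fun t ht =>
      ⟨ha t (by simp [ht]), hb t (by simp [ht])⟩
    have hne : ∀ (e : ι → ℕ), (∀ t, v t = 0 → e t = 0) → ∀ t ∈ Finset.univ, v t ^ e t ≠ 0 := by
      intro e he t _
      by_cases ht : v t = 0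
      · rw [he t ht, pow_zero]; exact one_ne_zero
      · exact pow_ne_zero _ ht
    have h4 := congrArg Real.log h3
    rw [Real.log_prod (hne a fun t ht => (hz t ht).1),
      Real.log_prod (hne b fun t ht => (hz t ht).2), ← sub_eq_zero, ← Finset.sum_sub_distrib] at h4
    have h5 : (N : ℝ) * ∑ t, r t • Real.log (v t) = 0 := by
      rw [← h4, Finset.mul_sum]
      refine Finset.sum_congr rfl fun t _ => ?_
      by_cases ht : v t = 0
      · simp [ht]
      · have := h0 t
        rw [if_pos ht] at this
        have : (N : ℝ) * r t = a t - b t := by exact_mod_cast congrArg (fun q : ℚ => (q : ℝ)) this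
        rw [Rat.smul_def, ← mul_assoc, this, Real.log_pow, Real.log_pow]
        ring
    exact (mul_eq_zero.1 h5).resolve_left (by positivity)
  obtain ⟨g, hg⟩ := (((LinearMap.ker M).liftQ ℓ hker).comp
    M.quotKerEquivRange.symm.toLinearMap).exists_extend
  have hg' : ∀ r, g (M r) = ℓ r := by
    intro r
    have := LinearMap.congr_fun hg ⟨M r, LinearMap.mem_range_self M r⟩
    simp only [LinearMap.comp_apply, Submodule.subtype_apply, LinearEquiv.coe_coe] at this
    rw [this]
    have e : M.quotKerEquivRange.symm ⟨M r, LinearMap.mem_range_self M r⟩ =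
        (LinearMap.ker M).mkQ r := by
      rw [LinearEquiv.symm_apply_eq]
      rfl
    rw [e]
    rfl
  refine ⟨fun j => g (Pi.single j 1), fun t ht => ?_⟩
  have := hg' (Pi.single t 1)
  simp only [M, ℓ, Fintype.linearCombination_apply_single, one_smul, mS, if_pos ht] at this
  rw [← this, LinearMap.pi_apply_eq_sum_univ g]
  refine Finset.sum_congr rfl fun j _ => ?_
  rw [Rat.smul_def, mul_comm, Rat.cast_intCast]
  congr 2
  funext i
  simp [Pi.single_apply, eq_comm]

open Filter Topology in
/-- Non-negative solutions of all binomial equations are limits of positive points. -/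
lemma exists_tendsto_monomials (hv : ∀ t, 0 ≤ v t)
    (H : ∀ a b : ι → ℕ, ∑ t, a t = ∑ t, b t → (∀ j, ∑ t, a t * m t j = ∑ t, b t * m t j) →
      ∏ t, v t ^ a t = ∏ t, v t ^ b t) :
    ∃ (K : ℝ → ℝ) (x : ℝ → κ → ℝ), (∀ s, 0 < K s) ∧ (∀ s j, 0 < x s j) ∧
      ∀ t, Tendsto (fun s => K s * ∏ j, x s j ^ m t j) atTop (𝓝 (v t)) := by
  -- The extra exponent 1 turns the condition of equal degrees into one more linear condition; its
  -- variable becomes the homogeneous scaling `K`.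
  let m' : ι → Option κ → ℤ := fun t j => j.elim 1 (m t)
  have H' : ∀ a b : ι → ℕ, (∀ j, ∑ t, a t * m' t j = ∑ t, b t * m' t j) →
      ∏ t, v t ^ a t = ∏ t, v t ^ b t := fun a b hab =>
    H a b (by simpa [m', ← Nat.cast_sum, Nat.cast_inj] using hab none)
      fun j => by simpa [m'] using hab (some j)
  obtain ⟨w, hw⟩ := exists_face H'
  obtain ⟨c, hc⟩ := exists_log_eq H'
  -- The logarithms `c` fix the limits on the support, and moving in the direction `w` leaves these
  -- coordinates unchanged while the others tend to 0.
  refine ⟨fun s => Real.exp (c none + s * w none),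
    fun s j => Real.exp (c (some j) + s * w (some j)), fun s => Real.exp_pos _,
    fun s j => Real.exp_pos _, fun t => ?_⟩
  have hform : ∀ s : ℝ, Real.exp (c none + s * w none) *
      ∏ j, Real.exp (c (some j) + s * w (some j)) ^ m t j =
      Real.exp (∑ j, c j * m' t j) * Real.exp (s * (∑ j, w j * m' t j : ℚ)) := by
    intro s
    simp only [← Real.rpow_intCast, ← Real.exp_mul, ← Real.exp_sum, ← Real.exp_add, Fintype.sum_option, m',
      Option.elim]
    congr 1
    push_cast
    rw [mul_add, Finset.mul_sum]
    have : ∀ j, (c (some j) + s * w (some j)) * (m t j : ℝ) =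
        c (some j) * m t j + s * (w (some j) * m t j) := fun j => by ring
    simp only [this, Finset.sum_add_distrib]
    ring
  simp only [hform]
  by_cases ht : v t = 0
  · have h1 : ((∑ j, w j * m' t j : ℚ) : ℝ) < 0 := by exact_mod_cast (hw t).2 ht
    rw [ht, ← mul_zero (Real.exp (∑ j, c j * m' t j))]
    exact (Real.tendsto_exp_atBot.comp (tendsto_id.atTop_mul_const_of_neg h1)).const_mul _
  · rw [(hw t).1 ht, ← hc t ht, Real.exp_log ((hv t).lt_of_ne' ht)]
    simp

end Binomials

/-! ### The non-negative part of the toric variety -/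

lemma MvPolynomial.IsHomogeneous.eval_smul {σ R : Type*} [CommSemiring R] [Fintype σ]
    {f : MvPolynomial σ R} {e : ℕ} (hf : f.IsHomogeneous e) (a : R) (v : σ → R) :
    MvPolynomial.eval (a • v) f = a ^ e * MvPolynomial.eval v f := by
  rw [MvPolynomial.eval_eq', MvPolynomial.eval_eq', Finset.mul_sum]
  refine Finset.sum_congr rfl fun m hm => ?_
  have h1 : m.degree = e := by
    rw [Finsupp.degree_eq_weight_one]
    exact hf (MvPolynomial.mem_support_iff.1 hm)
  rw [Finsupp.degree_eq_sum] at h1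
  simp only [Pi.smul_apply, smul_eq_mul, mul_pow]
  rw [Finset.prod_mul_distrib, Finset.prod_pow_eq_pow_sum, h1]
  ring

lemma eval_rep_mk_eq_zero_iff {k e : ℕ} {f : MvPolynomial (Fin k) ℂ} (hf : f.IsHomogeneous e)
    {v : Fin k → ℂ} (hv : v ≠ 0) :
    MvPolynomial.eval (Projectivization.mk ℂ v hv).rep f = 0 ↔ MvPolynomial.eval v f = 0 := by
  obtain ⟨a, ha⟩ := Projectivization.exists_smul_eq_mk_rep ℂ v hv
  rw [← ha]
  change MvPolynomial.eval ((a : ℂ) • v) f = 0 ↔ _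
  rw [hf.eval_smul, mul_eq_zero, or_iff_right (pow_ne_zero _ a.ne_zero)]

section

variable {n k : ℕ}

lemma monomialVector_ne_zero {T : Fin k → MaximalColoredTree n} (t : Fin k) (x : Fin n → ℂˣ) :
    monomialVector T x ≠ 0 :=
  fun h => (Units.ne_zero _) (congrFun h t)

lemma vanishing_iff {T : Fin k → MaximalColoredTree n} (t : Fin k) {f : MvPolynomial (Fin k) ℂ}
    {e : ℕ} (hf : f.IsHomogeneous e) :
    (∀ q ∈ monomialImage T, MvPolynomial.eval q.rep f = 0) ↔
      ∀ x, MvPolynomial.eval (monomialVector T x) f = 0 := by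
  constructor
  · intro h x
    exact (eval_rep_mk_eq_zero_iff hf (monomialVector_ne_zero t x)).1 (h _ ⟨x, _, rfl⟩)
  · rintro h q ⟨x, hx, rfl⟩
    exact (eval_rep_mk_eq_zero_iff hf hx).2 (h x)

lemma exists_monomialVector_eq (T : Fin k → MaximalColoredTree n) {x : Fin n → ℝ}
    (hx : ∀ j, 0 < x j) : ∃ u : Fin n → ℂˣ,
      monomialVector T u = fun t => ((∏ j, x j ^ weightVector (T t) j : ℝ) : ℂ) := by
  refine ⟨fun j => Units.mk0 (x j : ℂ) (by exact_mod_cast (hx j).ne'), ?_⟩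
  funext t
  simp [monomialVector]

lemma prod_zpow_eq_treeWeight {x : Fin n → ℝ} (hx : ∀ j, 0 < x j) :
    ∃ d : RatioSpace n, ∃ K : ℝ, 0 < K ∧ ∀ T : MaximalColoredTree n,
      ∏ j, x j ^ weightVector T j = K * treeWeight d.1 T := by
  let X : ℕ → ℝ := fun i => if h : i < n then x ⟨i, h⟩ else 1
  let y : ℝ := if h : n - 1 < n then x ⟨n - 1, h⟩ else 1
  have hX : ∀ i, 0 < X i := fun i => by simp only [X]; split_ifs; exacts [hx _, one_pos]
  have hy : 0 < y := by simp only [y]; split_ifs; exacts [hx _, one_pos]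
  refine ⟨⟨gapSystem n X y, isRatioSystem_gapSystem hX hy⟩,
    pairProd 0 n fun p q => (∑ i ∈ Finset.Ico p q, X i) + (∑ i ∈ Finset.Ico p q, X i) ^ 2 / y,
    pairProd_pos fun p q _ hpq _ => ?_, fun T => ?_⟩
  · have := sum_Ico_pos hX hpq
    positivity
  · rw [mul_comm, ← treeWeight_gapSystem hX hy T]
    refine Finset.prod_congr rfl fun j _ => ?_
    congr 1
    have hj := j.2
    split_ifs with h
    · simp [X]
    · simp only [y, dif_pos (show n - 1 < n by omega)]
      congr 1
      ext
      simp only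
      omega

/-! ### From systems of ratios to the non-negative part of the variety. -/

/-- The vector of the limits of the monomials. -/
noncomputable def treeVector (T : Fin k → MaximalColoredTree n) (d : RatioSpace n) : Fin k → ℝ :=
  fun t => treeWeight d.1 (T t)

lemma continuous_treeVector (T : Fin k → MaximalColoredTree n) : Continuous (treeVector T) :=
  continuous_pi fun t => (continuous_treeWeight (T t)).comp continuous_subtype_val

lemma treeVector_nonneg (T : Fin k → MaximalColoredTree n) (d : RatioSpace n) (t : Fin k) :
    0 ≤ treeVector T d t := d.2.treeWeight_nonneg _

lemma sum_treeVector_pos (hn : 0 < n) (T : Fin k ≃ MaximalColoredTree n) (d : RatioSpace n) :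
    0 < ∑ t, treeVector T d t := by
  obtain ⟨S, hS⟩ := d.2.exists_treeWeight_ne_zero hn
  refine Finset.sum_pos' (fun t _ => treeVector_nonneg T d t) ⟨T.symm S, Finset.mem_univ _, ?_⟩
  refine (treeVector_nonneg T d _).lt_of_ne' ?_
  simpa [treeVector] using hS

lemma treeVector_ne_zero (hn : 0 < n) (T : Fin k ≃ MaximalColoredTree n) (d : RatioSpace n) :
    (fun t => (treeVector T d t : ℂ)) ≠ 0 := by
  intro h
  have h1 := sum_treeVector_pos hn T d
  rw [Finset.sum_eq_zero fun t _ => Complex.ofReal_eq_zero.1 (congrFun h t)] at h1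
  exact lt_irrefl 0 h1

-- A form that vanishes on all monomial vectors vanishes on the tree vectors of distinct points,
-- which are positive multiples of such vectors, and by continuity on their limits.
open Filter Topology in
lemma mk_treeVector_mem (hn : 0 < n) (T : Fin k ≃ MaximalColoredTree n) (d : RatioSpace n) :
    Projectivization.mk ℂ _ (treeVector_ne_zero hn T d) ∈ toricVariety T := by
  intro e f hf hvan
  obtain ⟨S, hS⟩ := d.2.exists_treeWeight_ne_zero hn
  have t := T.symm S
  rw [vanishing_iff t hf] at hvan
  rw [eval_rep_mk_eq_zero_iff hf]
  obtain ⟨x, hx, hlim⟩ := d.2.exists_tendsto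
  have hlim' : Tendsto (fun s => fun t => (treeWeight (gapSystem n (x s) 1) (T t) : ℂ)) atTop
      (𝓝 fun t => (treeVector T d t : ℂ)) :=
    tendsto_pi_nhds.2 fun t => (Complex.continuous_ofReal.comp
      (continuous_treeWeight (T t))).continuousAt.tendsto.comp hlim
  have h1 := (MvPolynomial.continuous_eval f).continuousAt.tendsto.comp hlim'
  refine tendsto_nhds_unique h1 (tendsto_const_nhds.congr fun s => ?_)
  obtain ⟨u, hu⟩ := exists_monomialVector_eq T
    (x := fun j : Fin n => if (j : ℕ) + 1 < n then x s j else 1)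
    (fun j => by split_ifs; exacts [hx s _, one_pos])
  have h2 := hvan u
  set P := pairProd 0 n fun p q => (∑ i ∈ Finset.Ico p q, x s i) +
    (∑ i ∈ Finset.Ico p q, x s i) ^ 2 / 1 with hP
  have hP0 : 0 < P := pairProd_pos fun p q _ hpq _ => by
    have := sum_Ico_pos (hx s) hpq
    positivity
  have h3 : monomialVector T u = (P : ℂ) •
      fun t => (treeWeight (gapSystem n (x s) 1) (T t) : ℂ) := by
    rw [hu]
    funext t
    rw [treeWeight_gapSystem (hx s) one_pos (T t), Pi.smul_apply, smul_eq_mul, ← Complex.ofReal_mul,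
      mul_comm]
  rw [h3, hf.eval_smul] at h2
  exact ((mul_eq_zero.1 h2).resolve_left
    (pow_ne_zero _ (by exact_mod_cast hP0.ne'))).symm

/-- The point of the non-negative part of the toric variety that belongs to a system of ratios. -/
noncomputable def toricPoint (hn : 0 < n) (T : Fin k ≃ MaximalColoredTree n) (d : RatioSpace n) :
    nonnegPart (toricVariety T) :=
  ⟨Projectivization.mk ℂ _ (treeVector_ne_zero hn T d), mk_treeVector_mem hn T d,
    treeVector T d, _, treeVector_nonneg T d, rfl⟩

lemma continuous_toricPoint (hn : 0 < n) (T : Fin k ≃ MaximalColoredTree n) :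
    Continuous (toricPoint hn T) := by
  refine Continuous.subtype_mk ?_ _
  have h1 : Continuous fun d : RatioSpace n =>
      (⟨_, treeVector_ne_zero hn T d⟩ : {v : Fin k → ℂ // v ≠ 0}) :=
    Continuous.subtype_mk (continuous_pi fun t => Complex.continuous_ofReal.comp
      ((continuous_apply t).comp (continuous_treeVector T))) _
  exact continuous_coinduced_rng.comp h1

/-- The scalar relating two non-negative representatives may be replaced by its modulus. -/
lemma treeVector_eq_of_mk_eq {v w : Fin k → ℝ} (hv : (fun t => (v t : ℂ)) ≠ 0)
    (hw : (fun t => (w t : ℂ)) ≠ 0) (hv0 : ∀ t, 0 ≤ v t) (hw0 : ∀ t, 0 ≤ w t)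
    (h : Projectivization.mk ℂ _ hv = Projectivization.mk ℂ _ hw) :
    ∃ K : ℝ, K ≠ 0 ∧ ∀ t, v t = K * w t := by
  obtain ⟨a, ha⟩ := (Projectivization.mk_eq_mk_iff ℂ _ _ hv hw).1 h
  refine ⟨‖(a : ℂ)‖, norm_ne_zero_iff.2 a.ne_zero, fun t => ?_⟩
  have := congrArg norm (congrFun ha t)
  change ‖(a : ℂ) * (w t : ℂ)‖ = _ at this
  rw [norm_mul, Complex.norm_of_nonneg (hv0 t), Complex.norm_of_nonneg (hw0 t)] at this
  exact this.symm

lemma toricPoint_injective (hn : 0 < n) (T : Fin k ≃ MaximalColoredTree n) :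
    Function.Injective (toricPoint hn T) := by
  intro d d' h
  obtain ⟨K, hK, hw⟩ := treeVector_eq_of_mk_eq _ _ (treeVector_nonneg T d) (treeVector_nonneg T d')
    (congrArg Subtype.val h)
  refine Subtype.ext (d.2.eq_of_treeWeight d'.2 hK fun S => ?_)
  simpa [treeVector] using hw (T.symm S)

lemma zpow_sum_eq_prod {ι G : Type*} [CommGroup G] (g : G) (s : Finset ι) (e : ι → ℤ) :
    g ^ ∑ i ∈ s, e i = ∏ i ∈ s, g ^ e i := by
  classical
  induction s using Finset.induction_on with
  | empty => simp
  | insert i s hi ih => rw [Finset.sum_insert hi, Finset.prod_insert hi, zpow_add, ih]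

/-- The binomial is homogeneous because the two total degrees agree, and it vanishes on the monomial
vectors because the total weights agree. -/
lemma binomial_eq {T : Fin k → MaximalColoredTree n} {v : Fin k → ℝ}
    (hv : (fun t => (v t : ℂ)) ≠ 0) (h : Projectivization.mk ℂ _ hv ∈ toricVariety T)
    (a b : Fin k → ℕ) (hab : ∑ t, a t = ∑ t, b t)
    (hw : ∀ j, ∑ t, a t * weightVector (T t) j = ∑ t, b t * weightVector (T t) j) :
    ∏ t, v t ^ a t = ∏ t, v t ^ b t := by
  have hmon : ∀ a : Fin k → ℕ,
      (∏ t, MvPolynomial.X t ^ a t : MvPolynomial (Fin k) ℂ).IsHomogeneous (∑ t, a t) := by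
    intro a
    exact MvPolynomial.IsHomogeneous.prod _ _ _ fun t _ => MvPolynomial.isHomogeneous_X_pow t (a t)
  have hf : (∏ t, MvPolynomial.X t ^ a t - ∏ t, MvPolynomial.X t ^ b t :
      MvPolynomial (Fin k) ℂ).IsHomogeneous (∑ t, a t) := (hmon a).sub (hab ▸ hmon b)
  have hk : Nonempty (Fin k) := by
    by_contra hk
    rw [not_nonempty_iff] at hk
    exact hv (Subsingleton.elim _ _)
  have h1 := h _ _ hf ((vanishing_iff hk.some hf).2 fun x => by
    simp only [map_sub, map_prod, map_pow, MvPolynomial.eval_X, monomialVector, ← Units.val_pow_eq_pow_val,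
      ← Units.coe_prod]
    rw [sub_eq_zero]
    congr 1
    have key : ∀ a : Fin k → ℕ, ∏ t, (∏ j, x j ^ weightVector (T t) j) ^ a t =
        ∏ j, x j ^ ∑ t, a t * weightVector (T t) j := by
      intro a
      simp only [← Finset.prod_pow]
      rw [Finset.prod_comm]
      refine Finset.prod_congr rfl fun j _ => ?_
      rw [zpow_sum_eq_prod]
      refine Finset.prod_congr rfl fun t _ => ?_
      rw [mul_comm, zpow_mul, zpow_natCast]
    rw [key, key]
    simp only [hw])
  rw [eval_rep_mk_eq_zero_iff hf, map_sub, sub_eq_zero] at h1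
  simp only [map_prod, map_pow, MvPolynomial.eval_X] at h1
  exact_mod_cast h1

open Filter Topology in
lemma toricPoint_surjective (hn : 0 < n) (T : Fin k ≃ MaximalColoredTree n) :
    Function.Surjective (toricPoint hn T) := by
  rintro ⟨p, hp, v, hv, hv0, rfl⟩
  obtain ⟨K, x, hK, hx, hlim⟩ := exists_tendsto_monomials hv0 fun a b hab hw =>
    binomial_eq hv hp a b hab hw
  choose d L hL hd using fun s => prod_zpow_eq_treeWeight (hx s)
  have hsum : 0 < ∑ t, v t := by
    refine (Finset.sum_nonneg fun t _ => hv0 t).lt_of_ne' fun h0 => hv ?_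
    exact funext fun t => Complex.ofReal_eq_zero.2
      ((Finset.sum_eq_zero_iff_of_nonneg fun t _ => hv0 t).1 h0 t (Finset.mem_univ t))
  let ν : RatioSpace n → Fin k → ℝ := fun d t => treeVector T d t / ∑ t, treeVector T d t
  have hν : Continuous ν := continuous_pi fun t =>
    ((continuous_apply t).comp (continuous_treeVector T)).div
      (continuous_finsetSum _ fun t _ => (continuous_apply t).comp (continuous_treeVector T))
      fun d => (sum_treeVector_pos hn T d).ne'
  -- Dividing by the sum of coordinates selects one representative of each point, so compactness of
  -- the space of systems can be used in `Fin k → ℝ`.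
  have hclosed : IsClosed (Set.range ν) := (isCompact_range hν).isClosed
  have hmem : (fun t => v t / ∑ t, v t) ∈ Set.range ν := by
    refine hclosed.mem_of_tendsto (f := fun s => ν (d s)) (b := atTop) (tendsto_pi_nhds.2 fun t => ?_)
      (Eventually.of_forall fun s => Set.mem_range_self _)
    refine ((hlim t).div (tendsto_finsetSum _ fun t _ => hlim t) hsum.ne').congr fun s => ?_
    simp only [Pi.div_apply, hd, ν, treeVector]
    rw [← Finset.mul_sum, ← Finset.mul_sum, mul_div_mul_left _ _ (hK s).ne',
      mul_div_mul_left _ _ (hL s).ne']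
  obtain ⟨d, hd⟩ := hmem
  refine ⟨d, Subtype.ext ?_⟩
  refine (Projectivization.mk_eq_mk_iff' ℂ _ _ _ _).2
    ⟨((∑ t, treeVector T d t) / ∑ t, v t : ℝ), ?_⟩
  funext t
  have := congrFun hd t
  have h1 := (sum_treeVector_pos hn T d).ne'
  simp only [ν] at this
  rw [div_eq_div_iff h1 hsum.ne'] at this
  rw [Pi.smul_apply, smul_eq_mul, ← Complex.ofReal_mul]
  congr 1
  field_simp
  linarith

/-- The coordinates of a point of projective space, normalized by their sum. -/
noncomputable def normalizedNorms : ℙ ℂ (Fin k → ℂ) → Fin k → ℝ :=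
  Projectivization.lift (fun v t => ‖v.1 t‖ / ∑ t, ‖v.1 t‖) fun v w a h => by
    have ha : a ≠ 0 := by
      rintro rfl
      exact v.2 (by rw [h, zero_smul])
    funext t
    simp only [h, Pi.smul_apply, norm_smul]
    rw [← Finset.mul_sum, mul_div_mul_left _ _ (norm_ne_zero_iff.2 ha)]

lemma continuous_normalizedNorms : Continuous (normalizedNorms (k := k)) := by
  refine continuous_coinduced_dom.2 ?_
  change Continuous fun v : {v : Fin k → ℂ // v ≠ 0} => fun t => ‖v.1 t‖ / ∑ t, ‖v.1 t‖
  have hc : ∀ t, Continuous fun v : {v : Fin k → ℂ // v ≠ 0} => ‖v.1 t‖ := fun t =>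
    ((continuous_apply t).comp continuous_subtype_val).norm
  refine continuous_pi fun t => (hc t).div (continuous_finsetSum _ fun t _ => hc t)
    fun v h0 => v.2 ?_
  funext t
  exact norm_eq_zero.1
    ((Finset.sum_eq_zero_iff_of_nonneg fun t _ => norm_nonneg _).1 h0 t (Finset.mem_univ t))

/-- Absolute values divided by their sum are continuous on all of projective space and separate the
points with non-negative coordinates. -/
instance (V : Set (ℙ ℂ (Fin k → ℂ))) : T2Space (nonnegPart V) := by
  refine T2Space.of_injective_continuous (f := fun p : nonnegPart V => normalizedNorms p.1) ?_
    (continuous_normalizedNorms.comp continuous_subtype_val)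
  rintro ⟨_, _, v, hv, hv0, rfl⟩ ⟨_, _, w, hw, hw0, rfl⟩ h
  have h' : ∀ t, v t / ∑ t, v t = w t / ∑ t, w t := by
    intro t
    have : ‖(v t : ℂ)‖ / ∑ t, ‖(v t : ℂ)‖ = ‖(w t : ℂ)‖ / ∑ t, ‖(w t : ℂ)‖ := congrFun h t
    simpa only [Complex.norm_of_nonneg (hv0 _), Complex.norm_of_nonneg (hw0 _)] using this
  have key : ∀ v : Fin k → ℝ, (fun t => (v t : ℂ)) ≠ 0 → (∀ t, 0 ≤ v t) → ∑ t, v t ≠ 0 := by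
    intro v hv hv0 h0
    exact hv (funext fun t => Complex.ofReal_eq_zero.2
      ((Finset.sum_eq_zero_iff_of_nonneg fun t _ => hv0 t).1 h0 t (Finset.mem_univ t)))
  have hsv := key v hv hv0
  have hsw := key w hw hw0
  refine Subtype.ext ((Projectivization.mk_eq_mk_iff' ℂ _ _ _ _).2
    ⟨((∑ t, v t) / ∑ t, w t : ℝ), funext fun t => ?_⟩)
  have := h' t
  rw [div_eq_div_iff hsv hsw] at this
  rw [Pi.smul_apply, smul_eq_mul, ← Complex.ofReal_mul]
  congr 1
  field_simp
  linarith

/-- The space of systems of ratios is homeomorphic to the non-negative part of the variety. -/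
noncomputable def toricHomeomorph (hn : 0 < n) (T : Fin k ≃ MaximalColoredTree n) :
    RatioSpace n ≃ₜ nonnegPart (toricVariety T) :=
  Continuous.homeoOfEquivCompactToT2
    (f := Equiv.ofBijective _ ⟨toricPoint_injective hn T, toricPoint_surjective hn T⟩)
    (continuous_toricPoint hn T)

end

lemma List.eq_of_pairwise_lt {α : Type*} [LinearOrder α] {l l' : List α} (h : l.Pairwise (· < ·))
    (h' : l'.Pairwise (· < ·)) (hm : ∀ x, x ∈ l ↔ x ∈ l') : l = l' :=
  ((List.perm_ext_iff_of_nodup (h.imp ne_of_lt) (h'.imp ne_of_lt)).2 hm).eq_of_pairwise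
    (fun _ _ _ _ hab hba => absurd hab hba.asymm) h h'

/-! ### Components of nodal disks -/

namespace NodalDisk

variable {n : ℕ}

/-- `E` is a component of the nodal disk, with everything beyond it. -/
def IsSub (E : NodalDisk n) : NodalDisk n → Prop
  | marking _ => False
  | component seam m pos sub => E = component seam m pos sub ∨ ∃ c, IsSub E (sub c)

/-- The special points are stable and the markings occur in order, without omissions. -/
structure IsOrdered (D : NodalDisk n) : Prop where
  stable : D.IsStable
  sorted : D.labels.Pairwise (· < ·)
  connected : ∀ i ∈ D.labels, ∀ j ∈ D.labels, ∀ k, i ≤ k → k ≤ j → k ∈ D.labels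

/-- The coordinate of `z_{α i}` on the root component. -/
noncomputable def coord (D : NodalDisk n) (i : Fin n) : ℝ := (D.specialPoint i.succ).elim 0 id

section component

variable {seam : Option ℝ} {m : ℕ} {pos : Fin m → ℝ} {sub : Fin m → NodalDisk n}

lemma mem_labels_component {i : Fin n} :
    i ∈ (component seam m pos sub).labels ↔ ∃ c, i ∈ (sub c).labels := by
  simp [labels]

lemma IsStable.child (h : (component seam m pos sub).IsStable) (c : Fin m) : (sub c).IsStable := by
  cases seam
  · exact h.2.2 c
  · exact h.2.2.2 c

lemma IsStable.strictMono (h : (component seam m pos sub).IsStable) : StrictMono pos := by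
  cases seam
  · exact h.2.1
  · exact h.2.2.1

lemma IsStable.one_le (h : (component seam m pos sub).IsStable) : 1 ≤ m := by
  cases seam
  · exact one_le_two.trans h.1
  · exact h.2.1

lemma IsStable.exists_mem_labels {D : NodalDisk n} (h : D.IsStable) : ∃ i, i ∈ D.labels := by
  induction D with
  | marking i => exact ⟨i, by simp [labels]⟩
  | component seam m pos sub ih =>
    obtain ⟨i, hi⟩ := ih ⟨0, h.one_le⟩ (h.child _)
    exact ⟨i, mem_labels_component.2 ⟨_, hi⟩⟩

lemma labels_lt (h : (component seam m pos sub).labels.Pairwise (· < ·)) {c c' : Fin m}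
    (hc : c < c') {i j : Fin n} (hi : i ∈ (sub c).labels) (hj : j ∈ (sub c').labels) : i < j := by
  rw [labels, List.pairwise_flatMap] at h
  exact List.pairwise_iff_get.1 h.2 ⟨c, by simp⟩ ⟨c', by simp⟩ hc i (by simpa using hi) j
    (by simpa using hj)

lemma labels_inj (h : (component seam m pos sub).labels.Pairwise (· < ·)) {c c' : Fin m}
    {i : Fin n} (hi : i ∈ (sub c).labels) (hi' : i ∈ (sub c').labels) : c = c' := by
  rcases lt_trichotomy c c' with hc | hc | hc
  · exact absurd (labels_lt h hc hi hi') (lt_irrefl _)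
  · exact hc
  · exact absurd (labels_lt h hc hi' hi) (lt_irrefl _)

lemma IsOrdered.child (h : (component seam m pos sub).IsOrdered) (c : Fin m) :
    (sub c).IsOrdered where
  stable := h.stable.child c
  sorted := by
    have := h.sorted
    rw [labels, List.pairwise_flatMap] at this
    exact this.1 c (List.mem_finRange c)
  connected i hi j hj k hik hkj := by
    obtain ⟨c', hc'⟩ := mem_labels_component.1 (h.connected i (mem_labels_component.2 ⟨c, hi⟩) j
      (mem_labels_component.2 ⟨c, hj⟩) k hik hkj)
    rcases lt_trichotomy c c' with hc | hc | hc
    · exact absurd (labels_lt h.sorted hc hj hc') (not_lt.2 hkj)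
    · rwa [hc]
    · exact absurd (labels_lt h.sorted hc hc' hi) (not_lt.2 hik)

lemma specialPoint_of_mem (h : (component seam m pos sub).labels.Pairwise (· < ·)) {c : Fin m}
    {i : Fin n} (hi : i ∈ (sub c).labels) :
    (component seam m pos sub).specialPoint i.succ = (pos c : OnePoint ℝ) := by
  have hex : ∃ c, i ∈ (sub c).labels := ⟨c, hi⟩
  simp only [specialPoint, Fin.cases_succ, dif_pos hex]
  rw [labels_inj h hex.choose_spec hi]

lemma coord_of_mem (h : (component seam m pos sub).labels.Pairwise (· < ·)) {c : Fin m}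
    {i : Fin n} (hi : i ∈ (sub c).labels) : (component seam m pos sub).coord i = pos c := by
  rw [coord, specialPoint_of_mem h hi]
  rfl

end component

lemma specialPoint_of_notMem {D : NodalDisk n} {i : Fin n} (hi : i ∉ D.labels) :
    D.specialPoint i.succ = ∞ := by
  cases D with
  | marking j => rfl
  | component seam m pos sub =>
    rw [mem_labels_component] at hi
    simp only [specialPoint, Fin.cases_succ, dif_neg hi]

lemma not_isSub_marking {D : NodalDisk n} {i : Fin n} : ¬ IsSub (marking i) D := by
  induction D with
  | marking j => exact id
  | component seam m pos sub ih =>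
    rintro (h | ⟨c, hc⟩)
    · cases h
    · exact ih c hc

lemma IsSub.trans {D E F : NodalDisk n} (hFE : IsSub F E) (hED : IsSub E D) : IsSub F D := by
  induction D with
  | marking j => exact hED
  | component seam m pos sub ih =>
    rcases hED with rfl | ⟨c, hc⟩
    · exact hFE
    · exact Or.inr ⟨c, ih c hc⟩

lemma IsSub.labels_subset {D E : NodalDisk n} (h : IsSub E D) {i : Fin n} (hi : i ∈ E.labels) :
    i ∈ D.labels := by
  induction D with
  | marking j => exact h.elim
  | component seam m pos sub ih =>
    rcases h with rfl | ⟨c, hc⟩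
    · exact hi
    · exact mem_labels_component.2 ⟨c, ih c hc⟩

lemma IsSub.isOrdered {D E : NodalDisk n} (h : IsSub E D) (hD : D.IsOrdered) : E.IsOrdered := by
  induction D with
  | marking j => exact h.elim
  | component seam m pos sub ih =>
    rcases h with rfl | ⟨c, hc⟩
    · exact hD
    · exact ih c hc (hD.child c)

lemma IsSub.specialPoint {D E : NodalDisk n} (h : IsSub E D) (hD : D.IsOrdered) {i : Fin n}
    (hi : i ∈ E.labels) : E.specialPoint i.succ = (E.coord i : OnePoint ℝ) := by
  cases E with
  | marking j => exact absurd h not_isSub_marking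
  | component seam m pos sub =>
    have hE := (h.isOrdered hD).sorted
    obtain ⟨c, hc⟩ := mem_labels_component.1 hi
    rw [coord_of_mem hE hc, specialPoint_of_mem hE hc]

lemma IsSub.coord_le {D E : NodalDisk n} (h : IsSub E D) (hD : D.IsOrdered) {i j : Fin n}
    (hi : i ∈ E.labels) (hj : j ∈ E.labels) (hij : i ≤ j) : E.coord i ≤ E.coord j := by
  cases E with
  | marking j => exact absurd h not_isSub_marking
  | component seam m pos sub =>
    have hE := h.isOrdered hD
    obtain ⟨c, hc⟩ := mem_labels_component.1 hi
    obtain ⟨c', hc'⟩ := mem_labels_component.1 hj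
    rw [coord_of_mem hE.sorted hc, coord_of_mem hE.sorted hc']
    refine hE.stable.strictMono.monotone (not_lt.1 fun hlt => ?_)
    exact absurd (labels_lt hE.sorted hlt hc' hc) (not_lt.2 hij)

lemma IsSub.meetsAt_iff {D E : NodalDisk n} (h : IsSub E D) (hD : D.IsOrdered) {i j : Fin n} :
    MeetsAt i j E ↔ i ∈ E.labels ∧ j ∈ E.labels ∧ E.coord i ≠ E.coord j := by
  by_cases hi : i ∈ E.labels
  · by_cases hj : j ∈ E.labels
    · simp [MeetsAt, h.specialPoint hD hi, h.specialPoint hD hj, hi, hj]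
    · simp [MeetsAt, specialPoint_of_notMem hj, hj]
  · simp [MeetsAt, specialPoint_of_notMem hi, hi]

lemma component_coord_inj {seam : Option ℝ} {m : ℕ} {pos : Fin m → ℝ} {sub : Fin m → NodalDisk n}
    (h : (component seam m pos sub).IsOrdered) {i j : Fin n} {c c' : Fin m}
    (hi : i ∈ (sub c).labels) (hj : j ∈ (sub c').labels) :
    (component seam m pos sub).coord i = (component seam m pos sub).coord j ↔ c = c' := by
  rw [coord_of_mem h.sorted hi, coord_of_mem h.sorted hj, h.stable.strictMono.injective.eq_iff]

/-- Two markings are separated on some component. -/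
lemma IsOrdered.exists_meetsAt {D : NodalDisk n} (hD : D.IsOrdered) {i j : Fin n}
    (hi : i ∈ D.labels) (hj : j ∈ D.labels) (hij : i ≠ j) : ∃ E, IsSub E D ∧ MeetsAt i j E := by
  induction D with
  | marking k => simp [labels] at hi hj; exact absurd (hi.trans hj.symm) hij
  | component seam m pos sub ih =>
    obtain ⟨c, hc⟩ := mem_labels_component.1 hi
    obtain ⟨c', hc'⟩ := mem_labels_component.1 hj
    by_cases hcc : c = c'
    · subst hcc
      obtain ⟨E, hE, hE'⟩ := ih c (hD.child c) hc hc'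
      exact ⟨E, Or.inr ⟨c, hE⟩, hE'⟩
    · have hself : IsSub (component seam m pos sub) (component seam m pos sub) := Or.inl rfl
      exact ⟨_, hself, (hself.meetsAt_iff hD).2
        ⟨hi, hj, fun h => hcc ((component_coord_inj hD hc hc').1 h)⟩⟩

/-- Two markings are separated on at most one component. -/
lemma IsOrdered.meetsAt_unique {D E F : NodalDisk n} (hD : D.IsOrdered) (hE : IsSub E D)
    (hF : IsSub F D) {i j : Fin n} (hiE : MeetsAt i j E) (hiF : MeetsAt i j F) : E = F := by
  induction D with
  | marking k => exact hE.elim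
  | component seam m pos sub ih =>
    have hself : IsSub (component seam m pos sub) (component seam m pos sub) := Or.inl rfl
    have key : ∀ (E : NodalDisk n) (c : Fin m), IsSub E (sub c) → MeetsAt i j E →
        i ∈ (sub c).labels ∧ j ∈ (sub c).labels := by
      intro E c hE hm
      obtain ⟨h1, h2, -⟩ := (hE.meetsAt_iff (hD.child c)).1 hm
      exact ⟨hE.labels_subset h1, hE.labels_subset h2⟩
    have key' : ∀ (E : NodalDisk n) (c : Fin m), IsSub E (sub c) → MeetsAt i j E →
        ¬ MeetsAt i j (component seam m pos sub) := by
      intro E c hE hm hm'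
      obtain ⟨h1, h2⟩ := key E c hE hm
      exact ((hself.meetsAt_iff hD).1 hm').2.2 ((component_coord_inj hD h1 h2).2 rfl)
    rcases hE with rfl | ⟨c, hE⟩ <;> rcases hF with rfl | ⟨c', hF⟩
    · rfl
    · exact absurd hiE (key' _ _ hF hiF)
    · exact absurd hiF (key' _ _ hE hiE)
    · have := labels_inj hD.sorted (key E c hE hiE).1 (key F c' hF hiF).1
      subst this
      exact ih c (hD.child c) hE hF

/-- Markings on a component are not separated on a component closer to the root. -/
lemma IsOrdered.coord_eq {D E F : NodalDisk n} (hD : D.IsOrdered) (hE : IsSub E D)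
    (hF : IsSub F D) {i j k : Fin n} (hi : i ∈ E.labels) (hj : j ∈ E.labels) (hiF : i ∈ F.labels)
    (hk : k ∈ F.labels) (hkE : k ∉ E.labels) : F.coord i = F.coord j := by
  induction D with
  | marking k => exact hE.elim
  | component seam m pos sub ih =>
    rcases hE with rfl | ⟨c, hE⟩
    · exact absurd (hF.labels_subset hk) hkE
    · rcases hF with rfl | ⟨c', hF⟩
      · exact (component_coord_inj hD (hE.labels_subset hi) (hE.labels_subset hj)).2 rfl
      · have := labels_inj hD.sorted (hE.labels_subset hi) (hF.labels_subset hiF)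
        subst this
        exact ih c (hD.child c) hE hF

lemma findComponent_eq_some {P : NodalDisk n → Prop} {D E : NodalDisk n}
    (h : D.findComponent P = some E) : IsSub E D ∧ P E := by
  induction D with
  | marking i => cases h
  | component seam m pos sub ih =>
    simp only [findComponent] at h
    split_ifs at h with hp
    · cases h
      exact ⟨Or.inl rfl, hp⟩
    · obtain ⟨c, -, hc⟩ := List.exists_of_findSome?_eq_some h
      exact ⟨Or.inr ⟨c, (ih c hc).1⟩, (ih c hc).2⟩

/-- The search need not return `E`, only some component with the property. Later results must
therefore hold for every component on which the required points are distinct. -/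
lemma exists_findComponent {P : NodalDisk n → Prop} {D E : NodalDisk n} (hE : IsSub E D)
    (hP : P E) : ∃ F, D.findComponent P = some F ∧ IsSub F D ∧ P F := by
  suffices h : (D.findComponent P).isSome by
    obtain ⟨F, hF⟩ := Option.isSome_iff_exists.1 h
    exact ⟨F, hF, findComponent_eq_some hF⟩
  induction D with
  | marking i => exact hE.elim
  | component seam m pos sub ih =>
    simp only [findComponent]
    split_ifs with hp
    · rfl
    · rcases hE with rfl | ⟨c, hc⟩
      · exact absurd hP hp
      · rw [List.findSome?_isSome_iff]
        exact ⟨c, List.mem_finRange c, ih c hc⟩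

/-! ### Seams -/

lemma SeamsOnPaths.not_hasSeam {D : NodalDisk n} (h : D.SeamsOnPaths 0) : ¬ D.HasSeam := by
  induction D with
  | marking i => exact id
  | component seam m pos sub ih =>
    cases seam with
    | some y => obtain ⟨j, hj, -⟩ := h; omega
    | none =>
      rintro (hs | ⟨c, hc⟩)
      · cases hs
      · exact ih c (h c) hc

lemma SeamsOnPaths.hasSeam {D : NodalDisk n} (h : D.SeamsOnPaths 1) (hs : D.IsStable) :
    D.HasSeam := by
  induction D with
  | marking i => cases h
  | component seam m pos sub ih =>
    cases seam with
    | some y => exact Or.inl rfl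
    | none => exact Or.inr ⟨⟨0, hs.one_le⟩, ih _ (h _) (hs.child _)⟩

lemma IsSub.seamsOnPaths {D E : NodalDisk n} (h : IsSub E D) {k : ℕ} (hD : D.SeamsOnPaths k)
    (hk : k ≤ 1) : E.SeamsOnPaths 0 ∨ E.SeamsOnPaths 1 := by
  induction D generalizing k with
  | marking j => exact h.elim
  | component seam m pos sub ih =>
    rcases h with rfl | ⟨c, hc⟩
    · interval_cases k
      · exact Or.inl hD
      · exact Or.inr hD
    · cases seam with
      | some y =>
        obtain ⟨j, hj, hsub⟩ := hD
        exact ih c hc (hsub c) (by omega)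
      | none => exact ih c hc (hD c) hk

lemma IsSub.hasSeam {D E : NodalDisk n} (h : IsSub E D) (hE : E.HasSeam) : D.HasSeam := by
  induction D with
  | marking j => exact h.elim
  | component seam m pos sub ih =>
    rcases h with rfl | ⟨c, hc⟩
    · exact hE
    · exact Or.inr ⟨c, ih c hc⟩

lemma IsSub.height_eq_top {D E : NodalDisk n} (h : IsSub E D) (hD : ¬ D.HasSeam) :
    E.height = ⊤ := by
  have hE := mt h.hasSeam hD
  cases E with
  | marking j => exact absurd h not_isSub_marking
  | component seam m pos sub =>
    cases seam with
    | some y => exact absurd (Or.inl rfl) hE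
    | none => exact if_neg fun hc => hE (Or.inr hc)

/-- A line at height zero or a seam has only components at height `∞` beyond it. -/
lemma IsSub.height_trichotomy {D E : NodalDisk n} (h : IsSub E D) (hD : D.SeamsOnPaths 1)
    (hs : D.IsStable) : E.height = 0 ∨
      ((∃ y : ℝ, 0 < y ∧ E.height = y) ∨ E.height = ⊤) ∧
        ∀ F, IsSub F E → F ≠ E → F.height = ⊤ := by
  have hstab : E.IsStable := by
    clear hD
    induction D with
    | marking j => exact h.elim
    | component seam m pos sub ih =>
      rcases h with rfl | ⟨c, hc⟩
      · exact hs
      · exact ih c hc (hs.child c)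
  have hE := h.seamsOnPaths hD le_rfl
  cases E with
  | marking j => exact absurd h not_isSub_marking
  | component seam m pos sub =>
    cases seam with
    | some y =>
      refine Or.inr ⟨Or.inl ⟨y, hstab.1, rfl⟩, fun F hF hne => ?_⟩
      rcases hF with rfl | ⟨c, hc⟩
      · exact absurd rfl hne
      · refine hc.height_eq_top (SeamsOnPaths.not_hasSeam ?_)
        rcases hE with ⟨j, hj, hsub⟩ | ⟨j, hj, hsub⟩
        · omega
        · obtain rfl : j = 0 := by omega
          exact hsub c
    | none =>
      by_cases hc : ∃ c, (sub c).HasSeam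
      · exact Or.inl (if_pos hc)
      · refine Or.inr ⟨Or.inr (if_neg hc), fun F hF _ => hF.height_eq_top ?_⟩
        rintro (hh | hh)
        · cases hh
        · exact hc hh

end NodalDisk

/-! ### The cross-ratios as functions of a system of ratios -/

/-- The function `a ↦ 1 / a - 1` on `[0, 1]`. -/
noncomputable def invSubOne (a : ℝ) : EReal := (((ENNReal.ofReal a)⁻¹ - 1 : ENNReal) : EReal)

@[simp] lemma invSubOne_one : invSubOne 1 = 0 := by simp [invSubOne]

@[simp] lemma invSubOne_zero : invSubOne 0 = ⊤ := by simp [invSubOne]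

lemma invSubOne_of_pos {a : ℝ} (h0 : 0 < a) (h1 : a ≤ 1) :
    invSubOne a = ((1 / a - 1 : ℝ) : EReal) := by
  have h2 : (0 : ℝ) ≤ a⁻¹ - 1 := sub_nonneg.2 ((one_le_inv₀ h0).2 h1)
  rw [invSubOne, ← ENNReal.ofReal_inv_of_pos h0, ← ENNReal.ofReal_one,
    ← ENNReal.ofReal_sub _ zero_le_one, EReal.coe_ennreal_ofReal, max_eq_left h2, one_div]

lemma continuous_invSubOne : Continuous invSubOne := by
  unfold invSubOne
  exact continuous_coe_ennreal_ereal.comp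
    ((ENNReal.continuous_sub_right 1).comp (continuous_inv.comp ENNReal.continuous_ofReal))

lemma invSubOne_injOn : Set.InjOn invSubOne (Set.Icc 0 1) := by
  intro a ha b hb h
  rcases ha.1.eq_or_lt with rfl | ha0 <;> rcases hb.1.eq_or_lt with rfl | hb0
  · rfl
  · rw [invSubOne_zero, invSubOne_of_pos hb0 hb.2] at h
    exact absurd h.symm (EReal.coe_ne_top _)
  · rw [invSubOne_zero, invSubOne_of_pos ha0 ha.2] at h
    exact absurd h (EReal.coe_ne_top _)
  · rw [invSubOne_of_pos ha0 ha.2, invSubOne_of_pos hb0 hb.2, EReal.coe_eq_coe_iff] at h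
    exact inv_injective (by simpa [one_div] using h)

/-- The number `L / (L + h)`. -/
noncomputable def heightRatio (h : EReal) (L : ℝ) : ℝ :=
  if h = 0 then 1 else if h = ⊤ then 0 else L / (L + h.toReal)

lemma heightRatio_zero (L : ℝ) : heightRatio 0 L = 1 := if_pos rfl

lemma heightRatio_top (L : ℝ) : heightRatio ⊤ L = 0 := by simp [heightRatio]

lemma heightRatio_coe {y : ℝ} (hy : 0 < y) (L : ℝ) : heightRatio y L = L / (L + y) := by
  simp [heightRatio, hy.ne']

lemma pointDiff_coe_coe (x y : ℝ) : pointDiff x y = x - y := rfl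
lemma pointDiff_infty_coe (y : ℝ) : pointDiff ∞ y = 1 := rfl
lemma pointDiff_coe_infty (x : ℝ) : pointDiff x ∞ = -1 := rfl
lemma pointDiff_infty_infty : pointDiff ∞ ∞ = 0 := rfl

lemma crossRatio_of_eq_left (w : OnePoint ℝ) (w₃ w₄ : OnePoint ℝ) :
    crossRatio w w w₃ w₄ = ⊥ := by
  have : pointDiff w w = 0 := by
    induction w using OnePoint.rec
    · rfl
    · exact sub_self _
  rw [crossRatio, this, zero_mul, if_pos rfl]

lemma crossRatio_of_eq_right (w₁ w₂ : OnePoint ℝ) (w : OnePoint ℝ) :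
    crossRatio w₁ w₂ w w = ⊥ := by
  have : pointDiff w w = 0 := by
    induction w using OnePoint.rec
    · rfl
    · exact sub_self _
  rw [crossRatio, this, mul_zero, if_pos rfl]

lemma crossRatio_of_ne {w₁ w₂ w₃ w₄ : OnePoint ℝ}
    (h : pointDiff w₁ w₂ * pointDiff w₃ w₄ ≠ 0) : crossRatio w₁ w₂ w₃ w₄ =
      ((pointDiff w₂ w₃ * pointDiff w₄ w₁ / (pointDiff w₁ w₂ * pointDiff w₃ w₄) : ℝ) : EReal) :=
  if_neg h

/-- This is the identity `(x₃ - x₁) (x₄ - x₂) - (x₂ - x₁) (x₄ - x₃) = (x₃ - x₂) (x₄ - x₁)`, divided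
by `(x₂ - x₁) (x₄ - x₃)`. It makes the cross-ratio a function of two ratios in `[0, 1]`, with the
value `-∞` where their product is 0. -/
lemma crossRatio_coe {x₁ x₂ x₃ x₄ : ℝ} (h12 : x₁ ≤ x₂) (h23 : x₂ ≤ x₃) (h34 : x₃ ≤ x₄)
    (h13 : x₁ < x₃) (h24 : x₂ < x₄) : crossRatio x₁ x₂ x₃ x₄ =
      - invSubOne ((x₂ - x₁) / (x₃ - x₁) * ((x₄ - x₃) / (x₄ - x₂))) := by
  rcases h12.eq_or_lt with rfl | h12
  · simp [crossRatio_of_eq_left]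
  rcases h34.eq_or_lt with rfl | h34
  · simp [crossRatio_of_eq_right]
  have a1 := sub_pos.2 h12
  have a2 := sub_pos.2 h34
  have a3 := sub_pos.2 h13
  have a4 := sub_pos.2 h24
  have a5 : x₁ - x₂ ≠ 0 := by linarith
  have a6 : x₃ - x₄ ≠ 0 := by linarith
  rw [crossRatio_of_ne (show pointDiff (x₁ : OnePoint ℝ) x₂ * pointDiff (x₃ : OnePoint ℝ) x₄ ≠ 0 from
    mul_ne_zero a5 a6)]
  simp only [pointDiff_coe_coe]
  rw [invSubOne_of_pos (by positivity), ← EReal.coe_neg]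
  · congr 1
    field_simp
    ring
  · refine mul_le_one₀ ?_ (by positivity) ?_
    · rw [div_le_one a3]; linarith
    · rw [div_le_one a4]; linarith

lemma crossRatio_coe_infty {x₁ x₂ x₃ : ℝ} (h12 : x₁ ≤ x₂) (h23 : x₂ ≤ x₃) (h13 : x₁ < x₃) :
    crossRatio x₁ x₂ x₃ ∞ = - invSubOne ((x₂ - x₁) / (x₃ - x₁)) := by
  rcases h12.eq_or_lt with rfl | h12
  · simp [crossRatio_of_eq_left]
  have a1 := sub_pos.2 h12
  have a3 := sub_pos.2 h13
  have a5 : x₁ - x₂ ≠ 0 := by linarith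
  rw [crossRatio_of_ne (show pointDiff (x₁ : OnePoint ℝ) x₂ * pointDiff (x₃ : OnePoint ℝ) ∞ ≠ 0 from
    mul_ne_zero a5 (neg_ne_zero.2 one_ne_zero))]
  simp only [pointDiff_coe_coe, pointDiff_coe_infty, pointDiff_infty_coe]
  rw [invSubOne_of_pos (by positivity), ← EReal.coe_neg]
  · congr 1
    field_simp
    ring
  · rw [div_le_one a3]; linarith

lemma crossRatio_infty_coe {x₂ x₃ x₄ : ℝ} (h23 : x₂ ≤ x₃) (h34 : x₃ ≤ x₄) (h24 : x₂ < x₄) :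
    crossRatio ∞ x₂ x₃ x₄ = - invSubOne ((x₄ - x₃) / (x₄ - x₂)) := by
  rcases h34.eq_or_lt with rfl | h34
  · simp [crossRatio_of_eq_right]
  have a2 := sub_pos.2 h34
  have a4 := sub_pos.2 h24
  have a6 : x₃ - x₄ ≠ 0 := by linarith
  rw [crossRatio_of_ne (show pointDiff ∞ (x₂ : OnePoint ℝ) * pointDiff (x₃ : OnePoint ℝ) x₄ ≠ 0 from
    mul_ne_zero one_ne_zero a6)]
  simp only [pointDiff_coe_coe, pointDiff_coe_infty, pointDiff_infty_coe]
  rw [invSubOne_of_pos (by positivity), ← EReal.coe_neg]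
  · congr 1
    field_simp
    ring
  · rw [div_le_one a4]; linarith

lemma crossRatio_infty_infty (x₂ x₃ : ℝ) : crossRatio ∞ x₂ x₃ ∞ = 0 := by
  simp [crossRatio, pointDiff_coe_coe, pointDiff_coe_infty, pointDiff_infty_coe,
    pointDiff_infty_infty]

/-- The values of all cross-ratios for a system of ratios. -/
noncomputable def ratioRho (n : ℕ) (d : (ℕ → ℕ → ℕ → ℝ) × (ℕ → ℕ → ℝ)) :
    ((Fin 4 ↪o Fin (n + 1)) → EReal) × ((Fin 2 ↪o Fin n) → EReal) :=
  (fun q => - invSubOne ((if q 0 = 0 then 1 else d.1 (q 0 - 1) (q 2 - 1) (q 1 - 1)) *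
      (1 - d.1 (q 1 - 1) (q 3 - 1) (q 2 - 1))), fun p => invSubOne (d.2 (p 0) (p 1)))

lemma continuous_ratioRho (n : ℕ) : Continuous (ratioRho n) := by
  refine Continuous.prodMk (continuous_pi fun q => ?_) (continuous_pi fun p => ?_)
  · refine continuous_neg.comp (continuous_invSubOne.comp ?_)
    by_cases h : q 0 = 0 <;> simp only [h, if_true, if_false] <;> fun_prop
  · exact continuous_invSubOne.comp (by fun_prop)

lemma ratioRho_injective {n : ℕ} {d d' : (ℕ → ℕ → ℕ → ℝ) × (ℕ → ℕ → ℝ)} (h : IsRatioSystem n d)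
    (h' : IsRatioSystem n d') (hr : ratioRho n d = ratioRho n d') : d = d' := by
  refine Prod.ext ?_ ?_
  · funext p q k
    by_cases hk : p < q ∧ q < n ∧ p ≤ k ∧ k ≤ q
    · obtain ⟨hpq, hq, hpk, hkq⟩ := hk
      rcases hpk.eq_or_lt with rfl | hpk
      · rw [h.z_left _ _ hpq hq, h'.z_left _ _ hpq hq]
      rcases hkq.eq_or_lt with rfl | hkq
      · rw [h.z_right _ _ hpq hq, h'.z_right _ _ hpq hq]
      -- With `z₀` as first point the first factor is 1, and the cross-ratio reveals a single ratio.
      -- The shift by 1 is needed because index 0 stands for `z₀`.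
      let o : Fin 4 ↪o Fin (n + 1) := OrderEmbedding.ofStrictMono
        ![0, ⟨p + 1, by omega⟩, ⟨k + 1, by omega⟩, ⟨q + 1, by omega⟩] (by
          refine Fin.strictMono_iff_lt_succ.2 fun i => ?_
          fin_cases i <;> simp [Fin.lt_def] <;> omega)
      have hinv := neg_injective (congrFun (congrArg Prod.fst hr) o)
      have e0 : o 0 = 0 := rfl
      have e1 : ((o 1 : Fin (n + 1)) : ℕ) = p + 1 := rfl
      have e2 : ((o 2 : Fin (n + 1)) : ℕ) = k + 1 := rfl
      have e3 : ((o 3 : Fin (n + 1)) : ℕ) = q + 1 := rfl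
      simp only [e0, e1, e2, e3, if_true, one_mul, Nat.add_sub_cancel] at hinv
      have := invSubOne_injOn
        ⟨sub_nonneg.2 (h.z_le_one p q k), sub_le_self _ (h.z_nonneg p q k)⟩
        ⟨sub_nonneg.2 (h'.z_le_one p q k), sub_le_self _ (h'.z_nonneg p q k)⟩ hinv
      linarith
    · rw [h.z_junk _ _ _ hk, h'.z_junk _ _ _ hk]
  · funext p q
    by_cases hk : p < q ∧ q < n
    · obtain ⟨hpq, hq⟩ := hk
      let o : Fin 2 ↪o Fin n := OrderEmbedding.ofStrictMono
        ![⟨p, by omega⟩, ⟨q, hq⟩] (by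
          refine Fin.strictMono_iff_lt_succ.2 fun i => ?_
          fin_cases i
          simpa [Fin.lt_def] using hpq)
      have hinv : invSubOne (d.2 p q) = invSubOne (d'.2 p q) := congrFun (congrArg Prod.snd hr) o
      exact invSubOne_injOn ⟨h.w_nonneg p q hpq hq, h.w_le_one p q hpq hq⟩
        ⟨h'.w_nonneg p q hpq hq, h'.w_le_one p q hpq hq⟩ hinv
    · rw [h.w_junk _ _ hk, h'.w_junk _ _ hk]

/-! ### Nodal disks with prescribed ratios. -/

namespace NodalDisk

variable {n : ℕ}

/-- On every component, the special points and the seam have the given ratios. -/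
def Realizes (d : (ℕ → ℕ → ℕ → ℝ) × (ℕ → ℕ → ℝ)) (D : NodalDisk n) : Prop :=
  ∀ E, IsSub E D → ∀ p q : Fin n, p < q → MeetsAt p q E →
    (∀ k : Fin n, p ≤ k → k ≤ q →
      E.coord k = E.coord p + d.1 p q k * (E.coord q - E.coord p)) ∧
    d.2 p q = heightRatio E.height (E.coord q - E.coord p)

variable {d : (ℕ → ℕ → ℕ → ℝ) × (ℕ → ℕ → ℝ)} {D : NodalDisk n}

lemma Realizes.rho2_eq (hR : D.Realizes d) (hD : D.IsOrdered) (hc : D.SeamsOnPaths 1)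
    {p q : Fin n} (hp : p ∈ D.labels) (hq : q ∈ D.labels) (hpq : p < q) :
    D.rho2 p q = invSubOne (d.2 p q) := by
  obtain ⟨E, hE, hm⟩ := hD.exists_meetsAt hp hq hpq.ne
  obtain ⟨F, hF, hFD, hFm⟩ := exists_findComponent hE hm
  obtain ⟨hpF, hqF, hne⟩ := (hFD.meetsAt_iff hD).1 hFm
  have hlt : 0 < F.coord q - F.coord p :=
    sub_pos.2 ((hFD.coord_le hD hpF hqF hpq.le).lt_of_ne hne)
  rw [rho2, hF, (hR F hFD p q hpq hFm).2]
  simp only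
  rw [hFD.specialPoint hD hpF, hFD.specialPoint hD hqF, pointDiff_coe_coe]
  rcases hFD.height_trichotomy hc hD.stable with h | ⟨⟨y, hy, h⟩ | h, -⟩
  · rw [h, heightRatio_zero, invSubOne_one, EReal.zero_div]
  · rw [h, heightRatio_coe hy, ← EReal.coe_div, invSubOne_of_pos (by positivity)
      (by rw [div_le_one (by positivity)]; linarith)]
    congr 1
    field_simp
    ring
  · rw [h, heightRatio_top, invSubOne_zero, EReal.top_div_of_pos_ne_top (by exact_mod_cast hlt)
      (EReal.coe_ne_top _)]

lemma exists_ne_of_three_le_ncard {α : Type*} {f : Fin 4 → α}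
    (h : 3 ≤ (Set.range f).ncard) (x y : α) : ∃ t, f t ≠ x ∧ f t ≠ y := by
  by_contra hcon
  push Not at hcon
  have hsub : Set.range f ⊆ {x, y} := by
    rintro _ ⟨t, rfl⟩
    by_cases hx : f t = x
    · exact Or.inl hx
    · exact Or.inr (hcon t hx)
  have h1 := Set.ncard_le_ncard hsub
  have h2 := Set.ncard_insert_le x {y}
  rw [Set.ncard_singleton] at h2
  omega

lemma three_le_ncard_range {α : Type*} {f : Fin 4 → α} {a b c : Fin 4} (hab : f a ≠ f b)
    (hac : f a ≠ f c) (hbc : f b ≠ f c) : 3 ≤ (Set.range f).ncard := by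
  have h : ({f a, f b, f c} : Set α).ncard = 3 := Set.ncard_eq_three.2 ⟨_, _, _, hab, hac, hbc, rfl⟩
  rw [← h]
  refine Set.ncard_le_ncard ?_ (Set.toFinite _)
  rintro _ (rfl | rfl | rfl) <;> exact Set.mem_range_self _

/-- The value of a ratio on the component on which two markings are separated. -/
lemma Realizes.z_eq (hR : D.Realizes d) (hD : D.IsOrdered) {p q : Fin n} (hp : p ∈ D.labels)
    (hq : q ∈ D.labels) (hpq : p < q) : ∃ F, IsSub F D ∧ p ∈ F.labels ∧ q ∈ F.labels ∧
      0 < F.coord q - F.coord p ∧ MeetsAt p q F ∧ ∀ k : Fin n, p ≤ k → k ≤ q →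
        d.1 p q k = (F.coord k - F.coord p) / (F.coord q - F.coord p) := by
  obtain ⟨F, hF, hm⟩ := hD.exists_meetsAt hp hq hpq.ne
  obtain ⟨hpF, hqF, hne⟩ := (hF.meetsAt_iff hD).1 hm
  have hlt : 0 < F.coord q - F.coord p :=
    sub_pos.2 ((hF.coord_le hD hpF hqF hpq.le).lt_of_ne hne)
  refine ⟨F, hF, hpF, hqF, hlt, hm, fun k hk hk' => ?_⟩
  rw [(hR F hF p q hpq hm).1 k hk hk']
  field_simp
  ring

lemma Realizes.z_eq_of_isSub (hR : D.Realizes d) (hD : D.IsOrdered) {E : NodalDisk n}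
    (hE : IsSub E D) {p q k : Fin n} (hp : p ∈ E.labels) (hq : q ∈ E.labels) (hpq : p < q)
    (hlt : E.coord p < E.coord q) (hk : p ≤ k) (hk' : k ≤ q) :
    d.1 p q k = (E.coord k - E.coord p) / (E.coord q - E.coord p) := by
  have := sub_pos.2 hlt
  rw [(hR E hE p q hpq ((hE.meetsAt_iff hD).2 ⟨hp, hq, hlt.ne⟩)).1 k hk hk']
  field_simp
  ring

/-- Markings on a component that does not contain `p` or `q` are not separated relative to `p`
and `q`. -/
lemma Realizes.z_eq_z (hR : D.Realizes d) (hD : D.IsOrdered) {E : NodalDisk n} (hE : IsSub E D)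
    {p q a b : Fin n} (hp : p ∈ D.labels) (hq : q ∈ D.labels) (hpq : p < q)
    (ha : a ∈ E.labels) (hb : b ∈ E.labels) (hpa : p ≤ a) (haq : a ≤ q) (hpb : p ≤ b) (hbq : b ≤ q)
    (hE' : p ∉ E.labels ∨ q ∉ E.labels) : d.1 p q a = d.1 p q b := by
  obtain ⟨F, hF, hpF, hqF, hlt, -, hz⟩ := hR.z_eq hD hp hq hpq
  have haF := (hF.isOrdered hD).connected p hpF q hqF a hpa haq
  have : F.coord a = F.coord b := by
    rcases hE' with h | h
    · exact hD.coord_eq hE hF ha hb haF hpF h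
    · exact hD.coord_eq hE hF ha hb haF hqF h
  rw [hz a hpa haq, hz b hpb hbq, this]

/-- The value is independent of the component. The markings on a component form an interval, which
leaves few cases; a marking not on it sits at `∞`, and then `z_eq_z` forces a ratio to be 0 or 1, in
accordance with the degenerate cross-ratio. The remaining cases have only two distinct points. -/
lemma Realizes.crossRatio_eq (hR : D.Realizes d) (hY : IsRatioSystem n d) (hD : D.IsOrdered)
    (hall : ∀ i, i ∈ D.labels) {E : NodalDisk n} (hE : IsSub E D) {q₀ : Fin (n + 1)}
    {j k l : Fin n} (hq : q₀ < j.succ) (hjk : j < k) (hkl : k < l)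
    (h3 : 3 ≤ (Set.range fun t => E.specialPoint (![q₀, j.succ, k.succ, l.succ] t)).ncard) :
    crossRatio (E.specialPoint q₀) (E.specialPoint j.succ) (E.specialPoint k.succ)
      (E.specialPoint l.succ) = - invSubOne ((if q₀ = 0 then 1 else d.1 (q₀ - 1) k j) *
        (1 - d.1 j l k)) := by
  have h3' : ∀ x y : OnePoint ℝ, ¬ ((E.specialPoint q₀ = x ∨ E.specialPoint q₀ = y) ∧
      (E.specialPoint j.succ = x ∨ E.specialPoint j.succ = y) ∧
      (E.specialPoint k.succ = x ∨ E.specialPoint k.succ = y) ∧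
      (E.specialPoint l.succ = x ∨ E.specialPoint l.succ = y)) := by
    rintro x y ⟨a0, a1, a2, a3⟩
    obtain ⟨t, ht1, ht2⟩ := exists_ne_of_three_le_ncard h3 x y
    fin_cases t
    · exact a0.elim ht1 ht2
    · exact a1.elim ht1 ht2
    · exact a2.elim ht1 ht2
    · exact a3.elim ht1 ht2
  have hconn := (hE.isOrdered hD).connected
  have hjn : (j : ℕ) < l := hjk.trans hkl
  have hz1 : d.1 j l j = 0 := hY.z_left _ _ hjn l.2
  have hz2 : d.1 j l l = 1 := hY.z_right _ _ hjn l.2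
  -- The value of the first factor if `q₀` does not lie on the component.
  have hs : (q₀ = 0 ∨ ∃ i : Fin n, q₀ = i.succ ∧ i ∉ E.labels) → j ∈ E.labels → k ∈ E.labels →
      (if q₀ = 0 then 1 else d.1 (q₀ - 1) k j) = 1 := by
    rintro (rfl | ⟨i, rfl, hi⟩) hj hk
    · exact if_pos rfl
    · rw [if_neg (Fin.succ_ne_zero i), Fin.val_succ, Nat.add_sub_cancel]
      have hij : i < j := Fin.succ_lt_succ_iff.1 hq
      rw [hR.z_eq_z hD hE (hall i) (hall k) (hij.trans hjk) hj hk hij.le hjk.le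
        (hij.trans hjk).le le_rfl (Or.inl hi)]
      exact hY.z_right _ _ (hij.trans hjk) k.2
  have hinf : (q₀ = 0 ∨ ∃ i : Fin n, q₀ = i.succ ∧ i ∉ E.labels) → E.specialPoint q₀ = ∞ := by
    rintro (rfl | ⟨i, rfl, hi⟩)
    · cases E <;> rfl
    · exact specialPoint_of_notMem hi
  have hcases : (q₀ = 0 ∨ ∃ i : Fin n, q₀ = i.succ ∧ i ∉ E.labels) ∨
      ∃ i : Fin n, q₀ = i.succ ∧ i ∈ E.labels := by
    rcases Fin.eq_zero_or_eq_succ q₀ with h | ⟨i, h⟩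
    · exact Or.inl (Or.inl h)
    · by_cases hi : i ∈ E.labels
      · exact Or.inr ⟨i, h, hi⟩
      · exact Or.inl (Or.inr ⟨i, h, hi⟩)
  by_cases hj : j ∈ E.labels
  · have ej := hE.specialPoint hD hj
    by_cases hk : k ∈ E.labels
    · have ek := hE.specialPoint hD hk
      have ljk := hE.coord_le hD hj hk hjk.le
      by_cases hl : l ∈ E.labels
      · have el := hE.specialPoint hD hl
        have lkl := hE.coord_le hD hk hl hkl.le
        rcases hcases with hq0 | ⟨i, rfl, hi⟩
        · have hlt : E.coord j < E.coord l := by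
            refine (ljk.trans lkl).lt_of_ne fun he => h3' ∞ (E.coord j) ?_
            have : E.coord k = E.coord j := by linarith
            rw [hinf hq0, ej, ek, el, ← he, this]
            simp
          rw [hs hq0 hj hk, hinf hq0, ej, ek, el, crossRatio_infty_coe ljk lkl hlt, one_mul,
            hR.z_eq_of_isSub hD hE hj hl (hjk.trans hkl) hlt hjk.le hkl.le]
          have := sub_pos.2 hlt
          congr 2
          field_simp
          ring
        · have hij : i < j := Fin.succ_lt_succ_iff.1 hq
          have ei := hE.specialPoint hD hi
          have lij := hE.coord_le hD hi hj hij.le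
          have hik : E.coord i < E.coord k := by
            refine (lij.trans ljk).lt_of_ne fun he => h3' (E.coord i) (E.coord l) ?_
            have : E.coord j = E.coord i := by linarith
            rw [ei, ej, ek, el, ← he, this]
            simp
          have hjl : E.coord j < E.coord l := by
            refine (ljk.trans lkl).lt_of_ne fun he => h3' (E.coord i) (E.coord l) ?_
            have : E.coord k = E.coord l := by linarith
            rw [ei, ej, ek, el, he, this]
            simp
          rw [if_neg (Fin.succ_ne_zero i), Fin.val_succ, Nat.add_sub_cancel, ei, ej, ek, el,
            crossRatio_coe lij ljk lkl hik hjl,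
            hR.z_eq_of_isSub hD hE hi hk (hij.trans hjk) hik hij.le hjk.le,
            hR.z_eq_of_isSub hD hE hj hl (hjk.trans hkl) hjl hjk.le hkl.le]
          have := sub_pos.2 hjl
          congr 3
          field_simp
          ring
      · have ht : d.1 j l k = 0 := by
          rw [← hz1]
          exact hR.z_eq_z hD hE (hall j) (hall l) (hjk.trans hkl) hk hj hjk.le hkl.le le_rfl
            (hjk.trans hkl).le (Or.inr hl)
        have el := specialPoint_of_notMem hl
        rw [ht, sub_zero, mul_one]
        rcases hcases with hq0 | ⟨i, rfl, hi⟩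
        · rw [hs hq0 hj hk, hinf hq0, ej, ek, el, crossRatio_infty_infty, invSubOne_one, neg_zero]
        · have hij : i < j := Fin.succ_lt_succ_iff.1 hq
          have ei := hE.specialPoint hD hi
          have lij := hE.coord_le hD hi hj hij.le
          have hik : E.coord i < E.coord k := by
            refine (lij.trans ljk).lt_of_ne fun he => h3' (E.coord i) ∞ ?_
            have : E.coord j = E.coord i := by linarith
            rw [ei, ej, ek, el, ← he, this]
            simp
          rw [if_neg (Fin.succ_ne_zero i), Fin.val_succ, Nat.add_sub_cancel, ei, ej, ek, el,
            crossRatio_coe_infty lij ljk hik,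
            hR.z_eq_of_isSub hD hE hi hk (hij.trans hjk) hik hij.le hjk.le]
    · have hl : l ∉ E.labels := fun hl => hk (hconn j hj l hl k hjk.le hkl.le)
      have ek := specialPoint_of_notMem hk
      have el := specialPoint_of_notMem hl
      rcases hcases with hq0 | ⟨i, rfl, hi⟩
      · exact absurd ⟨Or.inl (hinf hq0), Or.inr ej, Or.inl ek, Or.inl el⟩ (h3' ∞ (E.coord j))
      · have hij : i < j := Fin.succ_lt_succ_iff.1 hq
        have hs0 : d.1 i k j = 0 := by
          rw [hR.z_eq_z hD hE (hall i) (hall k) (hij.trans hjk) hj hi hij.le hjk.le le_rfl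
            (hij.trans hjk).le (Or.inr hk)]
          exact hY.z_left _ _ (hij.trans hjk) k.2
        rw [if_neg (Fin.succ_ne_zero i), Fin.val_succ, Nat.add_sub_cancel, hs0, ek, el,
          crossRatio_of_eq_right, zero_mul, invSubOne_zero, EReal.neg_top]
  · have ej := specialPoint_of_notMem hj
    by_cases hl : l ∈ E.labels
    · have hi : q₀ = 0 ∨ ∃ i : Fin n, q₀ = i.succ ∧ i ∉ E.labels := by
        refine hcases.resolve_right ?_
        rintro ⟨i, rfl, hi⟩
        exact hj (hconn i hi l hl j (Fin.succ_lt_succ_iff.1 hq).le (hjk.trans hkl).le)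
      by_cases hk : k ∈ E.labels
      · have ht : d.1 j l k = 1 := by
          rw [← hz2]
          exact hR.z_eq_z hD hE (hall j) (hall l) (hjk.trans hkl) hk hl hjk.le hkl.le
            (hjk.trans hkl).le le_rfl (Or.inl hj)
        rw [ht, sub_self, mul_zero, invSubOne_zero, EReal.neg_top, hinf hi, ej,
          crossRatio_of_eq_left]
      · exact absurd ⟨Or.inl (hinf hi), Or.inl ej, Or.inl (specialPoint_of_notMem hk),
          Or.inr (hE.specialPoint hD hl)⟩ (h3' ∞ (E.coord l))
    · have el := specialPoint_of_notMem hl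
      exfalso
      rcases hcases with hq0 | ⟨i, rfl, hi⟩
      · exact h3' ∞ (E.specialPoint k.succ) ⟨Or.inl (hinf hq0), Or.inl ej, Or.inr rfl, Or.inl el⟩
      · have hk : k ∉ E.labels := fun hk =>
          hj (hconn i hi k hk j (Fin.succ_lt_succ_iff.1 hq).le hjk.le)
        exact h3' ∞ (E.specialPoint i.succ)
          ⟨Or.inr rfl, Or.inl ej, Or.inl (specialPoint_of_notMem hk), Or.inl el⟩

/-- The component separating the two middle markings works unless each outer marking coincides there
with its neighbor. -/
lemma IsOrdered.exists_threeDistinct (hD : D.IsOrdered) (hall : ∀ i, i ∈ D.labels)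
    {q₀ : Fin (n + 1)} {j k l : Fin n} (hq : q₀ < j.succ) (hjk : j < k) (hkl : k < l) :
    ∃ E, IsSub E D ∧ ThreeDistinct ![q₀, j.succ, k.succ, l.succ] E := by
  have h0 : ∀ E : NodalDisk n, E.specialPoint 0 = ∞ := fun E => by cases E <;> rfl
  obtain ⟨E, hE, hm⟩ := hD.exists_meetsAt (hall j) (hall k) hjk.ne
  obtain ⟨m1, m2, m3⟩ := hm
  by_cases h1 : E.specialPoint q₀ = E.specialPoint j.succ
  · by_cases h2 : E.specialPoint l.succ = E.specialPoint k.succ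
    · rcases Fin.eq_zero_or_eq_succ q₀ with rfl | ⟨i, rfl⟩
      · rw [h0] at h1
        exact absurd h1.symm m1
      have hij : i < j := Fin.succ_lt_succ_iff.1 hq
      -- The component separating the first two markings is used instead, with `∞` as third point.
      -- If `l` were on it, then so would be `k`, and it would separate `i` and `k`, as `E` does; by
      -- uniqueness it would be `E`, on which `i` and `j` coincide.
      obtain ⟨F, hF, hm'⟩ := hD.exists_meetsAt (hall i) (hall j) hij.ne
      obtain ⟨m1', m2', m3'⟩ := hm'
      by_cases hl : F.specialPoint l.succ = ∞
      · refine ⟨F, hF, three_le_ncard_range (a := 0) (b := 1) (c := 3) m3' ?_ ?_⟩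
        · exact fun h => m1' (h.trans hl)
        · exact fun h => m2' (h.trans hl)
      · exfalso
        have hl' : l ∈ F.labels := by
          by_contra hl'
          exact hl (specialPoint_of_notMem hl')
        obtain ⟨hiF, hjF, -⟩ := (hF.meetsAt_iff hD).1 ⟨m1', m2', m3'⟩
        have hkF := (hF.isOrdered hD).connected i hiF l hl' k (hij.trans hjk).le hkl.le
        have hik : F.coord i < F.coord k := by
          have e1 := hF.coord_le hD hiF hjF hij.le
          have e2 := hF.coord_le hD hjF hkF hjk.le
          have e3 : F.coord i ≠ F.coord j := ((hF.meetsAt_iff hD).1 ⟨m1', m2', m3'⟩).2.2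
          exact (e1.lt_of_ne e3).trans_le e2
        have hEF : E = F := by
          refine hD.meetsAt_unique hE hF (i := i) (j := k) ⟨?_, m2, ?_⟩
            ((hF.meetsAt_iff hD).2 ⟨hiF, hkF, hik.ne⟩)
          · rw [h1]; exact m1
          · rw [h1]; exact m3
        exact m3' (hEF ▸ h1)
    · by_cases hl : E.specialPoint l.succ = E.specialPoint j.succ
      · exfalso
        have hjE : j ∈ E.labels := by
          by_contra h; exact m1 (specialPoint_of_notMem h)
        have hkE : k ∈ E.labels := by
          by_contra h; exact m2 (specialPoint_of_notMem h)
        have hlE : l ∈ E.labels := by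
          by_contra h
          rw [specialPoint_of_notMem h] at hl
          exact m1 hl.symm
        have e1 := hE.coord_le hD hjE hkE hjk.le
        have e2 := hE.coord_le hD hkE hlE hkl.le
        rw [hE.specialPoint hD hlE, hE.specialPoint hD hjE] at hl
        have e3 := OnePoint.coe_injective hl
        have e4 := ((hE.meetsAt_iff hD).1 ⟨m1, m2, m3⟩).2.2
        exact e4 (by linarith)
      · exact ⟨E, hE, three_le_ncard_range (a := 1) (b := 2) (c := 3) m3 (Ne.symm hl)
          (Ne.symm h2)⟩
  · by_cases h2 : E.specialPoint q₀ = E.specialPoint k.succ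
    · exfalso
      have hjE : j ∈ E.labels := by
        by_contra h; exact m1 (specialPoint_of_notMem h)
      have hkE : k ∈ E.labels := by
        by_contra h; exact m2 (specialPoint_of_notMem h)
      rcases Fin.eq_zero_or_eq_succ q₀ with rfl | ⟨i, rfl⟩
      · rw [h0] at h2
        exact m2 h2.symm
      have hij : i < j := Fin.succ_lt_succ_iff.1 hq
      have hiE : i ∈ E.labels := by
        by_contra h
        rw [specialPoint_of_notMem h] at h2
        exact m2 h2.symm
      have e1 := hE.coord_le hD hiE hjE hij.le
      have e2 := hE.coord_le hD hjE hkE hjk.le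
      rw [hE.specialPoint hD hiE, hE.specialPoint hD hkE] at h2
      have e3 := OnePoint.coe_injective h2
      have e4 := ((hE.meetsAt_iff hD).1 ⟨m1, m2, m3⟩).2.2
      exact e4 (by linarith)
    · exact ⟨E, hE, three_le_ncard_range (a := 0) (b := 1) (c := 2) h1 h2 m3⟩

lemma Realizes.rho_eq (hR : D.Realizes d) (hY : IsRatioSystem n d) (hD : D.IsOrdered)
    (hc : D.SeamsOnPaths 1) (hall : ∀ i, i ∈ D.labels) :
    ((fun q => D.rho4 q, fun p => D.rho2 (p 0) (p 1)) :
        ((Fin 4 ↪o Fin (n + 1)) → EReal) × ((Fin 2 ↪o Fin n) → EReal)) = ratioRho n d := by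
  refine Prod.ext (funext fun q => ?_) (funext fun p => ?_)
  · have hq : ∀ t : Fin 4, t ≠ 0 → ∃ i : Fin n, q t = i.succ := fun t ht =>
      Fin.exists_succ_eq_of_ne_zero (fun h0 => by
        have := q.lt_iff_lt.2 (Fin.pos_iff_ne_zero.2 ht)
        rw [h0] at this
        exact absurd this (by simp)) |>.imp fun i hi => hi.symm
    obtain ⟨j, hj⟩ := hq 1 (by decide)
    obtain ⟨k, hk⟩ := hq 2 (by decide)
    obtain ⟨l, hl⟩ := hq 3 (by decide)
    have h01 : q 0 < j.succ := hj ▸ q.lt_iff_lt.2 (by decide)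
    have hjk : j < k := Fin.succ_lt_succ_iff.1 (hj ▸ hk ▸ q.lt_iff_lt.2 (by decide))
    have hkl : k < l := Fin.succ_lt_succ_iff.1 (hk ▸ hl ▸ q.lt_iff_lt.2 (by decide))
    have hvec : (⇑q : Fin 4 → Fin (n + 1)) = ![q 0, j.succ, k.succ, l.succ] := by
      funext t
      fin_cases t
      · rfl
      · exact hj
      · exact hk
      · exact hl
    obtain ⟨E, hE, h3⟩ := hD.exists_threeDistinct hall h01 hjk hkl
    rw [← hvec] at h3
    obtain ⟨F, hF, hFD, hF3⟩ := exists_findComponent hE h3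
    simp only [rho4, ratioRho, hF]
    rw [ThreeDistinct, hvec] at hF3
    rw [hj, hk, hl]
    simp only [Fin.val_succ, Nat.add_sub_cancel]
    exact hR.crossRatio_eq hY hD hall hFD h01 hjk hkl hF3
  · exact hR.rho2_eq hD hc (hall _) (hall _) (p.lt_iff_lt.2 (by decide))

end NodalDisk

namespace NodalDisk

variable {n : ℕ} {d : (ℕ → ℕ → ℕ → ℝ) × (ℕ → ℕ → ℝ)} {D : NodalDisk n}

/-! ### The system of ratios of a nodal quilted disk -/

lemma heightRatio_comp {H : EReal} (hH : H = 0 ∨ (∃ y : ℝ, 0 < y ∧ H = y) ∨ H = ⊤) {L L' : ℝ}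
    (hL : 0 < L) (hL' : 0 < L') :
    heightRatio H L' * (1 - heightRatio H L) =
      L' / L * heightRatio H L * (1 - heightRatio H L') := by
  rcases hH with rfl | ⟨y, hy, rfl⟩ | rfl
  · simp [heightRatio_zero]
  · rw [heightRatio_coe hy, heightRatio_coe hy]
    have : L + y ≠ 0 := by positivity
    have : L' + y ≠ 0 := by positivity
    field_simp
    ring
  · simp [heightRatio_top]

lemma heightRatio_mem {H : EReal} (hH : H = 0 ∨ (∃ y : ℝ, 0 < y ∧ H = y) ∨ H = ⊤) {L : ℝ}
    (hL : 0 < L) : 0 ≤ heightRatio H L ∧ heightRatio H L ≤ 1 := by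
  rcases hH with rfl | ⟨y, hy, rfl⟩ | rfl
  · simp [heightRatio_zero]
  · rw [heightRatio_coe hy, div_le_one (by positivity)]
    exact ⟨by positivity, by linarith⟩
  · simp [heightRatio_top]

/-- The ratios of `p < q` are read off on the unique component separating them. The composition
rules hold because a component that separates a subinterval `p, q` of `P, Q` is either the same one
or lies strictly beyond it. -/
lemma IsOrdered.exists_realizes (hD : D.IsOrdered) (hc : D.SeamsOnPaths 1)
    (hall : ∀ i, i ∈ D.labels) : ∃ d, IsRatioSystem n d ∧ D.Realizes d := by
  have : Nonempty (NodalDisk n) := ⟨D⟩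
  have hex : ∀ p q : Fin n, p < q → ∃ E, IsSub E D ∧ MeetsAt p q E := fun p q hpq =>
    hD.exists_meetsAt (hall p) (hall q) hpq.ne
  choose! E hE hm using hex
  have hmem : ∀ p q : Fin n, p < q → p ∈ (E p q).labels ∧ q ∈ (E p q).labels := fun p q hpq =>
    ⟨(((hE p q hpq).meetsAt_iff hD).1 (hm p q hpq)).1,
      (((hE p q hpq).meetsAt_iff hD).1 (hm p q hpq)).2.1⟩
  have hmemk : ∀ p q k : Fin n, p < q → p ≤ k → k ≤ q → k ∈ (E p q).labels :=
    fun p q k hpq hk hk' => ((hE p q hpq).isOrdered hD).connected p (hmem p q hpq).1 q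
      (hmem p q hpq).2 k hk hk'
  have hlt : ∀ p q : Fin n, p < q → 0 < (E p q).coord q - (E p q).coord p := fun p q hpq =>
    sub_pos.2 (((hE p q hpq).coord_le hD (hmem p q hpq).1 (hmem p q hpq).2 hpq.le).lt_of_ne
      (((hE p q hpq).meetsAt_iff hD).1 (hm p q hpq)).2.2)
  have hmono : ∀ p q k l : Fin n, p < q → p ≤ k → k ≤ l → l ≤ q →
      (E p q).coord k ≤ (E p q).coord l := fun p q k l hpq hk hkl hl =>
    (hE p q hpq).coord_le hD (hmemk p q k hpq hk (hkl.trans hl))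
      (hmemk p q l hpq (hk.trans hkl) hl) hkl
  have hheight : ∀ p q : Fin n, p < q → (E p q).height = 0 ∨
      (∃ y : ℝ, 0 < y ∧ (E p q).height = y) ∨ (E p q).height = ⊤ := fun p q hpq =>
    ((hE p q hpq).height_trichotomy hc hD.stable).imp id fun h => h.1
  have hcase : ∀ P Q p q : Fin n, P ≤ p → p < q → q ≤ Q →
      (E P Q).coord p = (E P Q).coord q ∨
        0 < (E P Q).coord q - (E P Q).coord p ∧ E p q = E P Q := by
    intro P Q p q hP hpq hQ
    have hPQ : P < Q := hP.trans_lt (hpq.trans_le hQ)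
    rcases (hmono P Q p q hPQ hP hpq.le hQ).eq_or_lt with h | h
    · exact Or.inl h
    · refine Or.inr ⟨sub_pos.2 h, hD.meetsAt_unique (hE p q hpq) (hE P Q hPQ) (hm p q hpq)
        (((hE P Q hPQ).meetsAt_iff hD).2 ⟨hmemk P Q p hPQ hP (hpq.le.trans hQ),
          hmemk P Q q hPQ (hP.trans hpq.le) hQ, h.ne⟩)⟩
  let z : ℕ → ℕ → ℕ → ℝ := fun p q k => if h : p < q ∧ q < n ∧ p ≤ k ∧ k ≤ q then
    ((E ⟨p, by omega⟩ ⟨q, by omega⟩).coord ⟨k, by omega⟩ -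
      (E ⟨p, by omega⟩ ⟨q, by omega⟩).coord ⟨p, by omega⟩) /
      ((E ⟨p, by omega⟩ ⟨q, by omega⟩).coord ⟨q, by omega⟩ -
        (E ⟨p, by omega⟩ ⟨q, by omega⟩).coord ⟨p, by omega⟩) else 0
  let w : ℕ → ℕ → ℝ := fun p q => if h : p < q ∧ q < n then
    heightRatio (E ⟨p, by omega⟩ ⟨q, by omega⟩).height
      ((E ⟨p, by omega⟩ ⟨q, by omega⟩).coord ⟨q, by omega⟩ -
        (E ⟨p, by omega⟩ ⟨q, by omega⟩).coord ⟨p, by omega⟩) else 0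
  have hz : ∀ p q k : Fin n, p < q → p ≤ k → k ≤ q → z p q k =
      ((E p q).coord k - (E p q).coord p) / ((E p q).coord q - (E p q).coord p) :=
    fun p q k hpq hk hk' => dif_pos ⟨hpq, q.2, hk, hk'⟩
  have hw : ∀ p q : Fin n, p < q → w p q =
      heightRatio (E p q).height ((E p q).coord q - (E p q).coord p) :=
    fun p q hpq => dif_pos ⟨hpq, q.2⟩
  have zcomp : ∀ P Q p q k : Fin n, P ≤ p → p < q → q ≤ Q → p ≤ k → k ≤ q →
      z P Q k = z P Q p + (z P Q q - z P Q p) * z p q k := by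
    intro P Q p q k hP hpq hQ hk hk'
    have hPQ : P < Q := hP.trans_lt (hpq.trans_le hQ)
    rw [hz P Q k hPQ (hP.trans hk) (hk'.trans hQ), hz P Q p hPQ hP (hpq.le.trans hQ),
      hz P Q q hPQ (hP.trans hpq.le) hQ]
    rcases hcase P Q p q hP hpq hQ with h | ⟨hpos, h⟩
    · have h1 := hmono P Q p k hPQ hP hk (hk'.trans hQ)
      have h2 := hmono P Q k q hPQ (hP.trans hk) hk' hQ
      have h3 : (E P Q).coord k = (E P Q).coord p := by linarith
      rw [h3, ← h]
      ring
    · rw [hz p q k hpq hk hk', h]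
      have := hlt P Q hPQ
      field_simp
      ring
  have wcomp : ∀ P Q p q : Fin n, P ≤ p → p < q → q ≤ Q →
      w p q * (1 - w P Q) = (z P Q q - z P Q p) * w P Q * (1 - w p q) := by
    intro P Q p q hP hpq hQ
    have hPQ : P < Q := hP.trans_lt (hpq.trans_le hQ)
    have hpos := hlt P Q hPQ
    rw [hz P Q p hPQ hP (hpq.le.trans hQ), hz P Q q hPQ (hP.trans hpq.le) hQ, ← sub_div,
      sub_sub_sub_cancel_right]
    rcases hcase P Q p q hP hpq hQ with h | ⟨hpos', h⟩
    · rw [← h, sub_self, zero_div, zero_mul, zero_mul]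
      -- The component of `p, q` lies strictly beyond that of `P, Q`. Either the latter is at height
      -- 0, so `w P Q = 1`, or everything beyond it is at height `∞`, so `w p q = 0`; both sides of
      -- the rule vanish.
      rcases (hE P Q hPQ).height_trichotomy hc hD.stable with h0 | ⟨-, hbelow⟩
      · rw [hw P Q hPQ, h0, heightRatio_zero, sub_self, mul_zero]
      · obtain ⟨F, hF, hFm⟩ := ((hE P Q hPQ).isOrdered hD).exists_meetsAt
          (hmemk P Q p hPQ hP (hpq.le.trans hQ)) (hmemk P Q q hPQ (hP.trans hpq.le) hQ) hpq.ne
        have hFe := hD.meetsAt_unique (hF.trans (hE P Q hPQ)) (hE p q hpq) hFm (hm p q hpq)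
        have hne : E p q ≠ E P Q := fun heq => by
          have := hlt p q hpq
          rw [heq] at this
          linarith
        rw [hw p q hpq, hbelow _ (hFe ▸ hF) hne, heightRatio_top, zero_mul]
    · rw [hw p q hpq, hw P Q hPQ, h]
      exact heightRatio_comp (hheight P Q hPQ) hpos hpos'
  refine ⟨(z, w), ⟨?_, ?_, ?_, ?_, ?_, ?_, ?_, ?_, ?_⟩, ?_⟩
  · intro p q hpq hq
    have := hz ⟨p, by omega⟩ ⟨q, hq⟩ ⟨p, by omega⟩ hpq le_rfl hpq.le
    rwa [sub_self, zero_div] at this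
  · intro p q hpq hq
    have := hz ⟨p, by omega⟩ ⟨q, hq⟩ ⟨q, by omega⟩ hpq hpq.le le_rfl
    rwa [div_self (hlt ⟨p, by omega⟩ ⟨q, hq⟩ hpq).ne'] at this
  · intro p q k hpq hq hk hk'
    have h1 := hz ⟨p, by omega⟩ ⟨q, hq⟩ ⟨k, by omega⟩ hpq hk hk'.le
    have h2 := hz ⟨p, by omega⟩ ⟨q, hq⟩ ⟨k + 1, by omega⟩ hpq (Nat.le_succ_of_le hk) hk'
    have h3 := hlt ⟨p, by omega⟩ ⟨q, hq⟩ hpq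
    have h4 := hmono ⟨p, by omega⟩ ⟨q, hq⟩ ⟨k, by omega⟩ ⟨k + 1, by omega⟩ hpq hk
      (Nat.le_succ k) hk'
    simp only at h1 h2
    simp only [h1, h2]
    gcongr
  · intro P Q p q k hP hpq hQ hn hk hk'
    exact zcomp ⟨P, by omega⟩ ⟨Q, hn⟩ ⟨p, by omega⟩ ⟨q, by omega⟩ ⟨k, by omega⟩ hP hpq hQ hk hk'
  · exact fun p q k h => dif_neg h
  · intro p q hpq hq
    have := hw ⟨p, by omega⟩ ⟨q, hq⟩ hpq
    simp only at this
    simp only [this]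
    exact (heightRatio_mem (hheight _ _ hpq) (hlt _ _ hpq)).1
  · intro p q hpq hq
    have := hw ⟨p, by omega⟩ ⟨q, hq⟩ hpq
    simp only at this
    simp only [this]
    exact (heightRatio_mem (hheight _ _ hpq) (hlt _ _ hpq)).2
  · intro P Q p q hP hpq hQ hn
    exact wcomp ⟨P, by omega⟩ ⟨Q, hn⟩ ⟨p, by omega⟩ ⟨q, by omega⟩ hP hpq hQ
  · exact fun p q h => dif_neg h
  · intro F hF p q hpq hFm
    obtain rfl := hD.meetsAt_unique hF (hE p q hpq) hFm (hm p q hpq)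
    have := hlt p q hpq
    refine ⟨fun k hk hk' => ?_, hw p q hpq⟩
    change _ = _ + z p q k * _
    rw [hz p q k hpq hk hk']
    field_simp
    ring

/-! ### A nodal quilted disk with a given system of ratios -/

/-- The labels in an interval, in order. -/
def intervalLabels (n a b : ℕ) : List (Fin n) :=
  (List.finRange n).filter fun i => a ≤ (i : ℕ) ∧ (i : ℕ) ≤ b

lemma mem_intervalLabels {a b : ℕ} {i : Fin n} :
    i ∈ intervalLabels n a b ↔ a ≤ (i : ℕ) ∧ (i : ℕ) ≤ b := by
  simp [intervalLabels]

lemma pairwise_intervalLabels (a b : ℕ) : (intervalLabels n a b).Pairwise (· < ·) :=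
  (List.pairwise_lt_finRange n).filter _

lemma realizes_component {seam : Option ℝ} {m : ℕ} {pos : Fin m → ℝ} {sub : Fin m → NodalDisk n}
    (hsub : ∀ c, (sub c).Realizes d)
    (h : ∀ p q : Fin n, p < q → MeetsAt p q (component seam m pos sub) →
      (∀ k : Fin n, p ≤ k → k ≤ q → (component seam m pos sub).coord k =
        (component seam m pos sub).coord p + d.1 p q k *
          ((component seam m pos sub).coord q - (component seam m pos sub).coord p)) ∧
      d.2 p q = heightRatio (component seam m pos sub).height
        ((component seam m pos sub).coord q - (component seam m pos sub).coord p)) :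
    (component seam m pos sub).Realizes d := by
  rintro E (rfl | ⟨c, hc⟩)
  · exact h
  · exact hsub c E hc

/-- The special points are the values of `z` on the interval. By monotonicity the markings with a
given value form a subinterval, which becomes the tree attached there; at least two values occur,
namely 0 and 1. -/
lemma exists_component (hY : IsRatioSystem n d) {a b : ℕ} (hab : a < b) (hb : b < n)
    (seam : Option ℝ) {Q : NodalDisk n → Prop}
    (hsub : ∀ p q, a ≤ p → p ≤ q → q ≤ b → d.1 a b p = d.1 a b q →
      ∃ D : NodalDisk n, D.labels = intervalLabels n p q ∧ Q D) :
    ∃ (m : ℕ) (pos : Fin m → ℝ) (sub : Fin m → NodalDisk n), 2 ≤ m ∧ StrictMono pos ∧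
      (∀ c, Q (sub c)) ∧ (component seam m pos sub).labels = intervalLabels n a b ∧
      ∀ i : Fin n, a ≤ (i : ℕ) → (i : ℕ) ≤ b →
        (component seam m pos sub).coord i = d.1 a b i := by
  classical
  let S := (Finset.Icc a b).image (d.1 a b)
  let pos : Fin S.card → ℝ := S.orderEmbOfFin rfl
  have hpos : StrictMono pos := (S.orderEmbOfFin rfl).strictMono
  have hfib : ∀ c, ((Finset.Icc a b).filter fun k => d.1 a b k = pos c).Nonempty := by
    intro c
    obtain ⟨k, hk, hkc⟩ := Finset.mem_image.1 (S.orderEmbOfFin_mem rfl c)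
    exact ⟨k, Finset.mem_filter.2 ⟨hk, hkc⟩⟩
  have hfib' : ∀ c, ∃ p q, a ≤ p ∧ p ≤ q ∧ q ≤ b ∧ d.1 a b p = d.1 a b q ∧
      ∀ k, p ≤ k ∧ k ≤ q ↔ (a ≤ k ∧ k ≤ b) ∧ d.1 a b k = pos c := by
    intro c
    have h1 := Finset.min'_mem _ (hfib c)
    have h2 := Finset.max'_mem _ (hfib c)
    have h4 : ∀ k ∈ (Finset.Icc a b).filter fun k => d.1 a b k = pos c,
      Finset.min' _ (hfib c) ≤ k := fun k hk => Finset.min'_le _ k hk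
    have h5 : ∀ k ∈ (Finset.Icc a b).filter fun k => d.1 a b k = pos c,
      k ≤ Finset.max' _ (hfib c) := fun k hk => Finset.le_max' _ k hk
    have h3 := h5 _ h1
    set lo := Finset.min' _ (hfib c) with hlo
    set hi := Finset.max' _ (hfib c) with hhi
    simp only [Finset.mem_filter, Finset.mem_Icc] at h1 h2 h4 h5
    refine ⟨lo, hi, h1.1.1, h3, h2.1.2, h1.2.trans h2.2.symm, fun k => ⟨fun hk => ?_, fun hk => ?_⟩⟩
    · refine ⟨⟨h1.1.1.trans hk.1, hk.2.trans h2.1.2⟩, le_antisymm ?_ ?_⟩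
      · rw [← h2.2]
        exact hY.z_mono (h1.1.1.trans hk.1) hk.2 h2.1.2 hb
      · rw [← h1.2]
        exact hY.z_mono h1.1.1 hk.1 (hk.2.trans h2.1.2) hb
    · exact ⟨h4 k hk, h5 k hk⟩
  choose lo hi g1 g2 g3 g4 g5 using hfib'
  choose sub hlab hQ using fun c => hsub (lo c) (hi c) (g1 c) (g2 c) (g3 c) (g4 c)
  have hmem : ∀ c (i : Fin n), i ∈ (sub c).labels ↔
      (a ≤ (i : ℕ) ∧ (i : ℕ) ≤ b) ∧ d.1 a b i = pos c := by
    intro c i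
    rw [hlab, mem_intervalLabels, g5]
  have hex : ∀ k, a ≤ k → k ≤ b → ∃ c, d.1 a b k = pos c := by
    intro k hk hk'
    have : d.1 a b k ∈ Set.range pos := by
      rw [Finset.range_orderEmbOfFin]
      exact Finset.mem_coe.2 (Finset.mem_image_of_mem _ (Finset.mem_Icc.2 ⟨hk, hk'⟩))
    obtain ⟨c, hc⟩ := this
    exact ⟨c, hc.symm⟩
  have hsorted : (component seam S.card pos sub).labels.Pairwise (· < ·) := by
    rw [labels, List.pairwise_flatMap]
    refine ⟨fun c _ => by rw [hlab]; exact pairwise_intervalLabels _ _, ?_⟩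
    refine (List.pairwise_lt_finRange _).imp fun {c c'} hcc i hi j hj => ?_
    rw [hmem] at hi hj
    by_contra hle
    have := hY.z_mono hj.1.1 (Fin.le_def.1 (not_lt.1 hle)) hi.1.2 hb
    rw [hi.2, hj.2] at this
    exact absurd (hpos hcc) (not_lt.2 this)
  refine ⟨S.card, pos, sub, ?_, hpos, hQ, List.eq_of_pairwise_lt hsorted
    (pairwise_intervalLabels a b) fun i => ?_, fun i hi hi' => ?_⟩
  · refine Finset.one_lt_card.2 ⟨0, ?_, 1, ?_, zero_ne_one⟩
    · exact Finset.mem_image.2 ⟨a, Finset.mem_Icc.2 ⟨le_rfl, hab.le⟩, hY.z_left a b hab hb⟩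
    · exact Finset.mem_image.2 ⟨b, Finset.mem_Icc.2 ⟨hab.le, le_rfl⟩, hY.z_right a b hab hb⟩
  · rw [mem_labels_component, mem_intervalLabels]
    constructor
    · rintro ⟨c, hc⟩
      exact ((hmem c i).1 hc).1
    · intro hi
      obtain ⟨c, hc⟩ := hex i hi.1 hi.2
      exact ⟨c, (hmem c i).2 ⟨hi, hc⟩⟩
  · obtain ⟨c, hc⟩ := hex i hi hi'
    rw [coord_of_mem hsorted ((hmem c i).2 ⟨⟨hi, hi'⟩, hc⟩), hc]

/-- For given value on an interval of length 1, the rule `w_comp` is a linear equation for `w` with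
non-zero leading coefficient. -/
lemma heightRatio_of_comp {H : EReal} (hH : H = 0 ∨ (∃ y : ℝ, 0 < y ∧ H = y) ∨ H = ⊤) {w U : ℝ}
    (hU : 0 < U) (hw : w * (1 - heightRatio H 1) = U * heightRatio H 1 * (1 - w)) :
    w = heightRatio H U := by
  rcases hH with rfl | ⟨y, hy, rfl⟩ | rfl
  · rw [heightRatio_zero] at hw ⊢
    have : U * (1 - w) = 0 := by linarith
    have := (mul_eq_zero.1 this).resolve_left hU.ne'
    linarith
  · rw [heightRatio_coe hy] at hw ⊢
    rw [eq_div_iff (by positivity)]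
    field_simp at hw
    linarith
  · rw [heightRatio_top] at hw ⊢
    linarith

/-- In the chosen coordinates the interval from `a` to `b` has length 1, so its single value `d.2 a
b` has to match the height, and `w_comp` takes care of all other pairs separated on the component.
-/
lemma exists_component_realizes (hY : IsRatioSystem n d) {a b : ℕ} (hab : a < b) (hb : b < n)
    (seam : Option ℝ) {Q : NodalDisk n → Prop} {H : EReal}
    (hH : H = 0 ∨ (∃ y : ℝ, 0 < y ∧ H = y) ∨ H = ⊤) (hHw : d.2 a b = heightRatio H 1)
    (hheight : ∀ (m : ℕ) (pos : Fin m → ℝ) (sub : Fin m → NodalDisk n), 2 ≤ m →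
      (∀ c, Q (sub c)) → (component seam m pos sub).height = H)
    (hsub : ∀ p q, a ≤ p → p ≤ q → q ≤ b → d.1 a b p = d.1 a b q →
      ∃ D : NodalDisk n, D.labels = intervalLabels n p q ∧ D.Realizes d ∧ Q D) :
    ∃ (m : ℕ) (pos : Fin m → ℝ) (sub : Fin m → NodalDisk n), 2 ≤ m ∧ StrictMono pos ∧
      (∀ c, Q (sub c)) ∧ (component seam m pos sub).labels = intervalLabels n a b ∧
      (component seam m pos sub).Realizes d := by
  obtain ⟨m, pos, sub, hm, hpos, hQ, hlab, hcoord⟩ := exists_component hY hab hb seam hsub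
  refine ⟨m, pos, sub, hm, hpos, fun c => (hQ c).2, hlab,
    realizes_component (fun c => (hQ c).1) fun p q hpq hmeet => ?_⟩
  have hp : p ∈ intervalLabels n a b := by
    rw [← hlab]
    by_contra h
    exact hmeet.1 (specialPoint_of_notMem h)
  have hq : q ∈ intervalLabels n a b := by
    rw [← hlab]
    by_contra h
    exact hmeet.2.1 (specialPoint_of_notMem h)
  rw [mem_intervalLabels] at hp hq
  have hcp := hcoord p hp.1 hp.2
  have hcq := hcoord q hq.1 hq.2
  refine ⟨fun k hk hk' => ?_, ?_⟩
  · rw [hcoord k (hp.1.trans hk) (le_trans (Fin.le_def.1 hk') hq.2), hcp, hcq,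
      hY.z_comp a b p q k hp.1 hpq hq.2 hb hk hk']
    ring
  · rw [hheight m pos sub hm fun c => (hQ c).2, hcp, hcq]
    have hself : IsSub (component seam m pos sub) (component seam m pos sub) := Or.inl rfl
    have hne : d.1 a b p ≠ d.1 a b q := by
      have hsorted : (component seam m pos sub).labels.Pairwise (· < ·) := by
        rw [hlab]; exact pairwise_intervalLabels a b
      obtain ⟨c, hc⟩ := mem_labels_component.1 (hlab ▸ mem_intervalLabels.2 hp)
      obtain ⟨c', hc'⟩ := mem_labels_component.1 (hlab ▸ mem_intervalLabels.2 hq)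
      intro heq
      rw [← hcp, ← hcq, coord_of_mem hsorted hc, coord_of_mem hsorted hc'] at heq
      exact hmeet.2.2 (by rw [specialPoint_of_mem hsorted hc, specialPoint_of_mem hsorted hc', heq])
    refine heightRatio_of_comp hH (sub_pos.2
      ((hY.z_mono hp.1 (Fin.le_def.1 hpq.le) hq.2 hb).lt_of_ne hne)) ?_
    rw [← hHw]
    exact hY.w_comp a b p q hp.1 hpq hq.2 hb

lemma realizes_marking (i : Fin n) : (marking i).Realizes d := fun _ h => h.elim

lemma labels_marking_eq {a : ℕ} (ha : a < n) :
    (marking (⟨a, ha⟩ : Fin n)).labels = intervalLabels n a a := by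
  refine List.eq_of_pairwise_lt (by simp [labels]) (pairwise_intervalLabels a a) fun i => ?_
  rw [mem_intervalLabels]
  simp only [labels, List.mem_singleton, Fin.ext_iff]
  omega

lemma exists_unquilted (hY : IsRatioSystem n d) (m : ℕ) : ∀ a b, a ≤ b → b < n → b - a = m →
    (∀ p q, a ≤ p → p < q → q ≤ b → d.2 p q = 0) →
    ∃ D : NodalDisk n, D.labels = intervalLabels n a b ∧ D.Realizes d ∧
      D.IsStable ∧ D.SeamsOnPaths 0 := by
  induction m using Nat.strong_induction_on with
  | _ m ih =>
    intro a b hab hb hm hw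
    rcases hab.eq_or_lt with rfl | hab
    · exact ⟨marking ⟨a, hb⟩, labels_marking_eq hb, realizes_marking _, trivial, rfl⟩
    obtain ⟨k, pos, sub, hk, hpos, hQ, hlab, hR⟩ := exists_component_realizes hY hab hb none
      (Q := fun D => D.IsStable ∧ D.SeamsOnPaths 0) (H := ⊤) (Or.inr (Or.inr rfl))
      (by rw [hw a b le_rfl hab le_rfl, heightRatio_top])
      (fun m pos sub _ hQ => if_neg fun ⟨c, hc⟩ => (hQ c).2.not_hasSeam hc)
      (fun p q hp hpq hq hz => ih (q - p) (by
          have : ¬ (p = a ∧ q = b) := by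
            rintro ⟨rfl, rfl⟩
            rw [hY.z_left _ _ hab hb, hY.z_right _ _ hab hb] at hz
            exact zero_ne_one hz
          omega) p q hpq (by omega) rfl
        fun p' q' hp' hpq' hq' => hw p' q' (by omega) hpq' (by omega))
    exact ⟨component none k pos sub, hlab, hR, ⟨hk, hpos, fun c => (hQ c).1⟩, fun c => (hQ c).2⟩

/-- A bivalent quilted component on the root side supplies the seam. It separates no markings, so it
imposes no condition and its height may be 1. -/
lemma exists_quilted_of_unquilted {a b : ℕ} (hD₀ : ∃ D₀ : NodalDisk n,
    D₀.labels = intervalLabels n a b ∧ D₀.Realizes d ∧ D₀.IsStable ∧ D₀.SeamsOnPaths 0) :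
    ∃ D : NodalDisk n, D.labels = intervalLabels n a b ∧ D.Realizes d ∧
      D.IsStable ∧ D.SeamsOnPaths 1 := by
  obtain ⟨D₀, hlab, hR, hs, hc⟩ := hD₀
  have hl : (component (some 1) 1 (fun _ => 0) fun _ => D₀).labels = intervalLabels n a b := by
    simp [labels, hlab, List.finRange_succ]
  refine ⟨component (some 1) 1 (fun _ => 0) fun _ => D₀, hl,
    realizes_component (fun _ => hR) fun p q _ hm => ?_,
    ⟨one_pos, le_rfl, Subsingleton.strictMono _, fun _ => hs⟩, ⟨0, rfl, fun _ => hc⟩⟩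
  have hsorted : (component (some 1) 1 (fun _ => 0) fun _ => D₀).labels.Pairwise (· < ·) := by
    rw [hl]; exact pairwise_intervalLabels a b
  obtain ⟨m1, m2, m3⟩ := hm
  have h1 := mem_labels_component.1 (of_not_not (mt specialPoint_of_notMem m1))
  have h2 := mem_labels_component.1 (of_not_not (mt specialPoint_of_notMem m2))
  obtain ⟨c, h1⟩ := h1
  obtain ⟨c', h2⟩ := h2
  exact absurd ((specialPoint_of_mem (c := 0) hsorted h1).trans
    (specialPoint_of_mem (c := 0) hsorted h2).symm) m3

/-- If `w = 0` on the whole interval, the seam is infinitely high and needs a bivalent component of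
its own. If `w = 1`, it is infinitely low and is passed on to the clusters. Otherwise it lies on the
root component. -/
lemma exists_quilted (hY : IsRatioSystem n d) (m : ℕ) : ∀ a b, a ≤ b → b < n → b - a = m →
    ∃ D : NodalDisk n, D.labels = intervalLabels n a b ∧ D.Realizes d ∧
      D.IsStable ∧ D.SeamsOnPaths 1 := by
  induction m using Nat.strong_induction_on with
  | _ m ih =>
    intro a b hab hb hm
    rcases hab.eq_or_lt with rfl | hab
    · exact exists_quilted_of_unquilted (exists_unquilted hY 0 a a le_rfl hb (by omega)
        fun p q hp hpq hq => by omega)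
    have hW0 := hY.w_nonneg a b hab hb
    have hW1 := hY.w_le_one a b hab hb
    rcases hW0.eq_or_lt with h0 | h0
    · refine exists_quilted_of_unquilted (exists_unquilted hY m a b hab.le hb hm
        fun p q hp hpq hq => ?_)
      have := hY.w_comp a b p q hp hpq hq hb
      rw [← h0] at this
      linarith
    rcases hW1.eq_or_lt with h1 | h1
    · obtain ⟨k, pos, sub, hk, hpos, hQ, hlab, hR⟩ := exists_component_realizes hY hab hb none
        (Q := fun D => D.IsStable ∧ D.SeamsOnPaths 1) (H := 0) (Or.inl rfl)
        (by rw [h1, heightRatio_zero])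
        (fun m pos sub hm hQ => if_pos ⟨⟨0, by omega⟩, (hQ _).2.hasSeam (hQ _).1⟩)
        (fun p q hp hpq hq hz => ih (q - p) (by
          have : ¬ (p = a ∧ q = b) := by
            rintro ⟨rfl, rfl⟩
            rw [hY.z_left _ _ hab hb, hY.z_right _ _ hab hb] at hz
            exact zero_ne_one hz
          omega) p q hpq (by omega) rfl)
      exact ⟨component none k pos sub, hlab, hR, ⟨hk, hpos, fun c => (hQ c).1⟩, fun c => (hQ c).2⟩
    -- The interval has length 1, so `w = 1 / (1 + y)`, that is `y = (1 - w) / w`.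
    · have hy : 0 < (1 - d.2 a b) / d.2 a b := div_pos (sub_pos.2 h1) h0
      obtain ⟨k, pos, sub, hk, hpos, hQ, hlab, hR⟩ := exists_component_realizes hY hab hb
        (some ((1 - d.2 a b) / d.2 a b))
        (Q := fun D => D.IsStable ∧ D.SeamsOnPaths 0) (H := ((1 - d.2 a b) / d.2 a b : ℝ))
        (Or.inr (Or.inl ⟨_, hy, rfl⟩))
        (by rw [heightRatio_coe hy]; field_simp; ring)
        (fun m pos sub _ _ => rfl)
        (fun p q hp hpq hq hz => exists_unquilted hY (q - p) p q hpq (by omega) rfl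
          fun p' q' hp' hpq' hq' => by
            -- A cluster has width 0 in the whole interval. Since `w < 1` there, the rule forces `w
            -- = 0` inside the cluster, which is therefore unquilted.
            have hw := hY.w_comp a b p' q' (hp.trans hp') hpq' (hq'.trans hq) hb
            have e1 := hY.z_mono hp hp' (by omega) hb
            have e2 := hY.z_mono (show a ≤ p' by omega) hpq'.le (by omega) hb
            have e3 := hY.z_mono (show a ≤ q' by omega) hq' hq hb
            have e4 : d.1 a b q' - d.1 a b p' = 0 := by linarith
            rw [e4, zero_mul, zero_mul] at hw
            exact (mul_eq_zero.1 hw).resolve_right (sub_pos.2 h1).ne')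
      exact ⟨component _ k pos sub, hlab, hR, ⟨hy, by omega, hpos, fun c => (hQ c).1⟩,
        ⟨0, rfl, fun c => (hQ c).2⟩⟩

end NodalDisk

namespace NodalDisk

variable {n : ℕ} {d : (ℕ → ℕ → ℕ → ℝ) × (ℕ → ℕ → ℝ)}

/-! ### The system of ratios determines the isomorphism class -/

section

variable {seam seam' : Option ℝ} {m m' : ℕ} {pos : Fin m → ℝ} {pos' : Fin m' → ℝ}
  {sub : Fin m → NodalDisk n} {sub' : Fin m' → NodalDisk n}

lemma mem_labels_iff_coord (hD : (component seam m pos sub).IsOrdered) {c : Fin m} {i : Fin n} :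
    i ∈ (sub c).labels ↔ i ∈ (component seam m pos sub).labels ∧
      (component seam m pos sub).coord i = pos c := by
  refine ⟨fun h => ⟨mem_labels_component.2 ⟨c, h⟩, coord_of_mem hD.sorted h⟩, fun ⟨h, hc⟩ => ?_⟩
  obtain ⟨c', hc'⟩ := mem_labels_component.1 h
  rw [coord_of_mem hD.sorted hc'] at hc
  rwa [← hD.stable.strictMono.injective hc]

lemma range_pos (hD : (component seam m pos sub).IsOrdered) :
    Set.range pos = (component seam m pos sub).coord ''
      {i | i ∈ (component seam m pos sub).labels} := by
  ext x
  constructor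
  · rintro ⟨c, rfl⟩
    obtain ⟨i, hi⟩ := (hD.stable.child c).exists_mem_labels
    exact ⟨i, (mem_labels_iff_coord hD).1 hi⟩
  · rintro ⟨i, hi, rfl⟩
    obtain ⟨c, hc⟩ := mem_labels_component.1 hi
    exact ⟨c, (coord_of_mem hD.sorted hc).symm⟩

lemma exists_lt_of_two_le (hD : (component seam m pos sub).IsOrdered) (hm : 2 ≤ m) :
    ∃ i j, i ∈ (component seam m pos sub).labels ∧ j ∈ (component seam m pos sub).labels ∧
      i < j ∧ (component seam m pos sub).coord i < (component seam m pos sub).coord j := by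
  have h01 : (⟨0, by omega⟩ : Fin m) < ⟨1, by omega⟩ := Nat.zero_lt_one
  obtain ⟨i, hi⟩ := (hD.stable.child ⟨0, by omega⟩).exists_mem_labels
  obtain ⟨j, hj⟩ := (hD.stable.child ⟨1, by omega⟩).exists_mem_labels
  refine ⟨i, j, mem_labels_component.2 ⟨_, hi⟩, mem_labels_component.2 ⟨_, hj⟩,
    labels_lt hD.sorted h01 hi hj, ?_⟩
  rw [coord_of_mem hD.sorted hi, coord_of_mem hD.sorted hj]
  exact hD.stable.strictMono h01

lemma Realizes.root (hR : (component seam m pos sub).Realizes d)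
    (hD : (component seam m pos sub).IsOrdered) (hm : 2 ≤ m) {p q : Fin n}
    (hp : p ∈ (component seam m pos sub).labels) (hq : q ∈ (component seam m pos sub).labels)
    (hpq : ∀ i ∈ (component seam m pos sub).labels, p ≤ i ∧ i ≤ q) :
    0 < (component seam m pos sub).coord q - (component seam m pos sub).coord p ∧
    (∀ i ∈ (component seam m pos sub).labels, (component seam m pos sub).coord i =
      (component seam m pos sub).coord p + d.1 p q i *
        ((component seam m pos sub).coord q - (component seam m pos sub).coord p)) ∧
    p < q ∧ d.2 p q = heightRatio (component seam m pos sub).height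
      ((component seam m pos sub).coord q - (component seam m pos sub).coord p) := by
  have hself : IsSub (component seam m pos sub) (component seam m pos sub) := Or.inl rfl
  obtain ⟨i, j, hi, hj, hij, hlt⟩ := exists_lt_of_two_le hD hm
  have h1 := hself.coord_le hD hp hi (hpq i hi).1
  have h2 := hself.coord_le hD hj hq (hpq j hj).2
  have hlt' : p < q := (hpq i hi).1.trans_lt (hij.trans_le (hpq j hj).2)
  have h3 := (hlt.trans_le h2)
  have h4 := h1.trans_lt h3
  obtain ⟨h5, h6⟩ := hR _ hself p q hlt' ((hself.meetsAt_iff hD).2 ⟨hp, hq, h4.ne⟩)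
  exact ⟨sub_pos.2 h4, fun i hi => h5 i (hpq i hi).1 (hpq i hi).2, hlt', h6⟩

/-- Without a seam, stability requires two branches, and each of them carries a marking. -/
lemma IsOrdered.labels_ne_singleton (hD : (component seam m pos sub).IsOrdered)
    (hc : (component seam m pos sub).SeamsOnPaths 0) (i : Fin n) :
    (component seam m pos sub).labels ≠ [i] := by
  intro hl
  cases seam with
  | some y =>
    obtain ⟨j, hj, -⟩ := hc
    omega
  | none =>
    obtain ⟨i', j', hi', hj', hij, -⟩ := exists_lt_of_two_le hD hD.stable.1
    rw [hl, List.mem_singleton] at hi' hj'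
    exact hij.ne (hi'.trans hj'.symm)

lemma height_none_of_seamsOnPaths (hs : (component none m pos sub).IsStable)
    (hc : (component none m pos sub).SeamsOnPaths 1) : (component none m pos sub).height = 0 :=
  if_pos ⟨⟨0, hs.one_le⟩, (hc _).hasSeam (hs.child _)⟩

lemma heightRatio_height_pos (hs : (component seam m pos sub).IsStable)
    (hc : (component seam m pos sub).SeamsOnPaths 1) {L : ℝ} (hL : 0 < L) :
    0 < heightRatio (component seam m pos sub).height L := by
  cases seam with
  | none => simp [height_none_of_seamsOnPaths hs hc, heightRatio_zero]
  | some y =>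
    have hy : 0 < y := hs.1
    rw [height, heightRatio_coe hy]
    positivity

lemma Realizes.eq_zero {D : NodalDisk n} (hR : D.Realizes d) (hD : D.IsOrdered)
    (hc : D.SeamsOnPaths 0) {p q : Fin n} (hp : p ∈ D.labels) (hq : q ∈ D.labels) (hpq : p < q) :
    d.2 p q = 0 := by
  obtain ⟨E, hE, hm⟩ := hD.exists_meetsAt hp hq hpq.ne
  rw [(hR E hE p q hpq hm).2, hE.height_eq_top hc.not_hasSeam, heightRatio_top]

lemma Realizes.child (hR : (component seam m pos sub).Realizes d) (c : Fin m) :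
    (sub c).Realizes d := fun E hE => hR E (Or.inr ⟨c, hE⟩)

lemma IsOrdered.exists_bounds {D : NodalDisk n} (hD : D.IsOrdered) :
    ∃ p ∈ D.labels, ∃ q ∈ D.labels, ∀ i ∈ D.labels, p ≤ i ∧ i ≤ q := by
  obtain ⟨i, hi⟩ := hD.stable.exists_mem_labels
  have hne : D.labels.toFinset.Nonempty := ⟨i, List.mem_toFinset.2 hi⟩
  exact ⟨_, List.mem_toFinset.1 (Finset.min'_mem _ hne), _,
    List.mem_toFinset.1 (Finset.max'_mem _ hne), fun j hj =>
      ⟨Finset.min'_le _ _ (List.mem_toFinset.2 hj), Finset.le_max' _ _ (List.mem_toFinset.2 hj)⟩⟩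

/-- A root component with a single child is quilted, so all separations happen beyond the seam and
`w = 0` for the extreme markings. A root component that separates them, with the seam on it or
further out, gives `w > 0`. -/
lemma Realizes.two_le (hR : (component seam m pos sub).Realizes d)
    (hR' : (component seam' m' pos' sub').Realizes d) (hD : (component seam m pos sub).IsOrdered)
    (hD' : (component seam' m' pos' sub').IsOrdered) {k : ℕ} (hk : k ≤ 1)
    (hc : (component seam m pos sub).SeamsOnPaths k)
    (hc' : (component seam' m' pos' sub').SeamsOnPaths k)
    (hl : (component seam m pos sub).labels = (component seam' m' pos' sub').labels)
    (hm : 2 ≤ m) : 2 ≤ m' := by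
  cases seam' with
  | none => exact hD'.stable.1
  | some y' =>
    by_contra hlt
    have h1 : m' = 1 := by
      have := hD'.stable.one_le
      omega
    subst h1
    obtain ⟨j, rfl, hsub⟩ := hc'
    obtain rfl : j = 0 := by omega
    obtain ⟨p, hp, q, hq, hpq⟩ := hD.exists_bounds
    obtain ⟨hL, -, hlt, hw⟩ := hR.root hD hm hp hq hpq
    have hmem : ∀ i ∈ (component seam m pos sub).labels, i ∈ (sub' 0).labels := by
      intro i hi
      rw [hl, mem_labels_component] at hi
      obtain ⟨c, hc⟩ := hi
      rwa [Subsingleton.elim c 0] at hc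
    rw [(hR'.child 0).eq_zero (hD'.child 0) (hsub 0) (hmem p hp) (hmem q hq) hlt] at hw
    exact (heightRatio_height_pos hD.stable hc hL).ne hw

/-- The affine map is the one that matches the coordinates of the extreme markings; equality of
ratios makes it match all the others. Equality of `w` compares the heights. -/
lemma Realizes.exists_affine (hR : (component seam m pos sub).Realizes d)
    (hR' : (component seam' m' pos' sub').Realizes d) (hD : (component seam m pos sub).IsOrdered)
    (hD' : (component seam' m' pos' sub').IsOrdered)
    (hl : (component seam m pos sub).labels = (component seam' m' pos' sub').labels)
    (hm : 2 ≤ m) (hm' : 2 ≤ m') : ∃ a b L : ℝ, 0 < a ∧ 0 < L ∧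
      (∀ i ∈ (component seam m pos sub).labels, (component seam' m' pos' sub').coord i =
        a * (component seam m pos sub).coord i + b) ∧
      heightRatio (component seam m pos sub).height L =
        heightRatio (component seam' m' pos' sub').height (a * L) := by
  obtain ⟨p, hp, q, hq, hpq⟩ := hD.exists_bounds
  obtain ⟨hL, hz, -, hw⟩ := hR.root hD hm hp hq hpq
  rw [hl] at hp hq hpq
  obtain ⟨hL', hz', -, hw'⟩ := hR'.root hD' hm' hp hq hpq
  rw [hw] at hw'
  generalize (component seam m pos sub).coord = u at *
  generalize (component seam' m' pos' sub').coord = u' at *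
  refine ⟨(u' q - u' p) / (u q - u p), u' p - (u' q - u' p) / (u q - u p) * u p, u q - u p,
    div_pos hL' hL, hL, fun i hi => ?_, ?_⟩
  · rw [hz' i (hl ▸ hi), hz i hi]
    field_simp
    ring
  · rw [div_mul_cancel₀ _ hL.ne', hw']

end

/-- Nodal quilted disks with the same markings and the same ratios are isomorphic. -/
lemma Realizes.iso {D D' : NodalDisk n} {k : ℕ} (hk : k ≤ 1) (hD : D.IsOrdered)
    (hD' : D'.IsOrdered) (hl : D.labels = D'.labels) (hc : D.SeamsOnPaths k)
    (hc' : D'.SeamsOnPaths k) (hR : D.Realizes d) (hR' : D'.Realizes d) : Iso D D' := by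
  induction D generalizing D' k with
  | marking i =>
    obtain rfl : k = 0 := hc
    cases D' with
    | marking j =>
      obtain rfl : i = j := by simpa [labels] using hl
      exact .marking i
    | component seam m pos sub => exact absurd hl.symm (hD'.labels_ne_singleton hc' i)
  | component seam m pos sub ih =>
    cases D' with
    | marking j =>
      obtain rfl : k = 0 := hc'
      exact absurd hl (hD.labels_ne_singleton hc j)
    | component seam' m' pos' sub' =>
    by_cases hm : 2 ≤ m
    · have hm' := hR.two_le hR' hD hD' hk hc hc' hl hm
      obtain ⟨a, b, L, ha, hL, hcoord, hw⟩ := hR.exists_affine hR' hD hD' hl hm hm'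
      have hmono : StrictMono fun c => a * pos c + b := fun c c' h => by
        have := hD.stable.strictMono h
        simp only
        gcongr
      have hrange : Set.range (fun c => a * pos c + b) = Set.range pos' := by
        rw [range_pos hD', ← hl, Set.image_congr (s := {i | i ∈ (component seam m pos sub).labels})
          hcoord]
        change Set.range ((fun x => a * x + b) ∘ pos) = _
        rw [Set.range_comp, range_pos hD, Set.image_image]
      obtain rfl : m = m' := by
        have := Fintype.card_congr ((Equiv.ofInjective _ hmono.injective).trans
          ((Equiv.setCongr hrange).trans
            (Equiv.ofInjective _ hD'.stable.strictMono.injective).symm))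
        simpa using this
      have hpos := fun c => (congrFun ((hmono.range_inj hD'.stable.strictMono).1 hrange) c).symm
      have hlab : ∀ c, (sub c).labels = (sub' c).labels := by
        refine fun c => List.eq_of_pairwise_lt (hD.child c).sorted (hD'.child c).sorted fun i => ?_
        rw [mem_labels_iff_coord hD, mem_labels_iff_coord hD', ← hl]
        refine and_congr_right fun hi => ?_
        rw [hcoord i hi, hpos c, add_left_inj, mul_right_inj' ha.ne']
      cases seam with
      | none =>
        cases seam' with
        | none =>
          exact .component a b ha rfl hpos fun c => ih c hk (hD.child c) (hD'.child c) (hlab c)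
            (hc c) (hc' c) (hR.child c) (hR'.child c)
        | some y' =>
          have hy' : 0 < y' := hD'.stable.1
          obtain ⟨j, rfl, hsub⟩ := hc'
          obtain rfl : j = 0 := by omega
          rw [height_none_of_seamsOnPaths hD.stable hc, heightRatio_zero, height,
            heightRatio_coe hy', eq_div_iff (by positivity)] at hw
          linarith
      | some y =>
        have hy : 0 < y := hD.stable.1
        obtain ⟨j, rfl, hsub⟩ := hc
        obtain rfl : j = 0 := by omega
        cases seam' with
        | none =>
          rw [height_none_of_seamsOnPaths hD'.stable hc', heightRatio_zero, height,
            heightRatio_coe hy, div_eq_iff (by positivity)] at hw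
          linarith
        | some y' =>
          have hy' : 0 < y' := hD'.stable.1
          obtain ⟨j', hj', hsub'⟩ := hc'
          obtain rfl : j' = 0 := by omega
          rw [height, height, heightRatio_coe hy, heightRatio_coe hy',
            div_eq_div_iff (by positivity) (by positivity)] at hw
          -- The equation reads `L / (L + y) = a L / (a L + y')`, so the same affine map carries one
          -- seam to the other.
          have hyy : y' = a * y := mul_left_cancel₀ hL.ne' (by linarith)
          exact .component a b ha (by rw [hyy]; rfl) hpos fun c => ih c zero_le_one (hD.child c)
            (hD'.child c) (hlab c) (hsub c) (hsub' c) (hR.child c) (hR'.child c)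
    · have hm' := mt (hR'.two_le hR hD' hD hk hc' hc hl.symm) hm
      obtain rfl : m = 1 := by
        have := hD.stable.one_le
        omega
      obtain rfl : m' = 1 := by
        have := hD'.stable.one_le
        omega
      cases seam with
      | none => exact absurd hD.stable.1 (by omega)
      | some y =>
        cases seam' with
        | none => exact absurd hD'.stable.1 (by omega)
        | some y' =>
          have hy : 0 < y := hD.stable.1
          have hy' : 0 < y' := hD'.stable.1
          obtain ⟨j, rfl, hsub⟩ := hc
          obtain ⟨j', hj', hsub'⟩ := hc'
          obtain rfl : j = 0 := by omega
          obtain rfl : j' = 0 := by omega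
          -- With one finite special point and one seam there is exactly one affine map: the scaling
          -- is fixed by the seam and the translation by the point.
          refine .component (y' / y) (pos' 0 - y' / y * pos 0) (div_pos hy' hy) ?_
            (fun c => ?_) fun c => ih c zero_le_one (hD.child c)
            (hD'.child c) ?_ (hsub c) (hsub' c) (hR.child c) (hR'.child c)
          · rw [Option.map_some, div_mul_cancel₀ _ hy.ne']
          · rw [Subsingleton.elim c 0]
            ring
          · rw [Subsingleton.elim c 0]
            simpa [labels, List.finRange_succ] using hl

end NodalDisk

/-! ### The homeomorphism -/

lemma StableQuiltedDisk.isOrdered {n : ℕ} (S : StableQuiltedDisk n) : S.disk.IsOrdered where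
  stable := S.stable
  sorted := by
    rw [S.labels_eq]
    exact List.pairwise_lt_finRange n
  connected := by simp [S.labels_eq]

namespace RatioSpace

variable {n : ℕ}

lemma exists_stableQuiltedDisk (hn : 0 < n) (d : RatioSpace n) :
    ∃ S : StableQuiltedDisk n, S.disk.Realizes d.1 := by
  obtain ⟨D, hlab, hR, hs, hc⟩ := NodalDisk.exists_quilted d.2 (n - 1) 0 (n - 1) (Nat.zero_le _)
    (by omega) rfl
  refine ⟨⟨D, hs, hc, ?_⟩, hR⟩
  rw [hlab, NodalDisk.intervalLabels, List.filter_eq_self]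
  intro i _
  simp
  omega

/-- The isomorphism class of nodal quilted disks with a given system of ratios. -/
noncomputable def toModuli (hn : 0 < n) (d : RatioSpace n) : QuiltedModuli n :=
  Quotient.mk _ (exists_stableQuiltedDisk hn d).choose

lemma rho_toModuli (hn : 0 < n) (d : RatioSpace n) :
    QuiltedModuli.rho n (toModuli hn d) = ratioRho n d.1 := by
  have hS := (exists_stableQuiltedDisk hn d).choose_spec
  set S := (exists_stableQuiltedDisk hn d).choose with hdef
  exact hS.rho_eq d.2 S.isOrdered S.colored fun i => by simp [S.labels_eq]

lemma toModuli_bijective (hn : 0 < n) : Function.Bijective (toModuli (n := n) hn) := by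
  constructor
  · intro d d' h
    refine Subtype.ext (ratioRho_injective d.2 d'.2 ?_)
    rw [← rho_toModuli hn, ← rho_toModuli hn, h]
  · intro S
    induction S using Quotient.inductionOn with
    | h S =>
      obtain ⟨d, hY, hR⟩ := S.isOrdered.exists_realizes S.colored fun i => by simp [S.labels_eq]
      refine ⟨⟨d, hY⟩, Quotient.sound ?_⟩
      have hS' := (exists_stableQuiltedDisk hn ⟨d, hY⟩).choose_spec
      set S' := (exists_stableQuiltedDisk hn ⟨d, hY⟩).choose
      exact NodalDisk.Realizes.iso le_rfl S'.isOrdered S.isOrdered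
        (S'.labels_eq.trans S.labels_eq.symm) S'.colored S.colored hS' hR

lemma continuous_toModuli (hn : 0 < n) : Continuous (toModuli (n := n) hn) := by
  refine continuous_induced_rng.2 ?_
  have : QuiltedModuli.rho n ∘ toModuli hn = fun d => ratioRho n d.1 := funext (rho_toModuli hn)
  rw [this]
  exact (continuous_ratioRho n).comp continuous_subtype_val

/-- The topology is induced by the cross-ratios, so their injectivity is what makes the moduli space
Hausdorff. -/
lemma rho_injective (hn : 0 < n) : Function.Injective (QuiltedModuli.rho n) := by
  intro S S' h
  obtain ⟨d, rfl⟩ := (toModuli_bijective hn).2 S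
  obtain ⟨d', rfl⟩ := (toModuli_bijective hn).2 S'
  rw [rho_toModuli, rho_toModuli] at h
  rw [Subtype.ext (ratioRho_injective d.2 d'.2 h)]

/-- The moduli space of nodal quilted disks is the space of systems of ratios. -/
noncomputable def moduliHomeomorph (hn : 0 < n) : RatioSpace n ≃ₜ QuiltedModuli n :=
  have : T2Space (QuiltedModuli n) :=
    .of_injective_continuous (rho_injective hn) continuous_induced_dom
  (continuous_toModuli hn).homeoOfEquivCompactToT2
    (f := Equiv.ofBijective _ (toModuli_bijective hn))

end RatioSpace

/-- For every ordering `T₁, …, T_k` of the maximal colored trees with `n` leaves, the moduli space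
of stable `n + 1`-marked nodal quilted disks is homeomorphic to the non-negative part of the
projective toric variety given by the weight vectors of these trees. -/
theorem mainTheorem3 (n : ℕ) (hn : 2 ≤ n)
    (T : Fin (Nat.card (MaximalColoredTree n)) ≃ MaximalColoredTree n) :
    Nonempty (QuiltedModuli n ≃ₜ nonnegPart (toricVariety T)) :=
  ⟨(RatioSpace.moduliHomeomorph (by omega)).symm.trans (toricHomeomorph (by omega) T)⟩
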